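/- **Theorem (error threshold for Heisenberg-limited sensing).** Consider estimating $\theta$ from the signal $U_\theta=e^{-i\theta H}$, $H=\sum_{i=1}^n Z_i/2$, acting instantaneously and noiselessly on $n$ probe qubits, where all other operations are noisy as follows, all error events being independent. In every time step, each qubit that undergoes a gate or idles then suffers a Pauli $X$ with probability $p$. Each qubit to be prepared in $|0\rangle$ (or $|+\rangle$) is prepared in $|1\rangle$ (or $|-\rangle$) instead with probability $p_{\rm prep}$. Each reported single-qubit measurement result (in the $Z$ or $X$ basis) is flipped with probability $q$. Classical processing is noiseless. Given integers $r,T\ge 0$ and a minimum-weight decoder, the protocol $\mathcal P_n(r,T)$ on $n$ probe qubits and $n$ ancilla qubits is: 1. Prepare all probes in $|+\rangle$. Repeat $r$ times: prepare $n$ ancillas in $|+\rangle$, apply CNOTs from ancilla $i$ to probe $i$ for all $i$, measure the ancillas in the $X$ basis. Apply $Z$ to each probe for which more than half of the $r$ results are $-1$. 2. Perform $T$ rounds of syndrome measurement of the repetition-code checks $Z_kZ_{k+1}$, $1\le k\le n-1$: prepare measure qubits in $|0\rangle$; apply in parallel CNOTs from probe $k$ to measure qubit $k$ for all $k$; then CNOTs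 from probe $k+1$ to measure qubit $k$ for all $k$; measure the measure qubits in the $Z$ basis. The decoder takes the matching graph whose detectors are the differences (mod 2) of the reported values of a check in consecutive rounds, with one space-like edge for each probe and each pair of consecutive rounds, and one time-like edge for each check and each round (edges touching only one detector are half-edges). It finds a set of edges of minimum cardinality that accounts for all defects, corrects the last reported syndrome by the time-like edges of the last round in this set, and returns a pattern of bit flips with this corrected syndrome; ties are broken in any way. Apply $X$ to the probes in this pattern. 3. Apply the phase gate $S=\mathrm{diag}(1,i)$ to one uniformly random probe. 4. Let the signal $U_\theta$ act on the probes. 5. Measure every $X_i$ by $r$ repetitions of the ancilla-assisted measurement of step 1 with majority vote, and output the product $x\in\{+1,-1\}$ of the $n$ voted values. Let $\mathscr P_n(x;\theta)$ be the probability of output $x$ and $\mathcal F_n(\theta)=\sum_{x=\pm1}\mathscr P_n(x;\theta)\,(\partial_\theta\ln\mathscr P_n(x;\theta))^2$ its classical Fisher information. For all constants $a,b>0$ there are thresholds $p^{\rm th},q^{\rm th},p_{\rm prep}^{\rm th}>0$ such that for all error rates $0\le p<p^{\rm th}$, $0\le q<q^{\rm th}$, $0\le p_{\rm prep}<p_{\rm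 prep}^{\rm th}$ and every choice of minimum-weight decoders, the protocol $\mathcal P_n(r,T)$ with $r=\lceil a\ln n\rceil$ and $T=\lceil b\ln n\rceil$ satisfies $$\mathcal F_n(0)=\Theta(n^2)\qquad(n\to\infty).$$ -/

import Mathlib

open Filter Asymptotics

noncomputable section

namespace FTSensing

/-! ### Registers, operators and gates -/

/-- The register: `n` probe (data) qubits and `n` ancilla qubits, which are reset before every use. -/
abbrev Qubit (n : ℕ) : Type := Fin n ⊕ Fin n

/-- The `i`-th probe qubit. -/
abbrev data {n : ℕ} (i : Fin n) : Qubit n := Sum.inl i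

/-- The `i`-th ancilla qubit. -/
abbrev anc {n : ℕ} (i : Fin n) : Qubit n := Sum.inr i

/-- Operators on the Hilbert space of the register, as matrices in the computational basis
(`false` is the ket 0 and `true` the ket 1 of a qubit). -/
abbrev Operator (n : ℕ) : Type := Matrix (Qubit n → Bool) (Qubit n → Bool) ℂ

/-- The tensor product of single-qubit operators. -/
def tensor {n : ℕ} (M : Qubit n → Matrix Bool Bool ℂ) : Operator n :=
  Matrix.of fun a b => ∏ q, M q (a q) (b q)

/-- Single-qubit gates; `idle` is the identity (wait) operation. -/
inductive Gate : Type
  | idle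
  | X
  | Z
  | S

/-- The unitary of a single-qubit gate: `X` is the bit flip, `Z = diag(1, -1)`, `S = diag(1, i)`. -/
def Gate.matrix : Gate → Matrix Bool Bool ℂ
  | .idle => 1
  | .X => Matrix.of fun a b => if a = b then 0 else 1
  | .Z => Matrix.diagonal fun b => if b then -1 else 1
  | .S => Matrix.diagonal fun b => if b then Complex.I else 1

/-- The operator that applies the gate `g` to each qubit of `F` and the identity elsewhere. -/
def onSet {n : ℕ} (F : Finset (Qubit n)) (g : Gate) : Operator n :=
  tensor fun q => if q ∈ F then g.matrix else 1

/-- A parallel layer of CNOT gates on disjoint pairs of qubits: `ctrl t = some c` if the layer has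
a CNOT with control `c` and target `t`, and `ctrl t = none` if `t` is not a target. -/
def cnotLayer {n : ℕ} (ctrl : Qubit n → Option (Qubit n)) : Operator n :=
  Matrix.of fun a b => if a = (fun q => xor (b q) ((ctrl q).elim false b)) then 1 else 0

/-- Bases for single-qubit state preparation and measurement. -/
inductive Basis : Type
  | z
  | x

/-- Amplitudes of the basis kets: `ket z m` is the ket `m`, `ket x false` is the ket `+` and
`ket x true` is the ket `-`. Label `true` thus means eigenvalue `-1`. -/
def Basis.ket : Basis → Bool → Bool → ℂ
  | .z, m, b => if b = m then 1 else 0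
  | .x, m, b => (if m && b then -1 else 1) / ((Real.sqrt 2 : ℝ) : ℂ)

/-- The signal Hamiltonian: half the sum of the Pauli `Z` operators of the probe qubits. -/
def hamiltonian (n : ℕ) : Operator n :=
  ∑ i : Fin n, (1 / 2 : ℂ) • onSet {data i} Gate.Z

/-- The signal unitary `exp(-i θ H)`. -/
def signal (n : ℕ) (θ : ℝ) : Operator n :=
  NormedSpace.exp ((-(Complex.I * (θ : ℂ))) • hamiltonian n)

/-- `ρ ↦ K ρ K†`. -/
def conj {n : ℕ} (K ρ : Operator n) : Operator n := K * ρ * K.conjTranspose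

/-! ### Circuit-level bit-flip noise -/

/-- Physical error rates: `p` for a bit flip at a gate or idle location, `q` for a flip of a
reported measurement result, `pprep` for a preparation in the orthogonal state. -/
structure NoiseRates : Type where
  p : ℝ
  q : ℝ
  pprep : ℝ

/-- Probability that, among independent events indexed by `S` of probability `r` each, exactly
those in `F` happen. -/
def weight {n : ℕ} (r : ℝ) (S F : Finset (Qubit n)) : ℝ :=
  r ^ F.card * (1 - r) ^ (S \ F).card

/-- Each qubit of `S` independently suffers a Pauli `X` with probability `r`. -/
def bitFlips {n : ℕ} (r : ℝ) (S : Finset (Qubit n)) (ρ : Operator n) : Operator n :=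
  ∑ F ∈ S.powerset, (weight r S F : ℂ) • conj (onSet F Gate.X) ρ

/-- Discard the qubits of `S` and replace them by fresh ones, those in `E` in the state
`B.ket true` and the others in the state `B.ket false`. The sum over `O` is the partial trace. -/
def reset {n : ℕ} (S : Finset (Qubit n)) (B : Basis) (E : Finset (Qubit n)) (ρ : Operator n) :
    Operator n :=
  ∑ O ∈ S.powerset, conj (tensor fun q =>
    if q ∈ S then
      Matrix.vecMulVec (B.ket (decide (q ∈ E))) (star (Basis.z.ket (decide (q ∈ O))))
    else 1) ρ

/-- Noisy preparation of every qubit of `S` in the state `B.ket false`: each is independently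
prepared in `B.ket true` with probability `r` instead. -/
def noisyPrepare {n : ℕ} (r : ℝ) (S : Finset (Qubit n)) (B : Basis) (ρ : Operator n) :
    Operator n :=
  ∑ E ∈ S.powerset, (weight r S E : ℂ) • reset S B E ρ

/-- The unnormalised state after measuring each qubit of `S` in the basis `B` with *true* results
`-1` exactly on `O`. -/
def project {n : ℕ} (S : Finset (Qubit n)) (B : Basis) (O : Finset (Qubit n)) (ρ : Operator n) :
    Operator n :=
  conj (tensor fun q =>
    if q ∈ S then
      Matrix.vecMulVec (B.ket (decide (q ∈ O))) (star (B.ket (decide (q ∈ O))))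
    else 1) ρ

/-- The unnormalised state after measuring each qubit of `S` in the basis `B` with *reported*
results `-1` exactly on `R`; each report is independently wrong with probability `r`. -/
def noisyMeasure {n : ℕ} (r : ℝ) (S : Finset (Qubit n)) (B : Basis) (R : Finset (Qubit n))
    (ρ : Operator n) : Operator n :=
  ∑ O ∈ S.powerset, (weight r S (symmDiff O R) : ℂ) • project S B O ρ

/-- Adaptive sensing protocols with a binary output. Each of the constructors `prepare`, `gates`,
`cnots`, `measure` is one time step of the whole register; qubits that it does not mention idle. -/
inductive Protocol (n : ℕ) : Type
  /-- stop and output a bit -/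
  | output (x : Bool) : Protocol n
  /-- prepare the qubits of `S` in the first state of the basis `B` -/
  | prepare (S : Finset (Qubit n)) (B : Basis) (next : Protocol n) : Protocol n
  /-- apply the single-qubit gate `g q` to each qubit `q` -/
  | gates (g : Qubit n → Gate) (next : Protocol n) : Protocol n
  /-- apply a parallel layer of CNOT gates -/
  | cnots (ctrl : Qubit n → Option (Qubit n)) (next : Protocol n) : Protocol n
  /-- measure the qubits of `S` in the basis `B`; continue depending on the set of those qubits
  whose reported result is `-1` -/
  | measure (S : Finset (Qubit n)) (B : Basis) (next : Finset (Qubit n) → Protocol n) : Protocol n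
  /-- choose a number below `N` uniformly at random -/
  | random (N : ℕ) (next : Fin N → Protocol n) : Protocol n
  /-- let the signal act on the probe qubits (instantaneously, without noise) -/
  | sense (next : Protocol n) : Protocol n

/-- The probability (times the trace of the initial state) that a protocol started in the state `ρ`
outputs `x` when the parameter is `θ` and every location is subject to the circuit-level noise:
after a gate or idle step each qubit suffers a bit flip with probability `p`; preparations and
measurement reports fail with probabilities `pprep` and `q`; all events are independent. -/
def run {n : ℕ} (η : NoiseRates) (θ : ℝ) : Protocol n → Operator n → Bool → ℝ
  | .output y, ρ, x => if x = y then (Matrix.trace ρ).re else 0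
  | .prepare S B next, ρ, x => run η θ next (bitFlips η.p Sᶜ (noisyPrepare η.pprep S B ρ)) x
  | .gates g next, ρ, x =>
      run η θ next (bitFlips η.p Finset.univ (conj (tensor fun q => (g q).matrix) ρ)) x
  | .cnots ctrl next, ρ, x =>
      run η θ next (bitFlips η.p Finset.univ (conj (cnotLayer ctrl) ρ)) x
  | .measure S B next, ρ, x =>
      ∑ R ∈ S.powerset, run η θ (next R) (bitFlips η.p Sᶜ (noisyMeasure η.q S B R ρ)) x
  | .random N next, ρ, x => (∑ j : Fin N, run η θ (next j) ρ x) / N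
  | .sense next, ρ, x => run η θ next (conj (signal n θ) ρ) x

/-! ### Minimum-weight decoding of repeated syndrome measurements of the repetition code -/

/-- The first qubit of the check `Z_k Z_{k+1}`. -/
def left {n : ℕ} (k : Fin (n - 1)) : Fin n := ⟨k, by omega⟩

/-- The second qubit of the check `Z_k Z_{k+1}`. -/
def right {n : ℕ} (k : Fin (n - 1)) : Fin n := ⟨k + 1, by omega⟩

/-- The checks violated by a pattern of bit flips. -/
def boundary {n : ℕ} (e : Fin n → ZMod 2) (k : Fin (n - 1)) : ZMod 2 := e (left k) + e (right k)

/-- A syndrome history: entry `s t k` is the reported value of check `k` in round `t`. -/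
abbrev History (n : ℕ) : Type := ℕ → Fin (n - 1) → ZMod 2

/-- A chain in the space-time matching graph: `space t i = 1` is the space-like edge "qubit `i`
flips between rounds `t` and `t + 1`"; `time t k = 1` is the time-like edge "the report of check
`k` in round `t` is wrong". -/
structure Chain (n : ℕ) : Type where
  space : ℕ → Fin n → ZMod 2
  time : ℕ → Fin (n - 1) → ZMod 2

/-- The chain accounts for all defects of `T` rounds. A detector is the difference of the reported
values of a check in two consecutive rounds. The values before the first round are unconstrained, so
time-like edges of the first and of the last round, and space-like edges of the two outermost
qubits, are half-edges. -/
def Chain.Explains {n : ℕ} (c : Chain n) (T : ℕ) (s : History n) : Prop :=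
  ∀ t, t + 1 < T → ∀ k,
    s (t + 1) k + s t k = boundary (c.space t) k + c.time (t + 1) k + c.time t k

/-- The number of edges of a chain in the matching graph of `T` rounds. -/
def Chain.length {n : ℕ} (c : Chain n) (T : ℕ) : ℕ :=
  (∑ t ∈ Finset.range (T - 1), (Finset.univ.filter fun i => c.space t i ≠ 0).card) +
    ∑ t ∈ Finset.range T, (Finset.univ.filter fun k => c.time t k ≠ 0).card

/-- The chain is a shortest one that accounts for all defects. -/
def Chain.IsMinimal {n : ℕ} (c : Chain n) (T : ℕ) (s : History n) : Prop :=
  c.Explains T s ∧ ∀ c' : Chain n, c'.Explains T s → c.length T ≤ c'.length T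

/-- A minimum-weight decoder, with any rule for ties: it finds a shortest chain that accounts for
the defects, corrects the last reported syndrome by the time-like edges of the last round, and
returns a pattern of bit flips with the corrected syndrome. -/
structure MinWeightDecoder (n : ℕ) : Type where
  correction : ℕ → History n → Fin n → ZMod 2
  spec : ∀ T s, ∃ c : Chain n, c.IsMinimal T s ∧
    ∀ k, boundary (correction T s) k = s (T - 1) k + c.time (T - 1) k

theorem exists_isMinimal {n : ℕ} (T : ℕ) (s : History n) : ∃ c : Chain n, c.IsMinimal T s := by
  have h0 : ∃ c : Chain n, c.Explains T s :=
    ⟨⟨fun _ _ => 0, s⟩, fun t _ k => by simp [boundary]⟩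
  have hne : ∃ m, ∃ c : Chain n, c.Explains T s ∧ c.length T = m := by
    obtain ⟨c, hc⟩ := h0
    exact ⟨_, c, hc, rfl⟩
  classical
  obtain ⟨c, hc, hm⟩ := Nat.find_spec hne
  exact ⟨c, hc, fun c' hc' => hm.le.trans (Nat.find_min' hne ⟨c', hc', rfl⟩)⟩

theorem boundary_surjective {n : ℕ} (v : Fin (n - 1) → ZMod 2) :
    ∃ e : Fin n → ZMod 2, ∀ k, boundary e k = v k := by
  refine ⟨fun i => ∑ j ∈ Finset.range i.1, if h : j < n - 1 then v ⟨j, h⟩ else 0, fun k => ?_⟩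
  have h2 : ∀ a b : ZMod 2, a + (a + b) = b := by decide
  simp [boundary, left, right, Finset.sum_range_succ, h2]

instance (n : ℕ) : Nonempty (MinWeightDecoder n) := by
  have h : ∀ (T : ℕ) (s : History n), ∃ e : Fin n → ZMod 2, ∃ c : Chain n, c.IsMinimal T s ∧
      ∀ k, boundary e k = s (T - 1) k + c.time (T - 1) k := fun T s => by
    obtain ⟨c, hc⟩ := exists_isMinimal T s
    obtain ⟨e, he⟩ := boundary_surjective fun k => s (T - 1) k + c.time (T - 1) k
    exact ⟨e, c, hc, he⟩
  choose f hf using h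
  exact ⟨⟨f, hf⟩⟩

/-! ### The protocol -/

/-- All probe qubits. -/
def probes (n : ℕ) : Finset (Qubit n) := Finset.univ.image data

/-- All ancilla qubits. -/
def ancillas (n : ℕ) : Finset (Qubit n) := Finset.univ.image anc

/-- The ancilla qubits used to measure the checks: ancilla `k` for the check `Z_k Z_{k+1}`. -/
def measureQubits (n : ℕ) : Finset (Qubit n) := Finset.univ.image fun k : Fin (n - 1) => anc (left k)

/-- Apply `g i` to each probe qubit `i`; the ancillas idle. -/
def probeGates {n : ℕ} (g : Fin n → Gate) : Protocol n → Protocol n :=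
  Protocol.gates (Sum.elim g fun _ => Gate.idle)

/-- `m` rounds of ancilla-assisted non-destructive measurements of all `X_i`: ancilla `i` is
prepared in the ket `+`, controls a CNOT with target probe `i`, and is measured in the `X` basis.
The number of results `-1` for each probe qubit is added to the counter `c`. -/
def xRounds {n : ℕ} : ℕ → (Fin n → ℕ) → ((Fin n → ℕ) → Protocol n) → Protocol n
  | 0, c, next => next c
  | m + 1, c, next =>
      .prepare (ancillas n) .x <|
      .cnots (Sum.elim (fun i => some (anc i)) fun _ => none) <|
      .measure (ancillas n) .x fun R =>
        xRounds m (fun i => c i + if anc i ∈ R then 1 else 0) next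

/-- Majority vote among `r` results, of which `c` are `-1`; `true` stands for `-1`. -/
def majority (r c : ℕ) : Bool := decide (r < 2 * c)

/-- `m` further rounds of syndrome measurements, starting with round `t`: measure qubit `k` is
prepared in the ket 0, is the target of a CNOT with control probe `k` and then of one with control
probe `k + 1`, and is measured in the `Z` basis. The results are recorded in the history. -/
def syndromeRounds {n : ℕ} : ℕ → ℕ → History n → (History n → Protocol n) → Protocol n
  | 0, _, s, next => next s
  | m + 1, t, s, next =>
      .prepare (measureQubits n) .z <|
      .cnots (Sum.elim (fun _ => none) fun i => if i.1 + 1 < n then some (data i) else none) <|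
      .cnots (Sum.elim (fun _ => none) fun i =>
        if h : i.1 + 1 < n then some (data ⟨i.1 + 1, h⟩) else none) <|
      .measure (measureQubits n) .z fun R =>
        syndromeRounds m (t + 1)
          (Function.update s t fun k => if anc (left k) ∈ R then 1 else 0) next

/-- The sensing protocol with `r` repetitions of each `X` measurement and `T` rounds of syndrome
measurements: prepare the probes in the ket `+` and repair them by majority vote; project onto the
repetition code (up to bit flips) by syndrome measurements and apply the decoder's correction;
apply a phase gate to a uniformly random probe; sense; measure all `X_i` with majority vote and
output the parity (`true` for the value `-1` of the product). -/
def protocol {n : ℕ} (r T : ℕ) (D : MinWeightDecoder n) : Protocol n :=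
  .prepare (probes n) .x <|
  xRounds r (fun _ => 0) fun c =>
  probeGates (fun i => if majority r (c i) then .Z else .idle) <|
  syndromeRounds T 0 (fun _ _ => 0) fun s =>
  probeGates (fun i => if D.correction T s i = 1 then .X else .idle) <|
  .random n fun j =>
  probeGates (fun i => if i = j then .S else .idle) <|
  .sense <|
  xRounds r (fun _ => 0) fun c =>
  .output (decide (Odd (Finset.univ.filter fun i => majority r (c i) = true).card))

/-- The probability that the protocol outputs `x`. The initial state of the register is
irrelevant, since every qubit is prepared before its first use; we take all kets 0. -/
def outcomeProb {n : ℕ} (η : NoiseRates) (r T : ℕ) (D : MinWeightDecoder n) (x : Bool) (θ : ℝ) : ℝ :=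
  run η θ (protocol r T D) (Matrix.single (fun _ => false) (fun _ => false) 1) x

/-- The classical Fisher information of a family of distributions on two outcomes. -/
def fisherInformation (P : Bool → ℝ → ℝ) (θ : ℝ) : ℝ :=
  ∑ x : Bool, P x θ * (deriv (fun t => Real.log (P x t)) θ) ^ 2

end FTSensing

end

/-! The noise flips bits and never phases. In the Heisenberg picture a bit flip shifts the row and
the column of a matrix unit by the same string, so the difference `d` of the two indices is immune
to it (`flipObs_apply`). A protocol can therefore be followed as a function of the probe row `x` and
of `d` (`HasData`). A syndrome round annihilates every `d` except `⊥` and `⊤`, that is, it leaves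
populations and the coherences between complementary strings, and turns the faults into a classical
average. Rounds of `X` measurements act on functionals of product form one qubit at a time
(`xEvol`).

This gives a closed formula (`outcomeProb_eq`): the two outcomes have probabilities `1/2 ± (τ^n -
(κδ)^n S(θ))/2`. Here `τ` and `κ` are half the sum and half the difference of the mean votes on the
two eigenstates of `X`, `δ` is the mean agreement of the first vote with the true eigenvalue, and
`S(θ)` is the average of `signalTerm` over a uniform initial string. The random phase gate
contributes a factor `M/n` and the signal a factor `sin(θM)`, where `M` is the magnetisation of the
corrected string. Hence `S'(0) = (1 - 2p) E[M²]/n`. Only `M²` enters, so a logical flip, which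
exchanges a string and its complement, is harmless.

By `fisherInformation_eq` the Fisher information is the squared slope divided by `1 - τ^(2n)`. It is
of order `n²` once `E[M²] ≥ n²/2` and `(κδ)^n ≥ 1/2`; the upper bound follows from `|M| ≤ n`.

For the votes, a Chernoff bound (`walk_le`, `vote_bounds`) shows that `τ`, `1 - κ` and `1 - δ` are
`O((2/L)^r)`, which is `O(n^(-2))` for logarithmic `r` and small error rates.

For `E[M²]` there is a Peierls argument on the space-time matching graph. The sum of the decoder's
chain and the true chain is a cycle, and by minimality at least half of each of its connected
components consists of true errors (`card_le_two_mul_card_inter`). Connected sets of `m + 1` edges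
at a given edge number at most `25^(2m)`, and a given one is half filled with errors with
probability at most `(64/Λ)^(m+1)`, so such clusters are exponentially rare (`prob_bad_le`). If no
cluster is as long as the whole history, a probe deviates from the global flip only through a
cluster that joins it to the last round, or through a flip that no check sees (`residual_error`,
`residual_flips`). The expected fraction of such probes is a small constant, not `o(1)`, and that is
enough for `E[M²]`. -/

open Filter Asymptotics

noncomputable section

namespace FTSensing

open scoped symmDiff

/-! ### Averages over independent Bernoulli bits -/

section Bernoulli

variable {ι κ : Type*} [Fintype ι] [DecidableEq ι] [Fintype κ] [DecidableEq κ]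
  {V W : Type*} [AddCommGroup V] [Module ℝ V] [AddCommGroup W] [Module ℝ W]

/-- Probability of the pattern `f` of independent bits that are `true` with probabilities `r`. -/
def bernWeight (r : ι → ℝ) (f : ι → Bool) : ℝ := ∏ i, if f i then r i else 1 - r i

/-- Expectation of `g` over independent bits that are `true` with probabilities `r`. -/
def bern (r : ι → ℝ) (g : (ι → Bool) → V) : V := ∑ f, bernWeight r f • g f

theorem sum_pi_prod {α : Type*} [Fintype α] [DecidableEq α] {R : Type*} [CommRing R]
    (f : ι → α → R) : ∑ x : ι → α, ∏ i, f i (x i) = ∏ i, ∑ j, f i j := by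
  rw [Finset.prod_univ_sum, Fintype.piFinset_univ]

theorem sum_bernWeight (r : ι → ℝ) : ∑ f, bernWeight r f = 1 := by
  simp only [bernWeight]
  rw [sum_pi_prod (fun i (b : Bool) => if b = true then r i else 1 - r i)]
  simp

theorem bern_const (r : ι → ℝ) (v : V) : bern r (fun _ => v) = v := by
  simp [bern, ← Finset.sum_smul, sum_bernWeight]

theorem bern_map (φ : V →ₗ[ℝ] W) (r : ι → ℝ) (g : (ι → Bool) → V) :
    φ (bern r g) = bern r (fun f => φ (g f)) := by
  simp [bern]

theorem bern_add (r : ι → ℝ) (g h : (ι → Bool) → V) :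
    bern r (fun f => g f + h f) = bern r g + bern r h := by
  simp [bern, Finset.sum_add_distrib]

theorem bern_sum {α : Type*} (s : Finset α) (r : ι → ℝ) (g : α → (ι → Bool) → V) :
    bern r (fun f => ∑ x ∈ s, g x f) = ∑ x ∈ s, bern r (g x) := by
  simp only [bern, Finset.smul_sum]
  exact Finset.sum_comm

theorem bern_mul (r : ι → ℝ) (c : ℂ) (g : (ι → Bool) → ℂ) :
    bern r (fun f => c * g f) = c * bern r g := by
  simp only [bern, Finset.mul_sum, mul_smul_comm]

theorem bern_mul_real (r : ι → ℝ) (c : ℝ) (g : (ι → Bool) → ℝ) :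
    bern r (fun f => c * g f) = c * bern r g := by
  simp only [bern, Finset.mul_sum, mul_smul_comm]

theorem bern_elim (r : ι ⊕ κ → ℝ) (g : (ι ⊕ κ → Bool) → V) :
    bern r g = bern (r ∘ Sum.inl) fun f => bern (r ∘ Sum.inr) fun h => g (Sum.elim f h) := by
  simp only [bern, Finset.smul_sum, smul_smul]
  rw [← Fintype.sum_prod_type', ← (Equiv.sumArrowEquivProdArrow ι κ Bool).symm.sum_comp]
  refine Finset.sum_congr rfl fun x _ => ?_
  congr 1
  simp [bernWeight, Fintype.prod_sum_type, Equiv.sumArrowEquivProdArrow]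
  rfl

/-- Prepend a layer of bits. -/
def consBits {L : Type*} {m : ℕ} (f : L → Bool) (h : Fin m × L → Bool) : Fin (m + 1) × L → Bool :=
  fun p => Fin.cases (motive := fun _ => Bool) (f p.2) (fun t => h (t, p.2)) p.1

/-- Splitting off the first layer of bits. -/
def consBitsEquiv (L : Type*) (m : ℕ) :
    (L → Bool) × (Fin m × L → Bool) ≃ (Fin (m + 1) × L → Bool) where
  toFun x := consBits x.1 x.2
  invFun ω := (fun l => ω (0, l), fun p => ω (p.1.succ, p.2))
  left_inv x := rfl
  right_inv ω := by
    funext ⟨t, l⟩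
    cases t using Fin.cases <;> rfl

theorem bern_cons {m : ℕ} (r : Fin (m + 1) × ι → ℝ) (g : (Fin (m + 1) × ι → Bool) → V) :
    bern r g = bern (fun l => r (0, l)) fun f =>
      bern (fun p : Fin m × ι => r (p.1.succ, p.2)) fun h => g (consBits f h) := by
  simp only [bern, Finset.smul_sum, smul_smul]
  rw [← Fintype.sum_prod_type', ← (consBitsEquiv ι m).sum_comp]
  refine Finset.sum_congr rfl fun x _ => ?_
  congr 1
  simp only [bernWeight, Fintype.prod_prod_type, Fin.prod_univ_succ]
  rfl

theorem bern_of_isEmpty [IsEmpty ι] (r : ι → ℝ) (g : (ι → Bool) → V) :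
    bern r g = g isEmptyElim := by
  simp [bern, bernWeight]
  congr 1

theorem bern_mono {r : ι → ℝ} (h0 : ∀ i, 0 ≤ r i) (h1 : ∀ i, r i ≤ 1) {g h : (ι → Bool) → ℝ}
    (hgh : ∀ f, g f ≤ h f) : bern r g ≤ bern r h := by
  refine Finset.sum_le_sum fun f _ => ?_
  refine mul_le_mul_of_nonneg_left (hgh f) (Finset.prod_nonneg fun i _ => ?_)
  split_ifs
  · exact h0 i
  · linarith [h1 i]

/-- Independence: the mean of a product over the bits is the product of the means. All exact kernels
and the Chernoff bound for clusters rest on it. -/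
theorem bern_prod {R : Type*} [CommRing R] [Algebra ℝ R] (r : ι → ℝ) (g : ι → Bool → R) :
    bern r (fun f => ∏ i, g i (f i)) = ∏ i, (r i • g i true + (1 - r i) • g i false) := by
  have h : ∀ f : ι → Bool, bernWeight r f • ∏ i, g i (f i) =
      ∏ i, (if f i = true then r i else 1 - r i) • g i (f i) := fun f => by
    rw [Finset.prod_smul]; rfl
  simp only [bern, h]
  rw [sum_pi_prod (fun i (b : Bool) => (if b = true then r i else 1 - r i) • g i b)]
  simp

end Bernoulli

/-! ### Sums over fault sets as Bernoulli averages -/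

section Powerset

variable {n : ℕ} {V : Type*} [AddCommGroup V] [Module ℝ V]

/-- The set of qubits at which `f` is `true`. -/
def supp {ι : Type*} [Fintype ι] (f : ι → Bool) : Finset ι := Finset.univ.filter fun q => f q = true

@[simp] theorem mem_supp {ι : Type*} [Fintype ι] (f : ι → Bool) (q : ι) :
    q ∈ supp f ↔ f q = true := by
  simp [supp]

/-- The error rates of events of probability `r` located at the elements of `S`. -/
def rateOn {ι : Type*} [DecidableEq ι] (r : ℝ) (S : Finset ι) (q : ι) : ℝ := if q ∈ S then r else 0

theorem sum_supp {ι : Type*} [Fintype ι] [DecidableEq ι] {V : Type*} [AddCommMonoid V]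
    (G : Finset ι → V) : ∑ F, G F = ∑ f : ι → Bool, G (supp f) := by
  refine Fintype.sum_equiv
    ⟨fun F q => decide (q ∈ F), supp, fun F => by ext; simp, fun f => by ext; simp⟩ _ _ fun F => ?_
  congr 1
  ext
  simp

theorem bernWeight_rateOn (r : ℝ) {S F : Finset (Qubit n)} (h : F ⊆ S) :
    bernWeight (rateOn r S) (fun q => decide (q ∈ F)) = weight r S F := by
  have h1 : ∀ q, (if decide (q ∈ F) = true then rateOn r S q else 1 - rateOn r S q) =
      (if q ∈ F then r else 1) * (if q ∈ S \ F then 1 - r else 1) := fun q => by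
    by_cases hF : q ∈ F
    · simp [hF, rateOn, h hF]
    · by_cases hS : q ∈ S <;> simp [hF, hS, rateOn]
  simp only [bernWeight, h1, Finset.prod_mul_distrib, Finset.prod_ite_mem, Finset.univ_inter,
    Finset.prod_const, weight]

/-- Bits outside `S` have rate `0`, so patterns that leave `S` carry no weight. Every fault set then
becomes a family of bits on the full register, and averages over different layers can be combined.
-/
theorem sum_powerset_weight (r : ℝ) (S : Finset (Qubit n)) (G : Finset (Qubit n) → V) :
    ∑ F ∈ S.powerset, weight r S F • G F = bern (rateOn r S) fun f => G (supp f) := by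
  have hz : ∀ F : Finset (Qubit n), F ∉ S.powerset →
      bernWeight (rateOn r S) (fun q => decide (q ∈ F)) • G F = 0 := fun F hF => by
    obtain ⟨q, hq, hqS⟩ := Finset.not_subset.1 fun h => hF (Finset.mem_powerset.2 h)
    rw [bernWeight, Finset.prod_eq_zero (Finset.mem_univ q), zero_smul]
    simp [hq, hqS, rateOn]
  rw [Finset.sum_congr rfl fun F hF => by rw [← bernWeight_rateOn r (Finset.mem_powerset.1 hF)],
    Finset.sum_subset (Finset.subset_univ _) fun F _ hF => hz F hF, sum_supp]
  simp [bern]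

end Powerset

/-! ### The Heisenberg picture -/

section Heisenberg

variable {n : ℕ}

/-- Linear functionals on operators, given by their values on matrix units. -/
abbrev Obs (n : ℕ) : Type := (Qubit n → Bool) → (Qubit n → Bool) → ℂ

/-- The value of a functional at an operator. -/
def pair (A : Obs n) (ρ : Operator n) : ℂ := ∑ a, ∑ b, A a b * ρ a b

/-- The functional `ρ ↦ A (K ρ K†)`. -/
def dual (K : Operator n) (A : Obs n) : Obs n := fun a b =>
  ∑ u, ∑ v, K u a * star (K v b) * A u v

theorem sum_comm_three {α β γ : Type*} (s : Finset α) (t : Finset β) (u : Finset γ)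
    (f : α → β → γ → ℂ) : ∑ a ∈ s, ∑ b ∈ t, ∑ c ∈ u, f a b c =
      ∑ c ∈ u, ∑ a ∈ s, ∑ b ∈ t, f a b c := by
  rw [Finset.sum_comm (s := u)]
  exact Finset.sum_congr rfl fun a _ => Finset.sum_comm

theorem pair_conj (A : Obs n) (K ρ : Operator n) : pair A (conj K ρ) = pair (dual K A) ρ := by
  simp only [pair, dual, conj, Matrix.mul_apply, Matrix.conjTranspose_apply, Finset.mul_sum,
    Finset.sum_mul]
  rw [Finset.sum_congr rfl fun u _ => Finset.sum_congr rfl fun v _ => Finset.sum_comm,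
    sum_comm_three]
  refine (Finset.sum_congr rfl fun a _ => sum_comm_three _ _ _ _).trans ?_
  refine Finset.sum_congr rfl fun a _ => Finset.sum_congr rfl fun b _ =>
    Finset.sum_congr rfl fun u _ => Finset.sum_congr rfl fun v _ => ?_
  ring

theorem pair_sum_right {α : Type*} (s : Finset α) (A : Obs n) (ρ : α → Operator n) :
    pair A (∑ x ∈ s, ρ x) = ∑ x ∈ s, pair A (ρ x) := by
  simp only [pair, Matrix.sum_apply, Finset.mul_sum]
  exact sum_comm_three _ _ _ _

theorem pair_smul_right (c : ℂ) (A : Obs n) (ρ : Operator n) : pair A (c • ρ) = c * pair A ρ := by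
  simp only [pair, Matrix.smul_apply, Finset.mul_sum, smul_eq_mul]
  simp only [mul_left_comm]

theorem pair_sum_left {α : Type*} (s : Finset α) (A : α → Obs n) (ρ : Operator n) :
    pair (∑ x ∈ s, A x) ρ = ∑ x ∈ s, pair (A x) ρ := by
  simp only [pair, Finset.sum_apply, Finset.sum_mul]
  exact sum_comm_three _ _ _ _

theorem pair_smul_left (c : ℂ) (A : Obs n) (ρ : Operator n) : pair (c • A) ρ = c * pair A ρ := by
  simp only [pair, Pi.smul_apply, Finset.mul_sum, smul_eq_mul, mul_assoc]

/-- The Kraus operators of `reset`. -/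
def resetKraus (S : Finset (Qubit n)) (B : Basis) (E O : Finset (Qubit n)) : Operator n :=
  tensor fun q => if q ∈ S then
    Matrix.vecMulVec (B.ket (decide (q ∈ E))) (star (Basis.z.ket (decide (q ∈ O)))) else 1

/-- The projection of `project`. -/
def projKraus (S : Finset (Qubit n)) (B : Basis) (O : Finset (Qubit n)) : Operator n :=
  tensor fun q => if q ∈ S then
    Matrix.vecMulVec (B.ket (decide (q ∈ O))) (star (B.ket (decide (q ∈ O)))) else 1

/-- Bit flips in the Heisenberg picture. -/
def flipObs (r : ℝ) (S : Finset (Qubit n)) (A : Obs n) : Obs n :=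
  ∑ F ∈ S.powerset, (weight r S F : ℂ) • dual (onSet F Gate.X) A

theorem pair_bitFlips (r : ℝ) (S : Finset (Qubit n)) (A : Obs n) (ρ : Operator n) :
    pair A (bitFlips r S ρ) = pair (flipObs r S A) ρ := by
  simp only [bitFlips, flipObs, pair_sum_right, pair_sum_left, pair_smul_left, pair_smul_right,
    pair_conj]

/-- The functional `ρ ↦ ∑ x, g x * run η θ P ρ x`. -/
def heis (η : NoiseRates) (θ : ℝ) (g : Bool → ℝ) : Protocol n → Obs n
  | .output y => fun a b => if a = b then (g y : ℂ) else 0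
  | .prepare S B next => ∑ E ∈ S.powerset, (weight η.pprep S E : ℂ) • ∑ O ∈ S.powerset,
      dual (resetKraus S B E O) (flipObs η.p Sᶜ (heis η θ g next))
  | .gates h next => dual (tensor fun q => (h q).matrix) (flipObs η.p Finset.univ (heis η θ g next))
  | .cnots ctrl next => dual (cnotLayer ctrl) (flipObs η.p Finset.univ (heis η θ g next))
  | .measure S B next => ∑ R ∈ S.powerset, ∑ O ∈ S.powerset, (weight η.q S (symmDiff O R) : ℂ) •
      dual (projKraus S B O) (flipObs η.p Sᶜ (heis η θ g (next R)))
  | .random N next => (N : ℂ)⁻¹ • ∑ j : Fin N, heis η θ g (next j)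
  | .sense next => dual (signal n θ) (heis η θ g next)

/-- A test function `g` on the outputs makes the whole protocol a single linear functional of the
initial state; indicators of one outcome are substituted only at the very end. -/
theorem sum_run (η : NoiseRates) (θ : ℝ) (g : Bool → ℝ) (P : Protocol n) (ρ : Operator n) :
    ∑ x, g x * run η θ P ρ x = (pair (heis η θ g P) ρ).re := by
  induction P generalizing ρ with
  | output y =>
    have h : pair (heis η θ g (.output y : Protocol n)) ρ = g y * ρ.trace := by
      simp [pair, heis, Matrix.trace, Finset.mul_sum]
    rw [h]
    cases y <;> simp [run]
  | prepare S B next ih =>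
    simp only [run, ih, pair_bitFlips, heis, noisyPrepare, pair_sum_left, pair_smul_left,
      pair_sum_right, pair_smul_right, reset, ← pair_conj]
    rfl
  | gates h next ih => simp only [run, ih, pair_bitFlips, heis, pair_conj]
  | cnots ctrl next ih => simp only [run, ih, pair_bitFlips, heis, pair_conj]
  | measure S B next ih =>
    simp only [run, Finset.mul_sum]
    rw [Finset.sum_comm]
    simp only [ih, pair_bitFlips, heis, noisyMeasure, pair_sum_left, pair_smul_left,
      pair_sum_right, pair_smul_right, project, ← pair_conj]
    rw [Complex.re_sum]
    rfl
  | random N next ih =>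
    have h : pair (heis η θ g (.random N next)) ρ =
        (((N : ℝ)⁻¹ : ℝ) : ℂ) * ∑ j : Fin N, pair (heis η θ g (next j)) ρ := by
      simp [heis, pair_smul_left, pair_sum_left]
    rw [h, Complex.re_ofReal_mul, Complex.re_sum, ← Finset.sum_congr rfl fun j _ => ih j ρ,
      Finset.sum_comm, Finset.mul_sum]
    refine Finset.sum_congr rfl fun x _ => ?_
    rw [run, ← Finset.mul_sum]
    ring
  | sense next ih => simp only [run, ih, heis, pair_conj]

end Heisenberg

/-! ### Evaluation of the elementary steps -/

section Steps

variable {n : ℕ}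

theorem tensor_monomial {M : Qubit n → Matrix Bool Bool ℂ} {π : Qubit n → Bool → Bool}
    {φ : Qubit n → Bool → ℂ} (h : ∀ q c b, M q c b = if c = π q b then φ q b else 0)
    (u a : Qubit n → Bool) :
    tensor M u a = if u = (fun q => π q (a q)) then ∏ q, φ q (a q) else 0 := by
  simp only [tensor, Matrix.of_apply, h]
  rw [Finset.prod_ite_zero]
  simp [funext_iff]

/-- Gates, CNOT layers, resets and projections in the `Z` basis, and the signal all have at most one
nonzero entry per column. Pulling a functional back along them is a relabelling with phases, without
sums. -/
theorem dual_monomial {K : Operator n} {π : (Qubit n → Bool) → Qubit n → Bool}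
    {φ : (Qubit n → Bool) → ℂ} (h : ∀ u a, K u a = if u = π a then φ a else 0) (A : Obs n)
    (a b : Qubit n → Bool) : dual K A a b = φ a * star (φ b) * A (π a) (π b) := by
  simp [dual, h, apply_ite star, ite_mul, mul_ite]

theorem symmDiff_apply_bool {ι : Type*} (a b : ι → Bool) (i : ι) :
    (a ∆ b) i = xor (a i) (b i) := by
  rw [Pi.symmDiff_apply, Bool.symmDiff_eq_xor]

/-- The flip `f` shifts row and column together, hence `a ∆ b` is preserved: this is why coherences
survive bit-flip noise. -/
theorem flipObs_apply (r : ℝ) (S : Finset (Qubit n)) (A : Obs n) (a b : Qubit n → Bool) :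
    flipObs r S A a b = bern (rateOn r S) fun f => A (a ∆ f) (b ∆ f) := by
  have h : ∀ F : Finset (Qubit n), dual (onSet F Gate.X) A a b =
      A (a ∆ fun q => decide (q ∈ F)) (b ∆ fun q => decide (q ∈ F)) := fun F => by
    rw [dual_monomial (π := fun a => a ∆ fun q => decide (q ∈ F)) (φ := fun _ => 1)]
    · simp
    · intro u a
      rw [onSet, tensor_monomial (π := fun q b => xor b (decide (q ∈ F))) (φ := fun _ _ => 1)]
      · simp [funext_iff]
      · intro q c b
        by_cases hq : q ∈ F
        · cases b <;> cases c <;> simp [hq, Gate.matrix]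
        · cases b <;> cases c <;> simp [hq]
  simp only [flipObs, Finset.sum_apply, Pi.smul_apply, h]
  simp only [Complex.coe_smul]
  rw [sum_powerset_weight r S fun F => A (a ∆ fun q => decide (q ∈ F)) (b ∆ fun q => decide (q ∈ F))]
  simp

variable (η : NoiseRates) (θ : ℝ) (g : Bool → ℝ)

theorem heis_cnots (ctrl : Qubit n → Option (Qubit n)) (next : Protocol n)
    (a b : Qubit n → Bool) : heis η θ g (.cnots ctrl next) a b =
      bern (rateOn η.p Finset.univ) fun f =>
        heis η θ g next ((fun q => xor (a q) ((ctrl q).elim false a)) ∆ f)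
          ((fun q => xor (b q) ((ctrl q).elim false b)) ∆ f) := by
  rw [heis, dual_monomial (π := fun a q => xor (a q) ((ctrl q).elim false a)) (φ := fun _ => 1)
    (fun u a => by simp [cnotLayer]), flipObs_apply]
  simp

/-- Whether a gate flips the computational basis. -/
def Gate.flips : Gate → Bool
  | .X => true
  | _ => false

/-- The phase of a gate at a basis ket. -/
def Gate.phase : Gate → Bool → ℂ
  | .Z, b => if b then -1 else 1
  | .S, b => if b then Complex.I else 1
  | _, _ => 1

theorem gate_matrix_apply (h : Gate) (c b : Bool) :
    h.matrix c b = if c = xor b h.flips then h.phase b else 0 := by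
  cases h <;> cases b <;> cases c <;> simp [Gate.matrix, Gate.flips, Gate.phase]

theorem heis_gates (h : Qubit n → Gate) (next : Protocol n) (a b : Qubit n → Bool) :
    heis η θ g (.gates h next) a b =
      (∏ q, (h q).phase (a q)) * star (∏ q, (h q).phase (b q)) *
      bern (rateOn η.p Finset.univ) fun f =>
        heis η θ g next (a ∆ (fun q => (h q).flips) ∆ f) (b ∆ (fun q => (h q).flips) ∆ f) := by
  rw [heis, dual_monomial (π := fun a => a ∆ fun q => (h q).flips)
    (φ := fun a => ∏ q, (h q).phase (a q)) _, flipObs_apply]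
  intro u a
  rw [tensor_monomial (π := fun q b => xor b (h q).flips) (φ := fun q b => (h q).phase b)
    (fun q c b => gate_matrix_apply _ _ _)]
  simp only [funext_iff, symmDiff_apply_bool]

/-- `a` with the values on `S` replaced by those of `e`. -/
def override (S : Finset (Qubit n)) (e a : Qubit n → Bool) : Qubit n → Bool :=
  fun q => if q ∈ S then e q else a q

theorem sum_powerset_indicator {V : Type*} [AddCommMonoid V] (S : Finset (Qubit n))
    (a : Qubit n → Bool) (G : Finset (Qubit n) → V) :
    (∑ O ∈ S.powerset, if ∀ q ∈ S, a q = decide (q ∈ O) then G O else 0) =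
      G (S.filter fun q => a q = true) := by
  rw [Finset.sum_eq_single_of_mem (S.filter fun q => a q = true) (by simp)]
  · rw [if_pos]
    intro q hq
    simp [hq]
  · intro O hO hne
    rw [if_neg]
    intro h
    refine hne (Finset.ext fun q => ?_)
    rw [Finset.mem_filter]
    constructor
    · intro hq
      have hS := Finset.mem_powerset.1 hO hq
      exact ⟨hS, by simp [h q hS, hq]⟩
    · rintro ⟨hS, ha⟩
      rw [h q hS] at ha
      simpa using ha

theorem prod_indicator (S O : Finset (Qubit n)) (a : Qubit n → Bool) :
    (∏ q, if q ∈ S then (if a q = decide (q ∈ O) then (1 : ℂ) else 0) else 1) =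
      if ∀ q ∈ S, a q = decide (q ∈ O) then 1 else 0 := by
  rw [Finset.prod_ite_mem, Finset.univ_inter, Finset.prod_ite_zero]
  simp

theorem dual_resetKraus_z (S E O : Finset (Qubit n)) (A : Obs n) (a b : Qubit n → Bool) :
    dual (resetKraus S .z E O) A a b =
      if ∀ q ∈ S, a q = decide (q ∈ O) then
        (if ∀ q ∈ S, a q = b q then
          A (override S (fun q => decide (q ∈ E)) a) (override S (fun q => decide (q ∈ E)) b)
        else 0) else 0 := by
  rw [dual_monomial (π := override S (fun q => decide (q ∈ E)))
    (φ := fun a => if ∀ q ∈ S, a q = decide (q ∈ O) then 1 else 0) _]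
  · by_cases h : ∀ q ∈ S, a q = decide (q ∈ O)
    · have h2 : (∀ q ∈ S, b q = decide (q ∈ O)) ↔ ∀ q ∈ S, a q = b q :=
        forall₂_congr fun q hq => by rw [h q hq, eq_comm]
      simp only [h2]
      split_ifs <;> simp_all
    · simp only [if_neg h, zero_mul]
  · intro u a
    rw [resetKraus, tensor_monomial (π := fun q b => if q ∈ S then decide (q ∈ E) else b)
      (φ := fun q b => if q ∈ S then (if b = decide (q ∈ O) then (1 : ℂ) else 0) else 1),
      prod_indicator]
    · rfl
    · intro q c b
      by_cases hq : q ∈ S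
      · simp only [hq, if_true, Matrix.vecMulVec_apply, Basis.ket, Pi.star_apply]
        split_ifs <;> simp
      · simp [hq, Matrix.one_apply]

theorem heis_prepare_z (S : Finset (Qubit n)) (next : Protocol n) (a b : Qubit n → Bool) :
    heis η θ g (.prepare S .z next) a b = if ∀ q ∈ S, a q = b q then
      bern (rateOn η.pprep S) fun e => bern (rateOn η.p Sᶜ) fun f =>
        heis η θ g next (override S e a ∆ f) (override S e b ∆ f) else 0 := by
  simp only [heis, Finset.sum_apply, Pi.smul_apply, Complex.coe_smul, dual_resetKraus_z,
    sum_powerset_indicator, flipObs_apply]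
  rw [sum_powerset_weight η.pprep S]
  split_ifs
  · simp
  · exact bern_const _ _

theorem dual_projKraus_z (S O : Finset (Qubit n)) (A : Obs n) (a b : Qubit n → Bool) :
    dual (projKraus S .z O) A a b =
      if ∀ q ∈ S, a q = decide (q ∈ O) then (if ∀ q ∈ S, a q = b q then A a b else 0) else 0 := by
  rw [dual_monomial (π := fun a => a)
    (φ := fun a => if ∀ q ∈ S, a q = decide (q ∈ O) then 1 else 0) _]
  · by_cases h : ∀ q ∈ S, a q = decide (q ∈ O)
    · have h2 : (∀ q ∈ S, b q = decide (q ∈ O)) ↔ ∀ q ∈ S, a q = b q :=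
        forall₂_congr fun q hq => by rw [h q hq, eq_comm]
      simp only [h2]
      split_ifs <;> simp_all
    · simp only [if_neg h, zero_mul]
  · intro u a
    rw [projKraus, tensor_monomial (π := fun q b => b)
      (φ := fun q b => if q ∈ S then (if b = decide (q ∈ O) then (1 : ℂ) else 0) else 1),
      prod_indicator]
    intro q c b
    by_cases hq : q ∈ S
    · simp only [hq, if_true, Matrix.vecMulVec_apply, Basis.ket, Pi.star_apply]
      by_cases h : b = decide (q ∈ O) <;> simp [h]
    · simp [hq, Matrix.one_apply]

theorem sum_powerset_symmDiff {V : Type*} [AddCommMonoid V] {S O : Finset (Qubit n)} (hO : O ⊆ S)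
    (G : Finset (Qubit n) → V) : ∑ R ∈ S.powerset, G R = ∑ Q ∈ S.powerset, G (O ∆ Q) := by
  have h : ∀ R ∈ S.powerset, O ∆ R ∈ S.powerset := fun R hR => by
    rw [Finset.mem_powerset] at *
    intro q hq
    rcases Finset.mem_symmDiff.1 hq with h | h
    · exact hO h.1
    · exact hR h.1
  refine Finset.sum_bij' (fun R _ => O ∆ R) (fun R _ => O ∆ R) h h ?_ ?_ ?_ <;>
    simp [symmDiff_symmDiff_cancel_left]

/-- On matrix units whose rows and columns agree on `S` the true results are read off from the row,
so the only randomness left is the pattern `e` of wrong reports. -/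
theorem heis_measure_z (S : Finset (Qubit n)) (next : Finset (Qubit n) → Protocol n)
    (a b : Qubit n → Bool) : heis η θ g (.measure S .z next) a b = if ∀ q ∈ S, a q = b q then
      bern (rateOn η.q S) fun e => bern (rateOn η.p Sᶜ) fun f =>
        heis η θ g (next ((S.filter fun q => a q = true) ∆ supp e)) (a ∆ f) (b ∆ f) else 0 := by
  simp only [heis, Finset.sum_apply, Pi.smul_apply, Complex.coe_smul, dual_projKraus_z,
    flipObs_apply, smul_ite, smul_zero, sum_powerset_indicator]
  rw [sum_powerset_symmDiff (Finset.filter_subset (fun q => a q = true) S)]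
  simp only [symmDiff_symmDiff_cancel_left]
  split_ifs
  · rw [sum_powerset_weight η.q S fun Q => bern (rateOn η.p Sᶜ) fun f =>
      heis η θ g (next ((S.filter fun q => a q = true) ∆ Q)) (a ∆ f) (b ∆ f)]
  · simp

/-- The magnetisation `∑ (-1)^{x_i}` of a bit string. -/
def magnetization (x : Fin n → Bool) : ℝ := ∑ i, if x i then -1 else 1

theorem signal_apply (u a : Qubit n → Bool) : signal n θ u a =
    if u = a then Complex.exp (-(Complex.I * θ * (magnetization (a ∘ Sum.inl) / 2))) else 0 := by
  have hH : hamiltonian n =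
      Matrix.diagonal fun a => ((magnetization (a ∘ Sum.inl) / 2 : ℝ) : ℂ) := by
    have h : ∀ i : Fin n, onSet {data i} Gate.Z =
        Matrix.diagonal fun a : Qubit n → Bool => if a (data i) then (-1 : ℂ) else 1 := fun i => by
      ext u a
      rw [onSet, tensor_monomial (π := fun q b => b)
        (φ := fun q b => if q = data i then (if b then -1 else 1) else 1), Matrix.diagonal_apply]
      · by_cases hu : u = a
        · simp [hu]
        · simp [hu]
      · intro q c b
        by_cases hq : q = data i
        · cases b <;> cases c <;> simp [hq, Gate.matrix]
        · cases b <;> cases c <;> simp [hq]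
    ext u a
    simp only [hamiltonian, h, Matrix.sum_apply, Matrix.smul_apply, Matrix.diagonal_apply]
    by_cases hu : u = a
    · simp only [hu, if_true, magnetization, Function.comp]
      push_cast
      rw [Finset.sum_div]
      refine Finset.sum_congr rfl fun i _ => ?_
      split_ifs <;> norm_num
    · simp [hu]
  rw [signal, hH, ← Matrix.diagonal_smul, Matrix.exp_diagonal, Matrix.diagonal_apply]
  by_cases hu : u = a
  · simp only [hu, if_true]
    rw [Pi.coe_exp, ← Complex.exp_eq_exp_ℂ]
    congr 1
    simp
  · simp [hu]

theorem heis_sense (next : Protocol n) (a b : Qubit n → Bool) :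
    heis η θ g (.sense next) a b =
      Complex.exp (Complex.I * θ * ((magnetization (b ∘ Sum.inl) - magnetization (a ∘ Sum.inl)) / 2)) *
        heis η θ g next a b := by
  rw [heis, dual_monomial (π := fun a => a) (φ := fun a =>
    Complex.exp (-(Complex.I * θ * (magnetization (a ∘ Sum.inl) / 2)))) (signal_apply θ)]
  congr 1
  rw [Complex.star_def, ← Complex.exp_conj, ← Complex.exp_add]
  congr 1
  simp only [map_neg, map_mul, map_div₀, Complex.conj_I, Complex.conj_ofReal, map_ofNat]
  ring

end Steps

/-! ### Ancilla-assisted `X` measurements -/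

section XRounds

variable {n : ℕ}

@[simp] theorem data_notMem_ancillas (i : Fin n) : data i ∉ ancillas n := by simp [ancillas]
@[simp] theorem anc_mem_ancillas (i : Fin n) : anc i ∈ ancillas n := by simp [ancillas]
@[simp] theorem data_mem_probes (i : Fin n) : data i ∈ probes n := by simp [probes]
@[simp] theorem anc_notMem_probes (i : Fin n) : anc i ∉ probes n := by simp [probes]

/-- `-1` if both arguments are `true`, else `1`. -/
def sgn (m w : Bool) : ℝ := if m && w then -1 else 1

/-- The matrix elements of an `X` eigenstate depend only on the difference of the two indices;
summed over rows, such an ancilla therefore becomes a uniformly random string. -/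
theorem ket_mul_star_ket (m b b' : Bool) :
    Basis.x.ket m b * star (Basis.x.ket m b') = ((sgn m (xor b b') / 2 : ℝ) : ℂ) := by
  have h : ((Real.sqrt 2 : ℝ) : ℂ) * (Real.sqrt 2 : ℝ) = 2 := by
    rw [← Complex.ofReal_mul, Real.mul_self_sqrt (by norm_num)]; norm_num
  have h2 : ((Real.sqrt 2 : ℝ) : ℂ)⁻¹ * ((Real.sqrt 2 : ℝ) : ℂ)⁻¹ = 2⁻¹ := by
    rw [← mul_inv, h]
  cases m <;> cases b <;> cases b' <;>
    simp [Basis.ket, sgn, div_eq_mul_inv, Complex.conj_ofReal, h2]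

theorem sum_qubit {V : Type*} [AddCommMonoid V] (G : (Qubit n → Bool) → V) :
    ∑ u, G u = ∑ p : Fin n → Bool, ∑ s : Fin n → Bool, G (Sum.elim p s) := by
  rw [← Fintype.sum_prod_type', ← (Equiv.sumArrowEquivProdArrow _ _ _).symm.sum_comp]
  rfl

theorem tensor_elim (M : Qubit n → Matrix Bool Bool ℂ) (p s x y : Fin n → Bool) :
    tensor M (Sum.elim p s) (Sum.elim x y) =
      (∏ i, M (data i) (p i) (x i)) * ∏ i, M (anc i) (s i) (y i) := by
  simp [tensor]

theorem prod_one_apply (p x : Fin n → Bool) :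
    ∏ i, (1 : Matrix Bool Bool ℂ) (p i) (x i) = if p = x then 1 else 0 := by
  simp only [Matrix.one_apply]
  rw [Finset.prod_ite_zero]
  simp [funext_iff]

theorem prod_ket_z (m y : Fin n → Bool) :
    ∏ i, star (Basis.z.ket (m i) (y i)) = if y = m then (1 : ℂ) else 0 := by
  simp only [Basis.ket, apply_ite star, star_one, star_zero]
  rw [Finset.prod_ite_zero]
  simp [funext_iff]

theorem resetKraus_ancillas (B : Basis) (E O : Finset (Qubit n)) (p s x y : Fin n → Bool) :
    resetKraus (ancillas n) B E O (Sum.elim p s) (Sum.elim x y) =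
      (if p = x then 1 else 0) * ((∏ i, B.ket (decide (anc i ∈ E)) (s i)) *
        if y = (fun i => decide (anc i ∈ O)) then 1 else 0) := by
  simp only [resetKraus, tensor_elim, data_notMem_ancillas, anc_mem_ancillas, if_true, if_false,
    prod_one_apply, Matrix.vecMulVec_apply, Pi.star_apply, Finset.prod_mul_distrib, prod_ket_z]

theorem resetKraus_probes (B : Basis) (E O : Finset (Qubit n)) (p s x y : Fin n → Bool) :
    resetKraus (probes n) B E O (Sum.elim p s) (Sum.elim x y) =
      ((∏ i, B.ket (decide (data i ∈ E)) (p i)) *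
        if x = (fun i => decide (data i ∈ O)) then 1 else 0) * (if s = y then 1 else 0) := by
  simp only [resetKraus, tensor_elim, anc_notMem_probes, data_mem_probes, if_true, if_false,
    prod_one_apply, Matrix.vecMulVec_apply, Pi.star_apply, Finset.prod_mul_distrib, prod_ket_z]

theorem projKraus_ancillas (B : Basis) (O : Finset (Qubit n)) (p s x y : Fin n → Bool) :
    projKraus (ancillas n) B O (Sum.elim p s) (Sum.elim x y) =
      (if p = x then 1 else 0) * ((∏ i, B.ket (decide (anc i ∈ O)) (s i)) *
        ∏ i, star (B.ket (decide (anc i ∈ O)) (y i))) := by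
  simp only [projKraus, tensor_elim, data_notMem_ancillas, anc_mem_ancillas, if_true, if_false,
    prod_one_apply, Matrix.vecMulVec_apply, Pi.star_apply, Finset.prod_mul_distrib]

/-- The set of ancillas at which `R` is `true`. -/
def ancSet (R : Fin n → Bool) : Finset (Qubit n) := supp (Sum.elim (fun _ => false) R)

@[simp] theorem anc_mem_ancSet (R : Fin n → Bool) (i : Fin n) : anc i ∈ ancSet R ↔ R i = true := by
  simp [ancSet]

@[simp] theorem data_notMem_ancSet (R : Fin n → Bool) (i : Fin n) : data i ∉ ancSet R := by
  simp [ancSet]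

theorem sum_powerset_ancillas {V : Type*} [AddCommMonoid V] (G : Finset (Qubit n) → V) :
    ∑ R ∈ (ancillas n).powerset, G R = ∑ R : Fin n → Bool, G (ancSet R) := by
  refine Finset.sum_bij' (fun R _ i => decide (anc i ∈ R)) (fun R _ => ancSet R) (by simp) ?_ ?_ ?_ ?_
  · intro R _
    rw [Finset.mem_powerset]
    rintro (i | i) h
    · exact absurd h (data_notMem_ancSet R i)
    · exact anc_mem_ancillas i
  · intro R hR
    ext q
    rcases q with i | i
    · have : data i ∉ R := fun h => data_notMem_ancillas i (Finset.mem_powerset.1 hR h)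
      simp [this]
    · simp
  · intro R _
    simp
  · intro R hR
    congr 1
    ext q
    rcases q with i | i
    · have : data i ∉ R := fun h => data_notMem_ancillas i (Finset.mem_powerset.1 hR h)
      simp [this]
    · simp

theorem weight_ancSet (r : ℝ) (O R : Fin n → Bool) :
    weight r (ancillas n) (ancSet O ∆ ancSet R) = ∏ i, if xor (O i) (R i) then r else 1 - r := by
  have h : ancSet O ∆ ancSet R ⊆ ancillas n := by
    rintro (i | i) h
    · simp [Finset.mem_symmDiff] at h
    · exact anc_mem_ancillas i
  rw [← bernWeight_rateOn r h, bernWeight, Fintype.prod_sum_type]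
  have h1 : ∀ i, (decide (anc i ∈ ancSet O ∆ ancSet R)) = xor (O i) (R i) := fun i => by
    cases hO : O i <;> cases hR : R i <;> simp [Finset.mem_symmDiff, hO, hR]
  simp only [h1, rateOn, anc_mem_ancillas, data_notMem_ancillas, if_true, if_false]
  have h2 : ∀ i, decide (data i ∈ ancSet O ∆ ancSet R) = false := by simp [Finset.mem_symmDiff]
  simp only [h2]
  simp

theorem dual_ancillas {K : Operator n} {k k' : (Fin n → Bool) → ℂ} {x y x' y' : Fin n → Bool}
    (h : ∀ p s, K (Sum.elim p s) (Sum.elim x y) = (if p = x then 1 else 0) * k s)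
    (h' : ∀ p s, K (Sum.elim p s) (Sum.elim x' y') = (if p = x' then 1 else 0) * k' s)
    (A : Obs n) : dual K A (Sum.elim x y) (Sum.elim x' y') =
      ∑ s, ∑ s', k s * star (k' s') * A (Sum.elim x s) (Sum.elim x' s') := by
  have h1 : ∀ a b, dual K A a b = ∑ p, ∑ s, ∑ p', ∑ s', K (Sum.elim p s) a *
      star (K (Sum.elim p' s') b) * A (Sum.elim p s) (Sum.elim p' s') := fun a b => by
    simp only [dual, sum_qubit (n := n)]
  rw [h1, Finset.sum_eq_single_of_mem x (Finset.mem_univ _) (by simp +contextual [h])]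
  refine Finset.sum_congr rfl fun s _ => ?_
  rw [Finset.sum_eq_single_of_mem x' (Finset.mem_univ _) (by simp +contextual [h'])]
  simp [h, h']

variable (η : NoiseRates) (θ : ℝ) (g : Bool → ℝ)

/-- The functional of `P` depends only on the reduced state of the probes: its value at the matrix
unit with row `x` and column `x ∆ d` is `B x d`. -/
def HasData (P : Protocol n) (B : (Fin n → Bool) → (Fin n → Bool) → ℂ) : Prop :=
  ∀ x y x' y', heis η θ g P (Sum.elim x y) (Sum.elim x' y') = if y = y' then B x (x ∆ x') else 0

theorem elim_symmDiff (x y : Fin n → Bool) (f : Qubit n → Bool) :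
    Sum.elim x y ∆ f = Sum.elim (x ∆ (f ∘ Sum.inl)) (y ∆ (f ∘ Sum.inr)) := by
  funext q
  rcases q with i | i <;> simp

theorem symmDiff_symmDiff_right_cancel {ι : Type*} (x x' f : ι → Bool) :
    (x ∆ f) ∆ (x' ∆ f) = x ∆ x' := by
  rw [symmDiff_symmDiff_symmDiff_comm, symmDiff_self, symmDiff_bot]

/-- Weight of the report `R` in the `X` measurement of the ancillas. -/
def measureKernel (R w : Fin n → Bool) : ℝ :=
  ∏ i, ((1 - η.q) * sgn (R i) (w i) + η.q * sgn (!R i) (w i)) / 2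

/-- Matrix elements of the ancillas after preparation. -/
def prepareKernel (w : Fin n → Bool) : ℝ := ∏ i, (if w i then 1 - 2 * η.pprep else 1) / 2

variable {η θ g}

theorem heis_measure_x {next : Finset (Qubit n) → Protocol n}
    {B : Finset (Qubit n) → (Fin n → Bool) → (Fin n → Bool) → ℂ}
    (h : ∀ R, HasData η θ g (next R) (B R)) (x y x' y' : Fin n → Bool) :
    heis η θ g (.measure (ancillas n) .x next) (Sum.elim x y) (Sum.elim x' y') =
      ∑ R, measureKernel η R (y ∆ y') * bern (rateOn η.p (ancillas n)ᶜ) fun f =>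
        B (ancSet R) (x ∆ (f ∘ Sum.inl)) (x ∆ x') := by
  have hd : ∀ R O, dual (projKraus (ancillas n) .x (ancSet O))
      (flipObs η.p (ancillas n)ᶜ (heis η θ g (next R))) (Sum.elim x y) (Sum.elim x' y') =
      ((∏ i, sgn (O i) (xor (y i) (y' i)) / 2 : ℝ) : ℂ) *
        bern (rateOn η.p (ancillas n)ᶜ) fun f => B R (x ∆ (f ∘ Sum.inl)) (x ∆ x') := fun R O => by
    have h1 : ∀ p s p' s', flipObs η.p (ancillas n)ᶜ (heis η θ g (next R)) (Sum.elim p s)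
        (Sum.elim p' s') = if s = s' then bern (rateOn η.p (ancillas n)ᶜ) fun f =>
          B R (p ∆ (f ∘ Sum.inl)) (p ∆ p') else 0 := fun p s p' s' => by
      simp only [flipObs_apply, elim_symmDiff, h R _ _ _ _, symmDiff_symmDiff_right_cancel,
        symmDiff_left_inj]
      split_ifs
      · rfl
      · exact bern_const _ _
    -- The ancillas left behind have trace one and are not seen by the continuation, so only the
    -- overlap with the state before the measurement remains.
    have h3 : ∑ s : Fin n → Bool, (∏ i, Basis.x.ket (O i) (s i)) *
        star (∏ i, Basis.x.ket (O i) (s i)) = 1 := by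
      simp only [star_prod, ← Finset.prod_mul_distrib, ket_mul_star_ket]
      rw [sum_pi_prod (fun i (b : Bool) => ((sgn (O i) (xor b b) / 2 : ℝ) : ℂ))]
      simp [sgn]
    have h4 : ((∏ i, sgn (O i) (xor (y i) (y' i)) / 2 : ℝ) : ℂ) =
        star (∏ i, star (Basis.x.ket (O i) (y' i))) * ∏ i, star (Basis.x.ket (O i) (y i)) := by
      rw [Complex.ofReal_prod]
      simp only [star_prod, star_star, ← Finset.prod_mul_distrib]
      refine Finset.prod_congr rfl fun i _ => ?_
      rw [Bool.xor_comm, ket_mul_star_ket]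
    rw [dual_ancillas (fun p s => projKraus_ancillas _ _ p s x y)
      (fun p s => projKraus_ancillas _ _ p s x' y')]
    simp only [h1, anc_mem_ancSet, Bool.decide_eq_true, mul_ite, mul_zero,
      Finset.sum_ite_eq, Finset.mem_univ, if_true, h4]
    rw [← Finset.sum_mul]
    congr 1
    rw [← one_mul (star (∏ i, star (Basis.x.ket (O i) (y' i))) * _), ← h3, Finset.sum_mul]
    refine Finset.sum_congr rfl fun s _ => ?_
    rw [star_mul']
    ring
  simp only [heis, sum_powerset_ancillas, Finset.sum_apply, Pi.smul_apply, hd, smul_eq_mul,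
    weight_ancSet]
  refine Finset.sum_congr rfl fun R _ => ?_
  rw [measureKernel]
  simp only [← mul_assoc, ← Complex.ofReal_mul]
  rw [← Finset.sum_mul, ← Complex.ofReal_sum]
  congr 2
  simp only [← Finset.prod_mul_distrib]
  rw [sum_pi_prod (fun i (o : Bool) => (if xor o (R i) then η.q else 1 - η.q) *
    (sgn o (xor (y i) (y' i)) / 2))]
  refine Finset.prod_congr rfl fun i _ => ?_
  rw [symmDiff_apply_bool]
  cases R i <;> simp <;> ring

theorem heis_prepare_x (next : Protocol n) (x y x' y' : Fin n → Bool) :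
    heis η θ g (.prepare (ancillas n) .x next) (Sum.elim x y) (Sum.elim x' y') =
      if y = y' then ∑ s, ∑ s', (prepareKernel η (s ∆ s') : ℂ) *
        bern (rateOn η.p (ancillas n)ᶜ) fun f =>
          heis η θ g next (Sum.elim x s ∆ f) (Sum.elim x' s' ∆ f) else 0 := by
  have hd : ∀ E, ∑ O, dual (resetKraus (ancillas n) .x E (ancSet O))
      (flipObs η.p (ancillas n)ᶜ (heis η θ g next)) (Sum.elim x y) (Sum.elim x' y') =
      if y = y' then ∑ s, ∑ s', ((∏ i, sgn (decide (anc i ∈ E)) (xor (s i) (s' i)) / 2 : ℝ) : ℂ) *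
        bern (rateOn η.p (ancillas n)ᶜ) fun f =>
          heis η θ g next (Sum.elim x s ∆ f) (Sum.elim x' s' ∆ f) else 0 := fun E => by
    have h1 : ∀ O, dual (resetKraus (ancillas n) .x E (ancSet O))
        (flipObs η.p (ancillas n)ᶜ (heis η θ g next)) (Sum.elim x y) (Sum.elim x' y') =
        if y = O then (if y = y' then ∑ s, ∑ s',
          ((∏ i, sgn (decide (anc i ∈ E)) (xor (s i) (s' i)) / 2 : ℝ) : ℂ) *
          bern (rateOn η.p (ancillas n)ᶜ) fun f =>
            heis η θ g next (Sum.elim x s ∆ f) (Sum.elim x' s' ∆ f) else 0) else 0 := fun O => by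
      rw [dual_ancillas (fun p s => resetKraus_ancillas _ _ _ p s x y)
        (fun p s => resetKraus_ancillas _ _ _ p s x' y')]
      simp only [anc_mem_ancSet, Bool.decide_eq_true]
      by_cases hy : y = O
      · subst hy
        by_cases hy' : y = y'
        · subst hy'
          simp only [if_true, mul_one, flipObs_apply]
          refine Finset.sum_congr rfl fun s _ => Finset.sum_congr rfl fun s' _ => ?_
          congr 1
          rw [star_prod, ← Finset.prod_mul_distrib, Complex.ofReal_prod]
          simp only [ket_mul_star_ket]
        · simp [hy', Ne.symm hy']
      · simp [hy]
    simp only [h1]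
    simp
  simp only [heis, Finset.sum_apply, Pi.smul_apply, sum_powerset_ancillas (fun O => dual _ _ _ _),
    hd, Complex.coe_smul]
  rw [sum_powerset_weight]
  split_ifs with hy
  · simp only [bern_sum]
    refine Finset.sum_congr rfl fun s _ => Finset.sum_congr rfl fun s' _ => ?_
    simp only [mul_comm _ (bern (rateOn η.p (ancillas n)ᶜ) _), bern_mul]
    congr 1
    have h2 : ∀ e : Qubit n → Bool, ((∏ i, sgn (decide (anc i ∈ supp e)) (xor (s i) (s' i)) / 2 : ℝ)
        : ℂ) = ∏ q, Sum.elim (fun _ _ => (1 : ℂ))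
          (fun i b => ((sgn b (xor (s i) (s' i)) / 2 : ℝ) : ℂ)) q (e q) := fun e => by
      rw [Fintype.prod_sum_type, Complex.ofReal_prod]
      simp
    simp only [h2]
    rw [bern_prod, Fintype.prod_sum_type, prepareKernel, Complex.ofReal_prod]
    simp only [Sum.elim_inl, Sum.elim_inr, rateOn, data_notMem_ancillas, anc_mem_ancillas, if_true,
      if_false, symmDiff_apply_bool]
    simp only [zero_smul, sub_zero, one_smul, zero_add, Finset.prod_const_one, one_mul]
    refine Finset.prod_congr rfl fun i _ => ?_
    rw [← Complex.coe_smul, ← Complex.coe_smul, smul_eq_mul, smul_eq_mul]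
    norm_cast
    simp only [sgn]
    split_ifs <;> simp_all <;> ring
  · exact bern_const _ _

variable (η) in
/-- Average over the random bit flips that a round of `X` measurements applies to the probes. -/
def shiftAvg (G : (Fin n → Bool) → ℂ) : ℂ :=
  ((2 : ℂ)⁻¹ ^ n) * ∑ s : Fin n → Bool, bern (rateOn η.p (ancillas n)ᶜ) fun f₀ : Qubit n → Bool =>
    bern (rateOn η.p Finset.univ) fun f₁ : Qubit n → Bool =>
    bern (rateOn η.p (ancillas n)ᶜ) fun f₂ : Qubit n → Bool =>
      G (((f₀ ∘ Sum.inl) ∆ (s ∆ (f₀ ∘ Sum.inr))) ∆ (f₁ ∘ Sum.inl) ∆ (f₂ ∘ Sum.inl))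

theorem shiftAvg_const (c : ℂ) : shiftAvg (n := n) η (fun _ => c) = c := by
  simp [shiftAvg, bern_const]

theorem shiftAvg_sum {α : Type*} (t : Finset α) (G : α → (Fin n → Bool) → ℂ) :
    shiftAvg η (fun u => ∑ x ∈ t, G x u) = ∑ x ∈ t, shiftAvg η (G x) := by
  simp only [shiftAvg, bern_sum]
  rw [Finset.sum_comm, Finset.mul_sum]

theorem sum_shift {α : Type*} [AddCommMonoid α] (F : (Fin n → Bool) → α) (u : Fin n → Bool) :
    ∑ x, F (x ∆ u) = ∑ x, F x :=
  Fintype.sum_equiv (Function.Involutive.toPerm (fun x => x ∆ u) fun x => by simp) _ _ fun _ => rfl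

theorem sum_shift' {α : Type*} [AddCommMonoid α] (F : (Fin n → Bool) → α) (u : Fin n → Bool) :
    ∑ x, F (u ∆ x) = ∑ x, F x := by
  simp only [symmDiff_comm u, sum_shift]

/-- The shifts permute the rows, so the random flips of a measurement round are invisible in sums
over all rows. For the first votes only these sums are needed. -/
theorem sum_shiftAvg (F : (Fin n → Bool) → ℂ) :
    ∑ x, shiftAvg η (fun u => F (x ∆ u)) = ∑ x, F x := by
  rw [← shiftAvg_sum]
  simp only [sum_shift, shiftAvg_const]

variable (η) in
/-- Joint weight of the report `R` and of a shift `w` of the off-diagonal index. -/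
def xKernel (R w : Fin n → Bool) : ℝ := 2 ^ n * (prepareKernel η w * measureKernel η R w)

/-- The CNOTs add the ancilla row `s` to the probe row and `s'` to the probe column. The weight
depends only on `w = s ∆ s'`, which moves `d`; the row `s` itself is uniform and joins the noise in
`shiftAvg`. The factor `2 ^ n` in `xKernel` cancels the normalisation of that average. -/
theorem hasData_xRound {next : Finset (Qubit n) → Protocol n}
    {B : Finset (Qubit n) → (Fin n → Bool) → (Fin n → Bool) → ℂ}
    (h : ∀ R, HasData η θ g (next R) (B R)) :
    HasData η θ g (.prepare (ancillas n) .x <|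
      .cnots (Sum.elim (fun i => some (anc i)) fun _ => none) <| .measure (ancillas n) .x next)
      (fun x d => shiftAvg η fun u => ∑ R, ∑ w, xKernel η R w * B (ancSet R) (x ∆ u) (d ∆ w)) := by
  intro x y x' y'
  have hc : ∀ p t : Fin n → Bool, (fun q => xor (Sum.elim p t q)
      (((Sum.elim (fun i => some (anc i)) fun _ => none) q : Option (Qubit n)).elim false
        (Sum.elim p t))) = Sum.elim (p ∆ t) t := fun p t => by
    funext q
    rcases q with i | i <;> simp
  have ha : ∀ x s f₀D f₀A f₁D f₂D : Fin n → Bool, (((x ∆ f₀D) ∆ (s ∆ f₀A)) ∆ f₁D) ∆ f₂D =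
      x ∆ ((f₀D ∆ (s ∆ f₀A)) ∆ f₁D ∆ f₂D) := fun x s f₀D f₀A f₁D f₂D => by
    simp only [symmDiff_assoc]
  have hb : ∀ x x' s s' f₀D f₀A : Fin n → Bool, ((x ∆ f₀D) ∆ (s ∆ f₀A)) ∆ ((x' ∆ f₀D) ∆ (s' ∆ f₀A))
      = (x ∆ x') ∆ (s ∆ s') := fun x x' s s' f₀D f₀A => by
    rw [symmDiff_symmDiff_symmDiff_comm, symmDiff_symmDiff_right_cancel,
      symmDiff_symmDiff_right_cancel]
  rw [heis_prepare_x]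
  simp only [heis_cnots, elim_symmDiff, hc, heis_measure_x h, symmDiff_symmDiff_right_cancel, hb]
  simp only [ha]
  refine if_congr Iff.rfl ?_ rfl
  have h2 : ((2 : ℂ)⁻¹ ^ n) * (2 : ℂ) ^ n = 1 := by rw [← mul_pow]; norm_num
  simp only [bern_sum, bern_mul, shiftAvg, Finset.mul_sum]
  refine Finset.sum_congr rfl fun s _ => ?_
  -- Substitutes `s' = s ∆ w`, which separates the uniform shift from the change of `d`.
  rw [← sum_shift' _ s, Finset.sum_comm]
  refine Finset.sum_congr rfl fun R _ => Finset.sum_congr rfl fun w _ => ?_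
  rw [symmDiff_symmDiff_cancel_left, xKernel]
  push_cast
  linear_combination (-1 : ℂ) * (prepareKernel η w : ℂ) * (measureKernel η R w : ℂ) *
    (bern (rateOn η.p (ancillas n)ᶜ) fun f₀ : Qubit n → Bool =>
      bern (rateOn η.p Finset.univ) fun f₁ : Qubit n → Bool =>
      bern (rateOn η.p (ancillas n)ᶜ) fun f₂ : Qubit n → Bool => B (ancSet R)
        (x ∆ (((f₀ ∘ Sum.inl) ∆ (s ∆ (f₀ ∘ Sum.inr))) ∆ (f₁ ∘ Sum.inl) ∆ (f₂ ∘ Sum.inl)))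
          ((x ∆ x') ∆ w)) * h2

variable (η) in
/-- The factor of `xKernel` at one qubit. -/
def xKernelOne (R w : Bool) : ℝ :=
  ((1 - η.q) * sgn R w + η.q * sgn (!R) w) / 2 * (if w then 1 - 2 * η.pprep else 1)

theorem xKernel_eq_prod (R w : Fin n → Bool) : xKernel η R w = ∏ i, xKernelOne η (R i) (w i) := by
  have h : (2 : ℝ) ^ n = ∏ _i : Fin n, 2 := by simp
  rw [xKernel, prepareKernel, measureKernel, h, ← Finset.prod_mul_distrib, ← Finset.prod_mul_distrib]
  refine Finset.prod_congr rfl fun i _ => ?_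
  rw [xKernelOne]
  ring

variable (η) in
/-- Evolution of one qubit's factor of a functional under `m` rounds of `X` measurements. -/
def xEvol (f : ℕ → Bool → ℝ) : ℕ → ℕ → Bool → ℝ
  | 0, c, d => f c d
  | m + 1, c, d => ∑ R, ∑ w, xKernelOne η R w * xEvol f m (c + if R then 1 else 0) (xor d w)

/-- Kernel and functional both factor over the qubits, so the sum over all reports and all shifts
distributes into one-qubit sums. -/
theorem sum_xKernel (f : ℕ → Bool → ℝ) (m : ℕ) (c : Fin n → ℕ) (d : Fin n → Bool) :
    ∑ R, ∑ w, xKernel η R w * ∏ i, xEvol η f m (c i + if anc i ∈ ancSet R then 1 else 0) ((d ∆ w) i)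
      = ∏ i, xEvol η f (m + 1) (c i) (d i) := by
  simp only [xKernel_eq_prod, ← Finset.prod_mul_distrib, anc_mem_ancSet, symmDiff_apply_bool]
  have h : ∀ R : Fin n → Bool, ∑ w : Fin n → Bool, ∏ i, xKernelOne η (R i) (w i) *
      xEvol η f m (c i + if R i = true then 1 else 0) (xor (d i) (w i)) =
      ∏ i, ∑ w, xKernelOne η (R i) w * xEvol η f m (c i + if R i = true then 1 else 0)
        (xor (d i) w) := fun R =>
    sum_pi_prod fun i (w : Bool) => xKernelOne η (R i) w *
      xEvol η f m (c i + if R i = true then 1 else 0) (xor (d i) w)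
  simp only [h]
  exact sum_pi_prod fun i (R : Bool) => ∑ w, xKernelOne η R w *
    xEvol η f m (c i + if R = true then 1 else 0) (xor (d i) w)

variable {J : Type*} [Fintype J]

/-- Measuring all `X_i` keeps functionals of product form that do not depend on the row index. -/
theorem hasData_xRounds_prod (m : ℕ) (K : J → ℂ) (f : J → ℕ → Bool → ℝ)
    {next : (Fin n → ℕ) → Protocol n}
    (h : ∀ c, HasData η θ g (next c) fun _ d => ∑ j, K j * ∏ i, (f j (c i) (d i) : ℂ))
    (c : Fin n → ℕ) : HasData η θ g (xRounds m c next)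
      fun _ d => ∑ j, K j * ∏ i, (xEvol η (f j) m (c i) (d i) : ℂ) := by
  induction m generalizing c with
  | zero => exact h c
  | succ m ih =>
    have h1 := hasData_xRound fun R => ih fun i => c i + if anc i ∈ R then 1 else 0
    simp only [shiftAvg_const] at h1
    rw [xRounds]
    convert h1 using 3 with x d
    simp only [Finset.mul_sum]
    rw [Finset.sum_congr rfl fun R _ => Finset.sum_comm, Finset.sum_comm]
    refine Finset.sum_congr rfl fun j _ => ?_
    have h2 := congrArg (fun r : ℝ => (r : ℂ)) (sum_xKernel (η := η) (f j) m c d)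
    push_cast at h2
    rw [← h2, Finset.mul_sum]
    refine Finset.sum_congr rfl fun R _ => ?_
    rw [Finset.mul_sum]
    exact Finset.sum_congr rfl fun w _ => by ring

/-- Measuring all `X_i` keeps functionals whose sum over the row index has product form. -/
theorem hasData_xRounds_sum (m : ℕ) (K : J → ℂ) (f : J → ℕ → Bool → ℝ)
    {next : (Fin n → ℕ) → Protocol n}
    (h : ∀ c, ∃ B, HasData η θ g (next c) B ∧
      ∀ d, ∑ x, B x d = ∑ j, K j * ∏ i, (f j (c i) (d i) : ℂ))
    (c : Fin n → ℕ) : ∃ B, HasData η θ g (xRounds m c next) B ∧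
      ∀ d, ∑ x, B x d = ∑ j, K j * ∏ i, (xEvol η (f j) m (c i) (d i) : ℂ) := by
  induction m generalizing c with
  | zero => exact h c
  | succ m ih =>
    choose B hB hB' using fun R : Finset (Qubit n) => ih fun i => c i + if anc i ∈ R then 1 else 0
    refine ⟨_, hasData_xRound hB, fun d => ?_⟩
    rw [sum_shiftAvg (fun x => ∑ R, ∑ w, (xKernel η R w : ℂ) * B (ancSet R) x (d ∆ w)),
      Finset.sum_comm, Finset.sum_congr rfl fun R _ => Finset.sum_comm]
    simp only [← Finset.mul_sum, hB']
    simp only [Finset.mul_sum]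
    rw [Finset.sum_congr rfl fun R _ => Finset.sum_comm, Finset.sum_comm]
    refine Finset.sum_congr rfl fun j _ => ?_
    have h2 := congrArg (fun r : ℝ => (r : ℂ)) (sum_xKernel (η := η) (f j) m c d)
    push_cast at h2
    rw [← h2, Finset.mul_sum]
    refine Finset.sum_congr rfl fun R _ => ?_
    rw [Finset.mul_sum]
    exact Finset.sum_congr rfl fun w _ => by ring

end XRounds

/-! ### Gates, sensing and syndrome measurements -/

section DataSteps

variable {n : ℕ} {η : NoiseRates} {θ : ℝ} {g : Bool → ℝ}

theorem hasData_output (b : Bool) : HasData (n := n) η θ g (.output b)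
    fun _ d => if d = ⊥ then (g b : ℂ) else 0 := by
  intro x y x' y'
  have h1 : Sum.elim x y = Sum.elim x' y' ↔ x = x' ∧ y = y' :=
    ⟨fun h => ⟨by simpa using congrArg (· ∘ Sum.inl) h, by simpa using congrArg (· ∘ Sum.inr) h⟩,
      fun ⟨h, h'⟩ => by rw [h, h']⟩
  simp only [heis, h1, symmDiff_eq_bot]
  split_ifs <;> simp_all

theorem bern_data {V : Type*} [AddCommGroup V] [Module ℝ V] (r : ℝ) (G : (Fin n → Bool) → V) :
    bern (rateOn r Finset.univ) (fun f : Qubit n → Bool => G (f ∘ Sum.inl)) =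
      bern (fun _ => r) G := by
  rw [bern_elim]
  simp only [Sum.elim_comp_inl, bern_const]
  congr 1
  funext i
  simp [rateOn]

theorem hasData_probeGates {h : Fin n → Gate} {next : Protocol n}
    {B : (Fin n → Bool) → (Fin n → Bool) → ℂ} (hB : HasData η θ g next B) :
    HasData η θ g (probeGates h next) fun x d =>
      (∏ i, (h i).phase (x i)) * star (∏ i, (h i).phase ((x ∆ d) i)) *
      bern (fun _ => η.p) fun f => B (x ∆ (fun i => (h i).flips) ∆ f) d := by
  intro x y x' y'
  have h0 : ∀ y : Fin n → Bool, ∏ i, Gate.idle.phase (y i) = 1 := fun y => by simp [Gate.phase]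
  have h1 : ((fun q : Qubit n => ((Sum.elim h fun _ => Gate.idle) q).flips) ∘ Sum.inr :
      Fin n → Bool) = ⊥ := rfl
  have h2 : ((fun q : Qubit n => ((Sum.elim h fun _ => Gate.idle) q).flips) ∘ Sum.inl :
      Fin n → Bool) = fun i => (h i).flips := rfl
  rw [probeGates, heis_gates]
  simp only [elim_symmDiff, hB _ _ _ _, symmDiff_symmDiff_right_cancel, Fintype.prod_sum_type,
    Sum.elim_inl, Sum.elim_inr, h0, mul_one, symmDiff_left_inj, h1, h2,
    symmDiff_symmDiff_cancel_left]
  split_ifs with hy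
  · rw [bern_data η.p fun f => B (x ∆ (fun i => (h i).flips) ∆ f) (x ∆ x')]
  · rw [bern_const, mul_zero]

theorem hasData_sense {next : Protocol n} {B : (Fin n → Bool) → (Fin n → Bool) → ℂ}
    (hB : HasData η θ g next B) : HasData η θ g (.sense next) fun x d =>
      Complex.exp (Complex.I * θ * ((magnetization (x ∆ d) - magnetization x) / 2)) * B x d := by
  intro x y x' y'
  rw [heis_sense, hB]
  simp only [Sum.elim_comp_inl, symmDiff_symmDiff_cancel_left, mul_ite, mul_zero]

theorem hasData_random {N : ℕ} {next : Fin N → Protocol n}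
    {B : Fin N → (Fin n → Bool) → (Fin n → Bool) → ℂ} (hB : ∀ j, HasData η θ g (next j) (B j)) :
    HasData η θ g (.random N next) fun x d => (N : ℂ)⁻¹ * ∑ j, B j x d := by
  intro x y x' y'
  simp only [heis, Finset.sum_apply, Pi.smul_apply, smul_eq_mul, hB _ _ _ _ _]
  split_ifs <;> simp

/-- The faults of one round of syndrome measurements: layer `0` holds the preparation errors,
layers `1`, `2`, `3`, `5` the bit flips after the preparation, the two CNOT layers and the
measurement, and layer `4` the errors of the reports. -/
abbrev RoundFaults (n : ℕ) : Type := Fin 6 × Qubit n → Bool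

/-- Error rates of one round of syndrome measurements. -/
def roundRate (η : NoiseRates) (n : ℕ) (p : Fin 6 × Qubit n) : ℝ :=
  rateOn ((![η.pprep, η.p, η.p, η.p, η.q, η.p] : Fin 6 → ℝ) p.1)
    ((![measureQubits n, (measureQubits n)ᶜ, Finset.univ, Finset.univ, measureQubits n,
      (measureQubits n)ᶜ] : Fin 6 → Finset (Qubit n)) p.1) p.2

/-- The reported value of a check in a round that starts with the bit string `x`. -/
def report (ω : RoundFaults n) (x : Fin n → Bool) (k : Fin (n - 1)) : Bool :=
  xor (xor (x (left k)) (ω (1, data (left k))))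
    (xor (xor (x (right k)) (xor (ω (1, data (right k))) (ω (2, data (right k)))))
      (xor (xor (ω (0, anc (left k))) (xor (ω (1, anc (left k))) (ω (2, anc (left k)))))
        (xor (ω (3, anc (left k))) (ω (4, anc (left k))))))

/-- The bit flips of the probes in a round. -/
def roundShift (ω : RoundFaults n) (i : Fin n) : Bool :=
  xor (xor (ω (1, data i)) (ω (2, data i))) (xor (ω (3, data i)) (ω (5, data i)))

theorem bern_roundRate (G : RoundFaults n → ℂ) : bern (roundRate η n) G =
    bern (rateOn η.pprep (measureQubits n)) fun f₀ =>
    bern (rateOn η.p (measureQubits n)ᶜ) fun f₁ =>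
    bern (rateOn η.p Finset.univ) fun f₂ =>
    bern (rateOn η.p Finset.univ) fun f₃ =>
    bern (rateOn η.q (measureQubits n)) fun f₄ =>
    bern (rateOn η.p (measureQubits n)ᶜ) fun f₅ =>
      G fun p => (![f₀, f₁, f₂, f₃, f₄, f₅] : Fin 6 → Qubit n → Bool) p.1 p.2 := by
  simp only [bern_cons, bern_of_isEmpty]
  refine congrArg (bern _) (funext fun f₀ => congrArg (bern _) (funext fun f₁ => congrArg (bern _)
    (funext fun f₂ => congrArg (bern _) (funext fun f₃ => congrArg (bern _) (funext fun f₄ =>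
      congrArg (bern _) (funext fun f₅ => congrArg G ?_))))))
  funext ⟨t, q⟩
  fin_cases t <;> rfl

theorem forall_mem_measureQubits (P : Qubit n → Prop) :
    (∀ q ∈ measureQubits n, P q) ↔ ∀ k : Fin (n - 1), P (anc (left k)) := by
  simp [measureQubits]

/-- A bit as an element of `ZMod 2`. -/
def bit (b : Bool) : ZMod 2 := if b then 1 else 0

/-- A measured qubit must carry the same value in row and column. Its value is a parity of two probe
bits up to faults common to both indices, so exactly the `d` that are equal on both probes of every
check survive. For these, row and column give the same reports. -/
theorem hasData_syndromeRound {next : (Fin (n - 1) → ZMod 2) → Protocol n}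
    {B : (Fin (n - 1) → ZMod 2) → (Fin n → Bool) → (Fin n → Bool) → ℂ}
    (hB : ∀ v, HasData η θ g (next v) (B v)) :
    HasData η θ g (.prepare (measureQubits n) .z <|
      .cnots (Sum.elim (fun _ => none) fun i => if i.1 + 1 < n then some (data i) else none) <|
      .cnots (Sum.elim (fun _ => none) fun i =>
        if h : i.1 + 1 < n then some (data ⟨i.1 + 1, h⟩) else none) <|
      .measure (measureQubits n) .z fun R => next fun k => if anc (left k) ∈ R then 1 else 0)
    fun x d => if ∀ k, d (left k) = d (right k) then bern (roundRate η n) fun ω =>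
      B (fun k => bit (report ω x k)) (x ∆ roundShift ω) d else 0 := by
  intro x y x' y'
  have hm : ∀ i : Fin n, anc i ∈ measureQubits n ↔ i.1 + 1 < n := fun i => by
    simp only [measureQubits, Finset.mem_image, Finset.mem_univ, true_and, Sum.inr.injEq, left]
    constructor
    · rintro ⟨k, hk⟩
      have := congrArg Fin.val hk
      have := k.2
      simp at *
      omega
    · exact fun h => ⟨⟨i, by omega⟩, rfl⟩
  have hm' : ∀ i : Fin n, data i ∉ measureQubits n := fun i => by simp [measureQubits]
  have ho : ∀ (e : Qubit n → Bool) (x y : Fin n → Bool), override (measureQubits n) e (Sum.elim x y)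
      = Sum.elim x fun i => if i.1 + 1 < n then e (anc i) else y i := fun e x y => by
    funext q
    rcases q with i | i <;> simp [override, hm, hm']
  have hc1 : ∀ x y : Fin n → Bool, (fun q => xor (Sum.elim x y q)
      (((Sum.elim (fun _ => none) fun i => if i.1 + 1 < n then some (data i) else none) q :
        Option (Qubit n)).elim false (Sum.elim x y))) =
      Sum.elim x fun i => if i.1 + 1 < n then xor (y i) (x i) else y i := fun x y => by
    funext q
    rcases q with i | i
    · simp
    · by_cases h : i.1 + 1 < n <;> simp [h]
  have hc2 : ∀ x y : Fin n → Bool, (fun q => xor (Sum.elim x y q)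
      (((Sum.elim (fun _ => none) fun i => if h : i.1 + 1 < n then some (data ⟨i.1 + 1, h⟩)
        else none) q : Option (Qubit n)).elim false (Sum.elim x y))) =
      Sum.elim x fun i => if h : i.1 + 1 < n then xor (y i) (x ⟨i.1 + 1, h⟩) else y i :=
    fun x y => by
    funext q
    rcases q with i | i
    · simp
    · by_cases h : i.1 + 1 < n <;> simp [h]
  have hl : ∀ k : Fin (n - 1), (left k).1 + 1 < n := fun k => by have := k.2; simp [left]; omega
  have hr : ∀ (k : Fin (n - 1)) h, (⟨(left k).1 + 1, h⟩ : Fin n) = right k := fun k h => rfl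
  rw [heis_prepare_z]
  simp only [ho, heis_cnots, elim_symmDiff, hc1, hc2, heis_measure_z, hB _ _ _ _ _,
    symmDiff_symmDiff_right_cancel, forall_mem_measureQubits, Sum.elim_inr, symmDiff_apply_bool,
    Function.comp, if_pos (hl _), dif_pos (hl _), hr]
  have hz : ∀ {ι : Type} [Fintype ι] [DecidableEq ι] (r : ι → ℝ) {G : (ι → Bool) → ℂ},
      (∀ f, G f = 0) → bern r G = 0 := fun r G h => by
    rw [show G = fun _ => 0 from funext h, bern_const]
  by_cases hA : ∀ k : Fin (n - 1), y (left k) = y' (left k)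
  swap
  · rw [if_neg hA, if_neg fun h => hA fun k => by rw [h]]
  rw [if_pos hA]
  -- The condition `d (left k) = d (right k)` written out. If it fails for some `k`, every fault
  -- pattern makes the measured values of row and column differ there.
  by_cases hC : ∀ k : Fin (n - 1), xor (x (left k)) (x' (left k)) = xor (x (right k)) (x' (right k))
  swap
  · rw [if_neg hC, ite_self]
    refine hz _ fun f₀ => hz _ fun f₁ => hz _ fun f₂ => hz _ fun f₃ => if_neg fun h => hC fun k => ?_
    have := h k
    revert this
    generalize x (left k) = a, x' (left k) = a', x (right k) = b, x' (right k) = b'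
    generalize f₁ (Sum.inl (right k)) = c, f₂ (Sum.inl (right k)) = d
    cases a <;> cases a' <;> cases b <;> cases b' <;> simp
  rw [if_pos hC]
  by_cases hy : y = y'
  swap
  · rw [if_neg hy]
    refine hz _ fun f₀ => hz _ fun f₁ => hz _ fun f₂ => hz _ fun f₃ => ?_
    split_ifs
    swap
    · rfl
    refine hz _ fun f₄ => hz _ fun f₅ => if_neg fun h => hy ?_
    rw [symmDiff_left_inj, symmDiff_left_inj] at h
    funext i
    by_cases hi : i.1 + 1 < n
    · exact hA ⟨i, by omega⟩
    · simpa [hi] using congrFun h i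
  subst hy
  rw [if_pos rfl, bern_roundRate]
  have hx : ∀ a a' b b' c d e f g h i : Bool, xor a a' = xor b b' →
      xor (xor (xor (xor (xor c d) (xor a e)) f) (xor (xor b g) h)) i =
        xor (xor (xor (xor (xor c d) (xor a' e)) f) (xor (xor b' g) h)) i := by
    intro a a' b b'
    cases a <;> cases a' <;> cases b <;> cases b' <;> simp
  refine congrArg (bern _) (funext fun f₀ => congrArg (bern _) (funext fun f₁ => congrArg (bern _)
    (funext fun f₂ => congrArg (bern _) (funext fun f₃ => ?_))))
  rw [if_pos fun k => hx _ _ _ _ _ _ _ _ _ _ _ (hC k)]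
  refine congrArg (bern _) (funext fun f₄ => congrArg (bern _) (funext fun f₅ => ?_))
  rw [if_pos]
  · refine congrArg₂ (fun v z => B v z (x ∆ x')) (funext fun k => ?_) (funext fun i => ?_)
    · have hb : ∀ a b : Bool, (a ^^ b) = true ↔ (a = true ∧ ¬ b = true ∨ b = true ∧ ¬ a = true) := by
        decide
      simp only [Finset.mem_symmDiff, Finset.mem_filter, hm, hl, true_and, mem_supp, ← hb, bit]
      congr 2
      have hs : ∀ a b c d e f g h i j : Bool, (a != (b != (c != (d != (e != (f != (g != (h !=
          (i != j))))))))) = (c != (d != (f != (g != (h != (a != (b != (e != (i != j))))))))) := by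
        simp only [Bool.bne_eq_xor, Bool.xor_left_comm, implies_true]
      simp [report, hl, hr]
      exact hs _ _ _ _ _ _ _ _ _ _
    · simp [roundShift]
  · rw [symmDiff_left_inj, symmDiff_left_inj]
    funext i
    by_cases hi : i.1 + 1 < n
    · have := hx _ _ _ _ (f₀ (anc i)) (f₁ (anc i)) (f₁ (data i)) (f₂ (anc i))
        (f₁ (data ⟨i + 1, hi⟩)) (f₂ (data ⟨i + 1, hi⟩)) false (hC ⟨i, by omega⟩)
      simpa [hi, left, right] using this
    · simp [hi]

end DataSteps

/-! ### The outcome distribution of the protocol -/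

section Trajectory

variable {n : ℕ}

/-- The bit string of the probes at the beginning of round `t`. -/
def trajectory (x : Fin n → Bool) (w : ℕ → RoundFaults n) : ℕ → Fin n → Bool
  | 0 => x
  | t + 1 => trajectory x w t ∆ roundShift (w t)

/-- The history `s` after `m` further rounds that start with round `t`. -/
def historyAfter : ℕ → ℕ → History n → (Fin n → Bool) → (ℕ → RoundFaults n) → History n
  | 0, _, s, _, _ => s
  | m + 1, t, s, x, w => historyAfter m (t + 1)
      (Function.update s t fun k => bit (report (w 0) x k)) (x ∆ roundShift (w 0)) fun i => w (i + 1)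

theorem trajectory_succ' (x : Fin n → Bool) (w : ℕ → RoundFaults n) (t : ℕ) :
    trajectory x w (t + 1) = trajectory (x ∆ roundShift (w 0)) (fun i => w (i + 1)) t := by
  induction t with
  | zero => rfl
  | succ t ih => rw [trajectory, ih, trajectory]

theorem historyAfter_of_lt (m : ℕ) {t t' : ℕ} (h : t' < t) (s : History n) (x : Fin n → Bool)
    (w : ℕ → RoundFaults n) : historyAfter m t s x w t' = s t' := by
  induction m generalizing t s x w with
  | zero => rfl
  | succ m ih => rw [historyAfter, ih (by omega), Function.update_of_ne (by omega)]

theorem historyAfter_add {m i : ℕ} (h : i < m) (t : ℕ) (s : History n) (x : Fin n → Bool)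
    (w : ℕ → RoundFaults n) : historyAfter m t s x w (t + i) =
      fun k => bit (report (w i) (trajectory x w i) k) := by
  induction m generalizing i t s x w with
  | zero => omega
  | succ m ih =>
    rw [historyAfter]
    cases i with
    | zero => rw [historyAfter_of_lt _ (by omega)]; simp [trajectory]
    | succ i =>
      rw [trajectory_succ', show t + (i + 1) = t + 1 + i by omega]
      exact ih (by omega) _ _ _ _

/-- The faults of `m` rounds as a sequence. -/
def faultSeq {m : ℕ} (ω : Fin m × (Fin 6 × Qubit n) → Bool) (t : ℕ) : RoundFaults n :=
  fun l => if h : t < m then ω (⟨t, h⟩, l) else false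

theorem faultSeq_consBits_zero {m : ℕ} (f : RoundFaults n)
    (h : Fin m × (Fin 6 × Qubit n) → Bool) : faultSeq (consBits f h) 0 = f := by
  funext l
  simp only [faultSeq, Nat.zero_lt_succ, dif_pos]
  rfl

theorem faultSeq_consBits_succ {m : ℕ} (f : RoundFaults n)
    (h : Fin m × (Fin 6 × Qubit n) → Bool) (t : ℕ) :
    faultSeq (consBits f h) (t + 1) = faultSeq h t := by
  funext l
  by_cases ht : t < m
  · simp only [faultSeq, ht, dif_pos, Nat.succ_lt_succ ht]
    rfl
  · simp [faultSeq, ht]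

variable {η : NoiseRates} {θ : ℝ} {g : Bool → ℝ}

/-- The alternative `m = 0` is needed because without any round nothing projects `d`. Each round
consumes one layer of fault bits through `bern_cons`. -/
theorem hasData_syndromeRounds (m : ℕ) {next : History n → Protocol n}
    {B : History n → (Fin n → Bool) → (Fin n → Bool) → ℂ} (hB : ∀ s, HasData η θ g (next s) (B s))
    (t : ℕ) (s : History n) : HasData η θ g (syndromeRounds m t s next) fun x d =>
      if m = 0 ∨ ∀ k, d (left k) = d (right k) then
        bern (fun p : Fin m × (Fin 6 × Qubit n) => roundRate η n p.2) fun ω =>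
          B (historyAfter m t s x (faultSeq ω)) (trajectory x (faultSeq ω) m) d else 0 := by
  induction m generalizing t s with
  | zero =>
    simp only [true_or, if_true, bern_of_isEmpty]
    exact hB s
  | succ m ih =>
    have h := hasData_syndromeRound fun v => ih (t + 1) (Function.update s t v)
    rw [syndromeRounds]
    convert h using 3 with x d
    by_cases hd : ∀ k, d (left k) = d (right k)
    · simp only [hd, implies_true, or_true, if_true]
      rw [bern_cons]
      simp only [historyAfter, trajectory_succ', faultSeq_consBits_zero, faultSeq_consBits_succ]
    · simp [hd]

end Trajectory

/-! ### Exact outcome probabilities -/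

section Outcome

variable {n : ℕ}

/-- The sign of a vote. -/
def voteSign (r c : ℕ) : ℝ := if majority r c then -1 else 1

/-- The data bits after error correction: round faults `ω`, bit flips `f` after the correction. -/
def corrected {T : ℕ} (D : MinWeightDecoder n) (x : Fin n → Bool)
    (ω : Fin T × (Fin 6 × Qubit n) → Bool) (f : Fin n → Bool) : Fin n → Bool :=
  trajectory x (faultSeq ω) T ∆ (fun i => decide (D.correction T
    (historyAfter T 0 (fun _ _ => 0) x (faultSeq ω)) i = 1)) ∆ f

/-- The contribution of the initial bit string `x` to the signal. -/
def signalTerm (η : NoiseRates) (T : ℕ) (D : MinWeightDecoder n) (θ : ℝ) (x : Fin n → Bool) : ℝ :=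
  bern (fun p : Fin T × (Fin 6 × Qubit n) => roundRate η n p.2) fun ω =>
    bern (fun _ : Fin n => η.p) fun f => (n : ℝ)⁻¹ * magnetization (corrected D x ω f) *
      bern (fun _ : Fin n => η.p) fun f' => Real.sin (θ * magnetization (corrected D x ω f ∆ f'))

/-- One qubit's factor of the functional that only sees diagonal matrix units. -/
def diagFactor (_ : ℕ) (d : Bool) : ℝ := if d then 0 else 1

/-- One qubit's factor of the parity of the votes. -/
def signFactor (r c : ℕ) (d : Bool) : ℝ := if d then 0 else voteSign r c

/-- One qubit's factor of the phase that the correction of `Z` errors gives to coherences. -/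
def phaseFactor (r c : ℕ) (d : Bool) : ℝ := if d then voteSign r c else 0

/-- Trace preservation: if the reports are ignored, the two reports add up and cancel every shift of
`d`. -/
theorem xEvol_diagFactor (η : NoiseRates) (m c : ℕ) (d : Bool) :
    xEvol η diagFactor m c d = if d then 0 else 1 := by
  induction m generalizing c d with
  | zero => rfl
  | succ m ih =>
    simp only [xEvol, ih, Fintype.sum_bool, xKernelOne, sgn]
    cases d <;> simp <;> ring

theorem magnetization_symmDiff_top (x : Fin n → Bool) :
    magnetization (x ∆ ⊤) = - magnetization x := by
  rw [magnetization, magnetization, ← Finset.sum_neg_distrib]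
  refine Finset.sum_congr rfl fun i _ => ?_
  cases h : x i <;> simp [h]

/-- The checks connect all probes in a line, so a string without violated check is constant. -/
theorem closed_iff (hn : 0 < n) (d : Fin n → Bool) :
    (∀ k, d (left k) = d (right k)) ↔ d = ⊥ ∨ d = ⊤ := by
  constructor
  · intro h
    have h1 : ∀ j (hj : j < n), d ⟨j, hj⟩ = d ⟨0, hn⟩ := fun j => by
      induction j with
      | zero => exact fun _ => rfl
      | succ j ih => exact fun hj => (h ⟨j, by omega⟩).symm.trans (ih (by omega))
    cases h0 : d ⟨0, hn⟩
    · left; funext i; exact (h1 i i.2).trans h0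
    · right; funext i; exact (h1 i i.2).trans h0
  · rintro (rfl | rfl) k <;> rfl

theorem prod_neg_one_pow {ι : Type*} [Fintype ι] (v : ι → Bool) :
    (if Odd (Finset.univ.filter fun i => v i = true).card then (-1 : ℝ) else 1) =
      ∏ i, if v i then (-1 : ℝ) else 1 := by
  rw [Finset.prod_ite, Finset.prod_const_one, mul_one, Finset.prod_const]
  split_ifs with h
  · rw [h.neg_one_pow]
  · rw [(Nat.not_odd_iff_even.1 h).neg_one_pow]

variable {η : NoiseRates} {θ : ℝ} {g : Bool → ℝ}

/-- The final measurement, on diagonal matrix units and on coherences between opposite strings. -/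
theorem hasData_readout (hn : 0 < n) (r : ℕ) : ∃ B : (Fin n → Bool) → ℂ,
    HasData (n := n) η θ g (xRounds r (fun _ => 0) fun c =>
      .output (decide (Odd (Finset.univ.filter fun i => majority r (c i) = true).card)))
      (fun _ d => B d) ∧
    B ⊥ = (((g false + g true) / 2 + (g false - g true) / 2 * xEvol η (signFactor r) r 0 false ^ n :
      ℝ) : ℂ) ∧
    B ⊤ = (((g false - g true) / 2 * xEvol η (signFactor r) r 0 true ^ n : ℝ) : ℂ) := by
  -- The output value `g` of the parity equals its mean over both outputs plus half the difference
  -- times the product of the vote signs. These are two product functionals, indexed by a bit.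
  have h := hasData_xRounds_prod (η := η) (θ := θ) (g := g) (n := n) r
    (fun b : Bool => if b then (((g false - g true) / 2 : ℝ) : ℂ) else
      (((g false + g true) / 2 : ℝ) : ℂ)) (fun b => if b then signFactor r else diagFactor)
    (next := fun c =>
      .output (decide (Odd (Finset.univ.filter fun i => majority r (c i) = true).card)))
    (fun c => ?_) fun _ => 0
  · refine ⟨_, h, ?_, ?_⟩
    · simp [xEvol_diagFactor]
      ring
    · simp [xEvol_diagFactor, hn.ne']
  · convert hasData_output _ using 3 with x d
    by_cases hd : d = ⊥
    · subst hd
      have h1 := prod_neg_one_pow fun i => majority r (c i)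
      have h2 : ∀ i, ((signFactor r (c i) false : ℝ) : ℂ) =
        (((if majority r (c i) = true then -1 else 1 : ℝ)) : ℂ) := fun i => rfl
      simp only [Fintype.sum_bool, if_true, show ∀ i, (⊥ : Fin n → Bool) i = false from fun _ => rfl, h2,
        Bool.false_eq_true, if_false, diagFactor, Complex.ofReal_one, Finset.prod_const_one]
      rw [← Complex.ofReal_prod, ← h1]
      by_cases ho : Odd (Finset.univ.filter fun i => majority r (c i) = true).card
      · rw [if_pos ho, decide_eq_true ho]; push_cast; ring
      · rw [if_neg ho, decide_eq_false ho]; push_cast; ring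
    · obtain ⟨i, hi⟩ : ∃ i, d i = true := by
        by_contra! hc
        exact hd (funext fun i => by simpa using hc i)
      have h3 : ∀ b : Bool, ∏ i, (((if b then signFactor r else diagFactor) (c i) (d i) : ℝ) : ℂ) =
          0 := fun b => Finset.prod_eq_zero (Finset.mem_univ i) (by
            cases b <;> simp [signFactor, diagFactor, hi])
      simp [h3, hd]

theorem prod_phase_S (j : Fin n) (x : Fin n → Bool) :
    ∏ i, (if i = j then Gate.S else Gate.idle).phase (x i) = if x j then Complex.I else 1 := by
  rw [Finset.prod_eq_single_of_mem j (Finset.mem_univ j) fun i _ h => by simp [h, Gate.phase]]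
  simp [Gate.phase]

theorem prod_phase_X (P : Fin n → Prop) [DecidablePred P] (x : Fin n → Bool) :
    ∏ i, (if P i then Gate.X else Gate.idle).phase (x i) = 1 :=
  Finset.prod_eq_one fun i _ => by split_ifs <;> rfl

/-- On the coherence between `x` and its complement the gate `S` on probe `j` gives the phase `-i`
or `i` according to bit `j`. Averaging over `j` yields the magnetisation, with the same sign that
the signal phase carries. -/
theorem sum_phase (x : Fin n → Bool) :
    ∑ j, (if x j then Complex.I else 1) * star (if (x ∆ ⊤) j then Complex.I else 1) =
      -Complex.I * magnetization x := by
  rw [magnetization, Complex.ofReal_sum, Finset.mul_sum]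
  refine Finset.sum_congr rfl fun j _ => ?_
  rw [symmDiff_apply_bool, show (⊤ : Fin n → Bool) j = true from rfl]
  cases x j <;> simp

theorem symmDiff_const_false (x : Fin n → Bool) : (x ∆ fun _ => false) = x := symmDiff_bot x

theorem re_I_mul_exp (φ : ℝ) : (Complex.I * Complex.exp (-(Complex.I * φ))).re = Real.sin φ := by
  rw [show -(Complex.I * (φ : ℂ)) = ((-φ : ℝ) : ℂ) * Complex.I by push_cast; ring]
  rw [Complex.I_mul_re, Complex.exp_ofReal_mul_I_im, Real.sin_neg, neg_neg]

theorem bern_re {ι : Type*} [Fintype ι] [DecidableEq ι] (r : ι → ℝ) (G : (ι → Bool) → ℂ) :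
    (bern r G).re = bern r fun f => (G f).re :=
  bern_map Complex.reLm r G

/-- The part of the protocol from the syndrome measurements on. -/
theorem hasData_encoded (hn : 0 < n) (r : ℕ) {T : ℕ} (hT : 0 < T) (D : MinWeightDecoder n) :
    ∃ B, HasData (n := n) η θ g (syndromeRounds T 0 (fun _ _ => 0) fun s =>
      probeGates (fun i => if D.correction T s i = 1 then .X else .idle) <|
      .random n fun j =>
      probeGates (fun i => if i = j then .S else .idle) <|
      .sense <|
      xRounds r (fun _ => 0) fun c =>
      .output (decide (Odd (Finset.univ.filter fun i => majority r (c i) = true).card))) B ∧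
    (∀ x, B x ⊥ = (((g false + g true) / 2 +
      (g false - g true) / 2 * xEvol η (signFactor r) r 0 false ^ n : ℝ) : ℂ)) ∧
    (∀ x, (B x ⊤).re = -((g false - g true) / 2 * xEvol η (signFactor r) r 0 true ^ n *
      signalTerm η T D θ x)) ∧
    ∀ x d, d ≠ ⊥ → d ≠ ⊤ → B x d = 0 := by
  obtain ⟨B, hB, hB0, hB1⟩ := hasData_readout (η := η) (θ := θ) (g := g) hn r
  have h := hasData_syndromeRounds T (fun s =>
    hasData_probeGates (h := fun i => if D.correction T s i = 1 then .X else .idle) <|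
      hasData_random fun j => hasData_probeGates (h := fun i => if i = j then .S else .idle) <|
        hasData_sense hB) 0 fun _ _ => 0
  have hS : ∀ (j i : Fin n), (if i = j then Gate.S else Gate.idle).flips = false := fun j i => by
    split_ifs <;> rfl
  have hX : ∀ (P : Prop) [Decidable P], (if P then Gate.X else Gate.idle).flips = decide P :=
    fun P _ => by
    by_cases hP : P <;> simp [hP, Gate.flips]
  have hn' : (n : ℂ) ≠ 0 := by exact_mod_cast hn.ne'
  simp only [prod_phase_X, prod_phase_S, star_one, one_mul, hS, hX, symmDiff_const_false,
    hT.ne', false_or] at h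
  refine ⟨_, h, fun x => ?_, fun x => ?_, fun x d hd hd' => ?_⟩
  · have h1 : ∀ (z : Fin n → Bool) (j : Fin n), (if z j then Complex.I else 1) *
        star (if z j then Complex.I else 1) = 1 := fun z j => by cases z j <;> simp
    simp only [symmDiff_bot, sub_self, zero_div, mul_zero, Complex.exp_zero, one_mul, h1, hB0,
      bern_const, Finset.sum_const, Finset.card_univ, Fintype.card_fin, nsmul_eq_mul, inv_mul_cancel_left₀ hn']
    simp
  -- Complementary strings have opposite magnetisation, so the signal phase is `-θm`. Together with
  -- the factor `-i` of the phase gate its real part becomes a sine.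
  · have h2 : ∀ m : ℝ, Complex.I * θ * ((((-m : ℝ) : ℂ) - m) / 2) = -(Complex.I * ((θ * m : ℝ) : ℂ)) :=
      fun m => by push_cast; ring
    rw [if_pos ((closed_iff hn ⊤).2 (Or.inr rfl))]
    simp only [magnetization_symmDiff_top, h2, hB1, ← Finset.sum_mul, sum_phase]
    rw [signalTerm, bern_re, ← bern_mul_real, show ∀ a : ℝ, -a = (-1) * a from fun a => by ring,
      ← bern_mul_real]
    congr 1
    funext ω
    rw [bern_re, ← bern_mul_real, ← bern_mul_real]
    congr 1
    funext f
    rw [← bern_mul, ← bern_mul, bern_re, ← bern_mul_real, ← bern_mul_real, ← bern_mul_real]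
    congr 1
    funext f'
    rw [← re_I_mul_exp, ← Complex.re_ofReal_mul, ← Complex.re_ofReal_mul, ← Complex.re_ofReal_mul]
    congr 1
    simp only [corrected]
    push_cast
    ring
  · rw [if_neg]
    rw [closed_iff hn]
    tauto

theorem sum_prod_two {R : Type*} [CommRing R] (f : Fin n → Bool → R) :
    ∑ w : Fin n → Bool, ∏ i, f i (w i) = ∏ i, (f i true + f i false) := by
  rw [sum_pi_prod]
  simp

theorem dual_probes {K : Operator n} {k k' : (Fin n → Bool) → ℂ} {x y x' y' : Fin n → Bool}
    (h : ∀ p s, K (Sum.elim p s) (Sum.elim x y) = k p * (if s = y then 1 else 0))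
    (h' : ∀ p s, K (Sum.elim p s) (Sum.elim x' y') = k' p * (if s = y' then 1 else 0))
    (A : Obs n) : dual K A (Sum.elim x y) (Sum.elim x' y') =
      ∑ p, ∑ p', k p * star (k' p') * A (Sum.elim p y) (Sum.elim p' y') := by
  have h1 : ∀ a b, dual K A a b = ∑ p, ∑ s, ∑ p', ∑ s', K (Sum.elim p s) a *
      star (K (Sum.elim p' s') b) * A (Sum.elim p s) (Sum.elim p' s') := fun a b => by
    simp only [dual, sum_qubit (n := n)]
  rw [h1]
  refine Finset.sum_congr rfl fun p _ => ?_
  rw [Finset.sum_eq_single_of_mem y (Finset.mem_univ _) (by simp +contextual [h])]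
  refine Finset.sum_congr rfl fun p' _ => ?_
  rw [Finset.sum_eq_single_of_mem y' (Finset.mem_univ _) (by simp +contextual [h'])]
  simp [h, h']

/-- The value of a functional at the initial preparation of the probes. -/
theorem heis_prepare_probes {P : Protocol n} {B : (Fin n → Bool) → (Fin n → Bool) → ℂ}
    (hB : HasData η θ g P B) :
    heis η θ g (.prepare (probes n) .x P) (fun _ => false) (fun _ => false) =
      ∑ w, (prepareKernel η w : ℂ) * ∑ x, B x w := by
  have h0 : (fun _ => false : Qubit n → Bool) =
      Sum.elim (fun _ => false : Fin n → Bool) fun _ => false := by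
    funext q; rcases q with i | i <;> rfl
  have hd : ∀ E O, dual (resetKraus (probes n) .x E O) (flipObs η.p (probes n)ᶜ (heis η θ g P))
      (Sum.elim (fun _ => false) fun _ => false) (Sum.elim (fun _ => false) fun _ => false) =
      if ∀ q ∈ probes n, (fun _ => false : Qubit n → Bool) q = decide (q ∈ O) then
        ∑ w, ((∏ i, sgn (decide (data i ∈ E)) (w i) / 2 : ℝ) : ℂ) * ∑ x, B x w else 0 := fun E O => by
    have hO : (∀ q ∈ probes n, (fun _ => false : Qubit n → Bool) q = decide (q ∈ O)) ↔
        (fun _ => false : Fin n → Bool) = fun i => decide (data i ∈ O) := by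
      rw [funext_iff]
      constructor
      · exact fun h i => h _ (data_mem_probes i)
      · rintro h (i | i) hq
        · exact h i
        · exact absurd hq (anc_notMem_probes i)
    rw [dual_probes (fun p s => resetKraus_probes _ _ _ p s _ _)
      (fun p s => resetKraus_probes _ _ _ p s _ _)]
    simp only [hO]
    split_ifs with hE
    · simp only [flipObs_apply, elim_symmDiff, hB _ _ _ _, symmDiff_symmDiff_right_cancel, if_true,
        mul_one]
      have h1 : ∀ p w : Fin n → Bool, (∏ i, Basis.x.ket (decide (data i ∈ E)) (p i)) *
          star (∏ i, Basis.x.ket (decide (data i ∈ E)) ((p ∆ w) i)) =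
          ((∏ i, sgn (decide (data i ∈ E)) (w i) / 2 : ℝ) : ℂ) := fun p w => by
        rw [star_prod, ← Finset.prod_mul_distrib, Complex.ofReal_prod]
        refine Finset.prod_congr rfl fun i _ => ?_
        rw [ket_mul_star_ket, symmDiff_apply_bool]
        cases p i <;> simp
      rw [Finset.sum_congr rfl fun p _ => (sum_shift' _ p).symm, Finset.sum_comm]
      simp only [h1, symmDiff_symmDiff_cancel_left]
      refine Finset.sum_congr rfl fun w _ => ?_
      rw [← Finset.mul_sum, ← bern_sum]
      congr 1
      simp only [sum_shift (fun x => B x w), bern_const]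
    · simp
  rw [h0]
  simp only [heis, Finset.sum_apply, Pi.smul_apply, hd, Complex.coe_smul]
  rw [Finset.sum_congr rfl fun E _ => by
    rw [sum_powerset_indicator (probes n) (fun _ => false) fun _ =>
      ∑ w, ((∏ i, sgn (decide (data i ∈ E)) (w i) / 2 : ℝ) : ℂ) * ∑ x, B x w]]
  rw [sum_powerset_weight η.pprep (probes n) fun E =>
    ∑ w, ((∏ i, sgn (decide (data i ∈ E)) (w i) / 2 : ℝ) : ℂ) * ∑ x, B x w]
  rw [bern_sum]
  refine Finset.sum_congr rfl fun w _ => ?_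
  simp only [mul_comm _ (∑ x, B x w), bern_mul]
  congr 1
  have h2 : ∀ e : Qubit n → Bool, ((∏ i, sgn (decide (data i ∈ supp e)) (w i) / 2 : ℝ)
      : ℂ) = ∏ q, Sum.elim (fun i b => ((sgn b (w i) / 2 : ℝ) : ℂ))
        (fun _ _ => (1 : ℂ)) q (e q) := fun e => by
    rw [Fintype.prod_sum_type, Complex.ofReal_prod]
    simp
  simp only [h2]
  rw [bern_prod, Fintype.prod_sum_type, prepareKernel, Complex.ofReal_prod]
  simp only [Sum.elim_inl, Sum.elim_inr, rateOn, anc_notMem_probes, data_mem_probes, if_true,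
    if_false]
  simp only [zero_smul, sub_zero, one_smul, zero_add, Finset.prod_const_one, mul_one]
  refine Finset.prod_congr rfl fun i _ => ?_
  rw [← Complex.coe_smul, ← Complex.coe_smul, smul_eq_mul, smul_eq_mul]
  norm_cast
  simp only [sgn]
  split_ifs <;> simp_all <;> ring

/-- A `Z` on a probe changes the sign of every coherence between complementary strings, so the
correction multiplies it by the product of the votes. -/
theorem prod_phase_Z (r : ℕ) (c : Fin n → ℕ) (x : Fin n → Bool) :
    (∏ i, (if majority r (c i) then Gate.Z else Gate.idle).phase (x i)) *
      star (∏ i, (if majority r (c i) then Gate.Z else Gate.idle).phase ((x ∆ ⊤) i)) =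
      ∏ i, (voteSign r (c i) : ℂ) := by
  rw [star_prod, ← Finset.prod_mul_distrib]
  refine Finset.prod_congr rfl fun i _ => ?_
  rw [symmDiff_apply_bool, show (⊤ : Fin n → Bool) i = true from rfl, voteSign]
  cases majority r (c i) <;> cases x i <;> simp [Gate.phase]

variable (η) in
/-- The damping of the signal by errors of the first votes. -/
def prepDamping (r : ℕ) : ℝ :=
  xEvol η (phaseFactor r) r 0 false + (1 - 2 * η.pprep) * xEvol η (phaseFactor r) r 0 true

/-- From the syndrome rounds on, only `d = ⊥` and `d = ⊤` contribute. Summed over rows, these are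
two product functionals (`diagFactor`, `phaseFactor`), so the first votes and the preparation of the
probes enter through the `n`-th power of one-qubit quantities. -/
theorem heis_protocol (hn : 0 < n) (r : ℕ) {T : ℕ} (hT : 0 < T) (D : MinWeightDecoder n) :
    (heis η θ g (protocol r T D) (fun _ => false) (fun _ => false)).re =
      (g false + g true) / 2 + (g false - g true) / 2 * (xEvol η (signFactor r) r 0 false ^ n -
        (xEvol η (signFactor r) r 0 true * prepDamping η r) ^ n *
        ((2 ^ n)⁻¹ * ∑ x, signalTerm η T D θ x)) := by
  obtain ⟨B, hB, hB0, hB1, hB2⟩ := hasData_encoded (η := η) (θ := θ) (g := g) hn r hT D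
  have hbt : (⊥ : Fin n → Bool) ≠ ⊤ := fun h => by
    have := congrFun h ⟨0, hn⟩
    exact Bool.false_ne_true this
  obtain ⟨B', hB', hs⟩ := hasData_xRounds_sum (η := η) (θ := θ) (g := g) (n := n) r
    (fun b : Bool => if b then ∑ x, B x ⊤ else ∑ x, B x ⊥)
    (fun b => if b then phaseFactor r else diagFactor)
    (next := fun c => probeGates (fun i => if majority r (c i) then .Z else .idle) <|
      syndromeRounds T 0 (fun _ _ => 0) fun s =>
      probeGates (fun i => if D.correction T s i = 1 then .X else .idle) <|
      .random n fun j =>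
      probeGates (fun i => if i = j then .S else .idle) <|
      .sense <|
      xRounds r (fun _ => 0) fun c =>
      .output (decide (Odd (Finset.univ.filter fun i => majority r (c i) = true).card)))
    (fun c => ⟨_, hasData_probeGates hB, fun d => by
      have hZ : ∀ (P : Prop) [Decidable P], (if P then Gate.Z else Gate.idle).flips = false :=
        fun P _ => by split_ifs <;> rfl
      simp only [Fintype.sum_bool, if_true, Bool.false_eq_true, if_false, hZ, symmDiff_const_false]
      by_cases hd : d = ⊥
      · subst hd
        have h1 : ∀ x : Fin n → Bool,
            (∏ i, (if majority r (c i) = true then Gate.Z else Gate.idle).phase (x i)) *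
            star (∏ i, (if majority r (c i) = true then Gate.Z else Gate.idle).phase (x i)) = 1 :=
          fun x => by
          rw [star_prod, ← Finset.prod_mul_distrib]
          refine Finset.prod_eq_one fun i _ => ?_
          split_ifs <;> cases x i <;> simp [Gate.phase]
        have h2 : ∏ i : Fin n, ((phaseFactor r (c i) ((⊥ : Fin n → Bool) i) : ℝ) : ℂ) = 0 :=
          Finset.prod_eq_zero (Finset.mem_univ ⟨0, hn⟩) (by simp [phaseFactor])
        have h3 : ∏ i : Fin n, ((diagFactor (c i) ((⊥ : Fin n → Bool) i) : ℝ) : ℂ) = 1 :=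
          Finset.prod_eq_one fun i _ => by simp [diagFactor]
        simp only [symmDiff_bot, h1, one_mul, h2, h3, mul_zero, zero_add, mul_one]
        rw [← bern_sum]
        simp only [sum_shift (fun x => B x ⊥), bern_const]
      · by_cases hd' : d = ⊤
        · subst hd'
          have h2 : ∏ i : Fin n, ((phaseFactor r (c i) ((⊤ : Fin n → Bool) i) : ℝ) : ℂ) =
              ∏ i, (voteSign r (c i) : ℂ) :=
            Finset.prod_congr rfl fun i _ => by simp [phaseFactor]
          have h3 : ∏ i : Fin n, ((diagFactor (c i) ((⊤ : Fin n → Bool) i) : ℝ) : ℂ) = 0 :=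
            Finset.prod_eq_zero (Finset.mem_univ ⟨0, hn⟩) (by simp [diagFactor])
          simp only [prod_phase_Z, h2, h3, mul_zero, add_zero]
          rw [← Finset.mul_sum, ← bern_sum, mul_comm]
          simp only [sum_shift (fun x => B x ⊤), bern_const]
        · have hex : ∀ b : Bool, d ≠ (fun _ => b) → ∃ i, d i = !b := fun b hb => by
            by_contra! hc
            exact hb (funext fun i => by simpa using hc i)
          obtain ⟨i, hi⟩ := hex false hd
          obtain ⟨j, hj⟩ := hex true hd'
          have h2 : ∏ i : Fin n, ((phaseFactor r (c i) (d i) : ℝ) : ℂ) = 0 :=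
            Finset.prod_eq_zero (Finset.mem_univ j) (by simp [phaseFactor, hj])
          have h3 : ∏ i : Fin n, ((diagFactor (c i) (d i) : ℝ) : ℂ) = 0 :=
            Finset.prod_eq_zero (Finset.mem_univ i) (by simp [diagFactor, hi])
          simp [h2, h3, hB2 _ d hd hd', bern_const]⟩) fun _ => 0
  rw [protocol, heis_prepare_probes hB']
  have hk : ∀ F : Bool → ℝ, ∑ w : Fin n → Bool, prepareKernel η w * ∏ i, F (w i) =
      ((F false + (1 - 2 * η.pprep) * F true) / 2) ^ n := fun F => by
    simp only [prepareKernel, ← Finset.prod_mul_distrib]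
    rw [sum_prod_two (fun (_ : Fin n) b => (if b = true then 1 - 2 * η.pprep else 1) / 2 * F b)]
    simp
    ring
  have hk0 := hk fun d => xEvol η diagFactor r 0 d
  have hk1 := hk fun d => xEvol η (phaseFactor r) r 0 d
  have hc : ∑ w, (prepareKernel η w : ℂ) * ∑ x, B' x w =
      (((2 : ℝ)⁻¹ ^ n : ℝ) : ℂ) * ∑ x, B x ⊥ + (((prepDamping η r / 2) ^ n : ℝ) : ℂ) * ∑ x, B x ⊤ := by
    have e0 : (((2 : ℝ)⁻¹ ^ n : ℝ) : ℂ) = ∑ w : Fin n → Bool, (prepareKernel η w : ℂ) *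
        ∏ i, (xEvol η diagFactor r 0 (w i) : ℂ) := by
      have : ((2 : ℝ)⁻¹ ^ n) = ((xEvol η diagFactor r 0 false + (1 - 2 * η.pprep) *
        xEvol η diagFactor r 0 true) / 2) ^ n := by simp [xEvol_diagFactor]
      rw [this, ← hk0]
      push_cast
      rfl
    have e1 : (((prepDamping η r / 2) ^ n : ℝ) : ℂ) = ∑ w : Fin n → Bool,
        (prepareKernel η w : ℂ) * ∏ i, (xEvol η (phaseFactor r) r 0 (w i) : ℂ) := by
      rw [prepDamping, ← hk1]
      push_cast
      rfl
    rw [e0, e1, Finset.sum_mul, Finset.sum_mul, ← Finset.sum_add_distrib]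
    refine Finset.sum_congr rfl fun w _ => ?_
    rw [hs]
    simp only [Fintype.sum_bool, if_true, Bool.false_eq_true, if_false]
    ring
  rw [hc, Complex.add_re, Complex.re_ofReal_mul, Complex.re_ofReal_mul, Complex.re_sum,
    Complex.re_sum]
  simp only [hB0, hB1, Complex.ofReal_re, Finset.sum_const, Finset.card_univ, Fintype.card_fun,
    Fintype.card_bool, Fintype.card_fin, nsmul_eq_mul, Finset.sum_neg_distrib, ← Finset.mul_sum]
  push_cast
  have h2 : ((2 : ℝ)⁻¹ ^ n) * (2 : ℝ) ^ n = 1 := by rw [← mul_pow]; norm_num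
  rw [← mul_assoc, h2, div_pow, mul_pow]
  ring

theorem outcomeProb_eq (hn : 0 < n) (r : ℕ) {T : ℕ} (hT : 0 < T) (D : MinWeightDecoder n)
    (b : Bool) : outcomeProb η r T D b θ = 1 / 2 + (if b then -1 else 1) / 2 *
      (xEvol η (signFactor r) r 0 false ^ n - (xEvol η (signFactor r) r 0 true * prepDamping η r) ^ n *
        ((2 ^ n)⁻¹ * ∑ x, signalTerm η T D θ x)) := by
  have h := sum_run η θ (fun y => if y = b then 1 else 0) (protocol r T D)
    (Matrix.single (fun _ => false) (fun _ => false) 1)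
  have hp : ∀ A : Obs n, pair A (Matrix.single (fun _ => false) (fun _ => false) 1) =
      A (fun _ => false) (fun _ => false) := fun A => by
    rw [pair, Finset.sum_eq_single_of_mem (fun _ => false) (Finset.mem_univ _),
      Finset.sum_eq_single_of_mem (fun _ => false) (Finset.mem_univ _)]
    · simp
    · intro c _ hc
      rw [Matrix.single_apply_of_col_ne _ _ hc.symm, mul_zero]
    · intro c _ hc
      exact Finset.sum_eq_zero fun d _ => by
        rw [Matrix.single_apply_of_row_ne hc.symm, mul_zero]
  rw [hp, heis_protocol hn r hT D] at h
  rw [outcomeProb]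
  cases b <;> simpa using h

end Outcome

/-! ### Connected sets of edges -/

section Connected

variable {α : Type*} [DecidableEq α] (N : α → Finset α)

/-- The ranges of walks with `k` steps that start at `x`, for the neighbourhoods `N`. -/
def walkRanges : ℕ → α → Finset (Finset α)
  | 0, x => {{x}}
  | k + 1, x => (N x).biUnion fun y => (walkRanges k y).image (insert x)

/-- Sets obtained from `{x}` by adding `m` new neighbours of elements already present. -/
inductive Grown (x : α) : ℕ → Finset α → Prop
  | base : Grown x 0 {x}
  | step {m : ℕ} {Γ : Finset α} {z u : α} (h : Grown x m Γ) (hz : z ∈ Γ) (hu : u ∈ N z)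
      (hΓ : u ∉ Γ) : Grown x (m + 1) (insert u Γ)

variable {N}

theorem card_walkRanges_le {Δ : ℕ} (h : ∀ x, (N x).card ≤ Δ) (k : ℕ) (x : α) :
    (walkRanges N k x).card ≤ Δ ^ k := by
  induction k generalizing x with
  | zero => simp [walkRanges]
  | succ k ih =>
    calc (walkRanges N (k + 1) x).card ≤ ∑ y ∈ N x, ((walkRanges N k y).image (insert x)).card :=
          Finset.card_biUnion_le
      _ ≤ ∑ _y ∈ N x, Δ ^ k := Finset.sum_le_sum fun y _ => Finset.card_image_le.trans (ih y)
      _ = (N x).card * Δ ^ k := by rw [Finset.sum_const, smul_eq_mul]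
      _ ≤ Δ ^ (k + 1) := by rw [pow_succ']; exact Nat.mul_le_mul_right _ (h x)

theorem insert_mem_walkRanges {k : ℕ} {x y : α} {Γ : Finset α} (hy : y ∈ N x)
    (h : Γ ∈ walkRanges N k y) : insert x Γ ∈ walkRanges N (k + 1) x :=
  Finset.mem_biUnion.2 ⟨y, hy, Finset.mem_image_of_mem _ h⟩

/-- When the walk passes `z`, insert a step to `u` and back: two more steps, one more point. -/
theorem detour_mem_walkRanges (hN : ∀ x y, y ∈ N x → x ∈ N y) {k : ℕ} {x z u : α} {Γ : Finset α}
    (h : Γ ∈ walkRanges N k x) (hz : z ∈ Γ) (hu : u ∈ N z) :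
    insert u Γ ∈ walkRanges N (k + 2) x := by
  induction k generalizing x Γ with
  | zero =>
    obtain rfl : Γ = {x} := by simpa [walkRanges] using h
    obtain rfl : z = x := by simpa using hz
    have h1 := insert_mem_walkRanges hu (insert_mem_walkRanges (hN _ _ hu) h)
    convert h1 using 1
    ext; simp
  | succ k ih =>
    obtain ⟨y, hy, hΓ⟩ := Finset.mem_biUnion.1 h
    obtain ⟨Γ', hΓ', rfl⟩ := Finset.mem_image.1 hΓ
    rcases Finset.mem_insert.1 hz with rfl | hz'
    · have h1 := insert_mem_walkRanges hu (insert_mem_walkRanges (hN _ _ hu) h)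
      convert h1 using 1
      ext; simp
    · rw [Finset.insert_comm]
      exact insert_mem_walkRanges hy (ih hΓ' hz')

/-- Connected sets are ranges of walks, which turns counting them into counting walks: at most `Δ ^
(2 * m)` sets with `m + 1` elements. -/
theorem Grown.mem_walkRanges (hN : ∀ x y, y ∈ N x → x ∈ N y) {x : α} {m : ℕ} {Γ : Finset α}
    (h : Grown N x m Γ) : Γ ∈ walkRanges N (2 * m) x := by
  induction h with
  | base => simp [walkRanges]
  | step h hz hu _ ih => exact detour_mem_walkRanges hN ih hz hu

theorem Grown.card {x : α} {m : ℕ} {Γ : Finset α} (h : Grown N x m Γ) : Γ.card = m + 1 := by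
  induction h with
  | base => simp
  | step h hz hu hΓ ih => rw [Finset.card_insert_of_notMem hΓ, ih]

theorem Grown.mem {x : α} {m : ℕ} {Γ : Finset α} (h : Grown N x m Γ) : x ∈ Γ := by
  induction h with
  | base => simp
  | step h hz hu hΓ ih => exact Finset.mem_insert_of_mem ih

/-- A set that contains all neighbours of its elements within `δ`. -/
def ClosedIn (N : α → Finset α) (δ C : Finset α) : Prop := ∀ z ∈ C, ∀ u ∈ N z, u ∈ δ → u ∈ C

/-- Grow `{x}` inside `δ` as long as a neighbour is missing; the cardinality of `δ` stops this. -/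
theorem exists_component {δ : Finset α} {x : α} (hx : x ∈ δ) :
    ∃ m Γ, Grown N x m Γ ∧ Γ ⊆ δ ∧ ClosedIn N δ Γ := by
  by_contra! hc
  have h : ∀ m, ∃ Γ, Grown N x m Γ ∧ Γ ⊆ δ := fun m => by
    induction m with
    | zero => exact ⟨{x}, .base, by simpa using hx⟩
    | succ m ih =>
      obtain ⟨Γ, hΓ, hδ⟩ := ih
      have h1 := hc m Γ hΓ hδ
      simp only [ClosedIn, not_forall] at h1
      obtain ⟨z, hz, u, hu, huδ, huΓ⟩ := h1
      exact ⟨_, hΓ.step hz hu huΓ, Finset.insert_subset huδ hδ⟩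
  obtain ⟨Γ, hΓ, hδ⟩ := h δ.card
  have := Finset.card_le_card hδ
  rw [hΓ.card] at this
  omega

/-- A closed set that meets a connected subset of `δ` can be followed back to its base point. This
lets a component be re-rooted at any of its elements. -/
theorem Grown.base_mem {δ C Γ : Finset α} (hN : ∀ x y, y ∈ N x → x ∈ N y) (hC : ClosedIn N δ C)
    {x y : α} {m : ℕ} (h : Grown N x m Γ) (hδ : Γ ⊆ δ) (hy : y ∈ Γ) (hyC : y ∈ C) : x ∈ C := by
  induction h generalizing y with
  | base => simp at hy; exact hy ▸ hyC
  | @step m Γ z u h hz hu hΓ ih =>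
    have hδ' := (Finset.insert_subset_iff.1 hδ).2
    rcases Finset.mem_insert.1 hy with rfl | hy
    · exact ih hδ' hz (hC _ hyC _ (hN _ _ hu) (hδ' hz))
    · exact ih hδ' hy hyC

end Connected

/-! ### The matching graph -/

section Matching

variable {T n : ℕ}

/-- The edges of the matching graph of `T` rounds. -/
abbrev Edge (T n : ℕ) : Type := (Fin (T - 1) × Fin n) ⊕ (Fin T × Fin (n - 1))

/-- Positions of the edges in the plane. -/
def edgePos : Edge T n → ℤ × ℤ
  | .inl (t, i) => (2 * t + 1, 2 * i)
  | .inr (t, k) => (2 * t, 2 * k + 1)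

theorem edgePos_injective : Function.Injective (edgePos (T := T) (n := n)) := by
  rintro (⟨t, i⟩ | ⟨t, i⟩) (⟨t', i'⟩ | ⟨t', i'⟩) h <;>
    simp only [edgePos, Prod.mk.injEq] at h <;> obtain ⟨h1, h2⟩ := h
  · have : t = t' := Fin.ext (by omega)
    have : i = i' := Fin.ext (by omega)
    simp_all
  · omega
  · omega
  · have : t = t' := Fin.ext (by omega)
    have : i = i' := Fin.ext (by omega)
    simp_all

/-- Edges at distance at most `2`; they include all edges that share a detector. -/
def nearEdges (e : Edge T n) : Finset (Edge T n) := Finset.univ.filter fun e' =>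
  |(edgePos e').1 - (edgePos e).1| ≤ 2 ∧ |(edgePos e').2 - (edgePos e).2| ≤ 2

theorem mem_nearEdges {e e' : Edge T n} : e' ∈ nearEdges e ↔
    |(edgePos e').1 - (edgePos e).1| ≤ 2 ∧ |(edgePos e').2 - (edgePos e).2| ≤ 2 := by
  simp [nearEdges]

theorem nearEdges_symm (e e' : Edge T n) (h : e' ∈ nearEdges e) : e ∈ nearEdges e' := by
  rw [mem_nearEdges] at *
  rwa [abs_sub_comm, abs_sub_comm (edgePos e).2]

theorem card_nearEdges_le (e : Edge T n) : (nearEdges e).card ≤ 25 := by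
  have h : (Finset.Icc ((edgePos e).1 - 2) ((edgePos e).1 + 2) ×ˢ
      Finset.Icc ((edgePos e).2 - 2) ((edgePos e).2 + 2)).card = 25 := by
    rw [Finset.card_product, Int.card_Icc, Int.card_Icc]
    ring_nf
    rfl
  rw [← h]
  refine Finset.card_le_card_of_injOn edgePos (fun e' he' => ?_) edgePos_injective.injOn
  have := mem_nearEdges.1 he'
  simp only [abs_le] at this
  simp only [Finset.coe_product, Set.mem_prod, Finset.mem_coe, Finset.mem_Icc]
  omega

theorem Grown.edgePos_le {x y : Edge T n} {m : ℕ} {Γ : Finset (Edge T n)}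
    (h : Grown nearEdges x m Γ) (hy : y ∈ Γ) : |(edgePos y).1 - (edgePos x).1| ≤ 2 * m := by
  induction h generalizing y with
  | base => simp at hy; simp [hy]
  | @step m Γ z u h hz hu hΓ ih =>
    rcases Finset.mem_insert.1 hy with rfl | hy
    · have h1 := ih hz
      have h2 := (mem_nearEdges.1 hu).1
      rw [abs_le] at *
      push_cast
      constructor <;> linarith
    · have := ih hy
      push_cast
      linarith

/-- The coefficient of a chain at an edge. -/
def Chain.coeff (c : Chain n) : Edge T n → ZMod 2
  | .inl (t, i) => c.space t i
  | .inr (t, k) => c.time t k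

variable (T) in
/-- The edges of a chain. -/
def Chain.edges (c : Chain n) : Finset (Edge T n) := Finset.univ.filter fun e => c.coeff e ≠ 0

theorem Chain.mem_edges {c : Chain n} {e : Edge T n} : e ∈ c.edges T ↔ c.coeff e ≠ 0 := by
  simp [Chain.edges]

theorem Chain.card_edges (c : Chain n) : (c.edges T).card = c.length T := by
  rw [Chain.length, Chain.edges, Finset.card_filter, Fintype.sum_sum_type, Fintype.sum_prod_type,
    Fintype.sum_prod_type, Finset.sum_range, Finset.sum_range]
  simp only [Finset.card_filter]
  rfl

/-- The sum of two chains. -/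
def Chain.add (c c' : Chain n) : Chain n :=
  ⟨fun t i => c.space t i + c'.space t i, fun t k => c.time t k + c'.time t k⟩

theorem Chain.coeff_add (c c' : Chain n) (e : Edge T n) :
    (c.add c').coeff e = c.coeff e + c'.coeff e := by
  rcases e with ⟨t, i⟩ | ⟨t, i⟩ <;> rfl

/-- The chain with a given set of edges. -/
def chainOf (Γ : Finset (Edge T n)) : Chain n :=
  ⟨fun t i => if h : t < T - 1 then (if .inl (⟨t, h⟩, i) ∈ Γ then 1 else 0) else 0,
    fun t k => if h : t < T then (if .inr (⟨t, h⟩, k) ∈ Γ then 1 else 0) else 0⟩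

theorem coeff_chainOf (Γ : Finset (Edge T n)) (e : Edge T n) :
    (chainOf Γ).coeff e = if e ∈ Γ then 1 else 0 := by
  rcases e with ⟨t, i⟩ | ⟨t, i⟩ <;> simp [Chain.coeff, chainOf]

variable (T) in
/-- The chain has no boundary inside the matching graph. -/
def Chain.IsCycle (c : Chain n) : Prop := ∀ t, t + 1 < T → ∀ k,
  boundary (c.space t) k + c.time (t + 1) k + c.time t k = 0

theorem zmod_two_add_self (a : ZMod 2) : a + a = 0 := by
  revert a; decide

theorem zmod_two_eq_one {a : ZMod 2} (h : a ≠ 0) : a = 1 := by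
  revert a; decide

/-- The at most four edges at a detector are mutually near. A closed part of a cycle hence contains
either all of the cycle's edges at a detector or none, and is itself a cycle. -/
theorem isCycle_chainOf {δ : Chain n} (hδ : δ.IsCycle T) {Γ : Finset (Edge T n)}
    (hΓ : Γ ⊆ δ.edges T) (hc : ClosedIn nearEdges (δ.edges T) Γ) : (chainOf Γ).IsCycle T := by
  intro t ht k
  let e : Fin 4 → Edge T n := ![.inl (⟨t, by omega⟩, left k), .inl (⟨t, by omega⟩, right k),
    .inr (⟨t + 1, ht⟩, k), .inr (⟨t, by omega⟩, k)]
  have hsum : ∀ c : Chain n, boundary (c.space t) k + c.time (t + 1) k + c.time t k =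
      c.coeff (e 0) + c.coeff (e 1) + c.coeff (e 2) + c.coeff (e 3) := fun c => rfl
  have hnear : ∀ a b, e a ∈ nearEdges (e b) := fun a b => by
    rw [mem_nearEdges, abs_le, abs_le]
    fin_cases a <;> fin_cases b <;> simp [e, edgePos, left, right] <;> omega
  rw [hsum]
  by_cases h : ∃ b, e b ∈ Γ
  · obtain ⟨b, hb⟩ := h
    have h1 : ∀ a, (chainOf Γ).coeff (e a) = δ.coeff (e a) := fun a => by
      rw [coeff_chainOf]
      split_ifs with ha
      · exact (zmod_two_eq_one (Chain.mem_edges.1 (hΓ ha))).symm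
      · by_contra hne
        exact ha (hc _ hb _ (hnear a b) (Chain.mem_edges.2 (Ne.symm hne)))
    rw [h1, h1, h1, h1, ← hsum]
    exact hδ t ht k
  · push Not at h
    simp [coeff_chainOf, h]

/-- A shortest chain uses at most half of the edges of a cycle in its sum with the true chain. -/
theorem card_le_two_mul_card_inter {c E : Chain n} {s : History n} (hc : c.IsMinimal T s)
    {Γ : Finset (Edge T n)} (hΓ : Γ ⊆ (c.add E).edges T) (hcyc : (chainOf Γ).IsCycle T) :
    Γ.card ≤ 2 * (Γ ∩ E.edges T).card := by
  have h1 : (c.add (chainOf Γ)).Explains T s := fun t ht k => by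
    rw [hc.1 t ht k]
    have := hcyc t ht k
    simp only [Chain.add, boundary] at *
    linear_combination -this
  have h2 := hc.2 _ h1
  rw [← Chain.card_edges, ← Chain.card_edges] at h2
  have h3 : (c.add (chainOf Γ)).edges T = (c.edges T) ∆ Γ := by
    ext e
    rw [Chain.mem_edges, Chain.coeff_add, coeff_chainOf, Finset.mem_symmDiff, Chain.mem_edges]
    by_cases he : e ∈ Γ
    · simp only [he, if_true]
      generalize c.coeff e = a
      revert a; decide
    · simp [he]
  have h4 : Γ ⊆ (Γ ∩ c.edges T) ∪ (Γ ∩ E.edges T) := fun e he => by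
    have := Chain.mem_edges.1 (hΓ he)
    rw [Chain.coeff_add] at this
    rw [Finset.mem_union, Finset.mem_inter, Finset.mem_inter, Chain.mem_edges, Chain.mem_edges]
    by_contra! hcon
    exact this (by rw [hcon.1 he, hcon.2 he, add_zero])
  -- Minimality against the chain with `Γ` added says that `c` uses at most half of `Γ`; by `h4`
  -- every other edge of `Γ` lies in `E`.
  have h5 := (Finset.card_le_card h4).trans (Finset.card_union_le _ _)
  rw [h3] at h2
  have h6 : ((c.edges T) ∆ Γ).card + 2 * (Γ ∩ c.edges T).card = (c.edges T).card + Γ.card := by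
    have a1 : (c.edges T) ∆ Γ = (c.edges T \ Γ) ∪ (Γ \ c.edges T) := rfl
    rw [a1, Finset.card_union_of_disjoint disjoint_sdiff_sdiff]
    have a2 := Finset.card_sdiff_add_card_inter (c.edges T) Γ
    have a3 := Finset.card_sdiff_add_card_inter Γ (c.edges T)
    rw [Finset.inter_comm] at a2
    omega
  omega

/-- There is a connected set of `m + 1` edges at `x` at least half of which are errors. -/
def Bad (E : Finset (Edge T n)) (x : Edge T n) (m : ℕ) : Prop :=
  ∃ Γ ∈ walkRanges nearEdges (2 * m) x, Γ.card = m + 1 ∧ Γ.card ≤ 2 * (Γ ∩ E).card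

theorem boundary_eq_zero {e : Fin n → ZMod 2} (h : ∀ k, boundary e k = 0) (i j : Fin n) :
    e i = e j := by
  have h1 : ∀ (a : ℕ) (ha : a < n), e ⟨a, ha⟩ = e ⟨0, by omega⟩ := fun a => by
    induction a with
    | zero => exact fun _ => rfl
    | succ a ih =>
      intro ha
      rw [← ih (by omega)]
      have h2 : ∀ a b : ZMod 2, a + b = 0 → b = a := by decide
      exact h2 _ _ (h ⟨a, by omega⟩)
  exact (h1 i i.2).trans (h1 j j.2).symm

/-- The residual error after decoding is, up to a global flip, caused by short bad clusters that
reach the last round, unless there is a bad cluster that is as long as the number of rounds. -/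
theorem residual_error {c E : Chain n} {s : History n} (hc : c.IsMinimal T s)
    (hE : E.Explains T s) (hT : 0 < T) {e : Fin n → ZMod 2}
    (he : ∀ k, boundary e k = E.time (T - 1) k + c.time (T - 1) k)
    (hbad : ∀ x : Edge T n, ∀ m, T - 1 ≤ m → ¬ Bad (E.edges T) x m) :
    ∃ κ, ∀ i, e i ≠ κ → ∃ t : Fin (T - 1), ∃ m, T - 1 - t.1 ≤ m ∧
      Bad (E.edges T) (.inl (t, i)) m := by
  classical
  have hδ : (c.add E).IsCycle T := fun t ht k => by
    have h1 := hc.1 t ht k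
    have h2 := hE t ht k
    simp only [Chain.add, boundary] at *
    have h3 := zmod_two_add_self (s (t + 1) k + s t k)
    nth_rw 1 [h1] at h3
    rw [h2] at h3
    linear_combination h3
  set δ := c.add E with hδdef
  choose! m Γ hg hsub hcl using fun x (hx : x ∈ δ.edges T) =>
    exists_component (N := nearEdges) hx
  have hB : ∀ x ∈ δ.edges T, Bad (E.edges T) x (m x) := fun x hx =>
    ⟨Γ x, (hg x hx).mem_walkRanges nearEdges_symm, (hg x hx).card,
      card_le_two_mul_card_inter hc (hsub x hx) (isCycle_chainOf hδ (hsub x hx) (hcl x hx))⟩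
  let last (k : Fin (n - 1)) : Edge T n := .inr (⟨T - 1, by omega⟩, k)
  -- Only components that contain a time-like edge of the last round can affect the corrected
  -- syndrome.
  let S : Finset (Edge T n) := (Finset.univ.filter fun k => last k ∈ δ.edges T).biUnion
    fun k => Γ (last k)
  have hS : ∀ y, y ∈ S ↔ ∃ k, last k ∈ δ.edges T ∧ y ∈ Γ (last k) := fun y => by simp [S]
  have hSsub : S ⊆ δ.edges T := fun y hy => by
    obtain ⟨k, hk, hy⟩ := (hS y).1 hy
    exact hsub _ hk hy
  have hScl : ClosedIn nearEdges (δ.edges T) S := fun z hz u hu huδ => by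
    obtain ⟨k, hk, hz⟩ := (hS z).1 hz
    exact (hS u).2 ⟨k, hk, hcl _ hk z hz u hu huδ⟩
  have hcyc := isCycle_chainOf hδ hSsub hScl
  have hfirst : ∀ k, (chainOf S).time 0 k = 0 := fun k => by
    simp only [chainOf, hT, dif_pos]
    rw [if_neg]
    intro hmem
    obtain ⟨k', hk', hy⟩ := (hS _).1 hmem
    -- Reaching round `0` from the last round covers the distance `2 (T - 1)` in steps of at most
    -- `2`, so the cluster would have `m ≥ T - 1`, which `hbad` excludes.
    have h1 := (hg _ hk').edgePos_le hy
    refine hbad (last k') (m (last k')) ?_ (hB _ hk')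
    rw [show (edgePos (last k')).1 = 2 * ((T - 1 : ℕ) : ℤ) from rfl,
      show (edgePos (.inr (⟨0, hT⟩, k) : Edge T n)).1 = 2 * ((0 : ℕ) : ℤ) from rfl, abs_le] at h1
    omega
  -- The flips accumulated along `S`. Since `S` is a cycle that avoids the first round, their
  -- boundary before each round is the set of time-like edges of that round.
  let y : ℕ → Fin n → ZMod 2 := fun t i => ∑ t' ∈ Finset.range t, (chainOf S).space t' i
  have hy : ∀ t, t < T → ∀ k, boundary (y t) k = (chainOf S).time t k := fun t => by
    induction t with
    | zero => intro _ k; simp [y, boundary, hfirst]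
    | succ t ih =>
      intro ht k
      have h1 := ih (by omega) k
      have h2 := hcyc t ht k
      have h3 := zmod_two_add_self ((chainOf S).time t k)
      have h4 := zmod_two_add_self ((chainOf S).time (t + 1) k)
      simp only [boundary, y, Finset.sum_range_succ] at *
      linear_combination h1 + h2 - h4
  have hlast : ∀ k, (chainOf S).time (T - 1) k = E.time (T - 1) k + c.time (T - 1) k := fun k => by
    have h1 : (chainOf S).time (T - 1) k = (chainOf S).coeff (last k) := rfl
    have h2 : E.time (T - 1) k + c.time (T - 1) k = δ.coeff (last k) := add_comm _ _
    rw [h1, h2, coeff_chainOf]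
    split_ifs with h
    · exact (zmod_two_eq_one (Chain.mem_edges.1 (hSsub h))).symm
    · by_contra hne
      have hk : last k ∈ δ.edges T := Chain.mem_edges.2 (Ne.symm hne)
      exact h ((hS _).2 ⟨k, hk, (hg _ hk).mem⟩)
  -- In the last round `S` has the same time-like edges as `δ`, so `e` and `y (T - 1)` have the same
  -- boundary and differ by a global flip.
  have hconst := boundary_eq_zero (e := fun i => e i + y (T - 1) i) fun k => by
    have h1 := he k
    have h2 := hy (T - 1) (by omega) k
    rw [hlast] at h2
    have h3 := zmod_two_add_self (E.time (T - 1) k + c.time (T - 1) k)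
    simp only [boundary] at *
    linear_combination h1 + h2 + h3
  rcases isEmpty_or_nonempty (Fin n) with hn | ⟨⟨i₀⟩⟩
  · exact ⟨0, fun i => (hn.false i).elim⟩
  refine ⟨e i₀ + y (T - 1) i₀, fun i hi => ?_⟩
  have hyi : y (T - 1) i ≠ 0 := fun h0 => hi (by rw [← hconst i i₀, h0, add_zero])
  obtain ⟨t, ht, hne⟩ := Finset.exists_ne_zero_of_sum_ne_zero hyi
  have ht' := Finset.mem_range.1 ht
  have hmem : (.inl (⟨t, ht'⟩, i) : Edge T n) ∈ S := by
    by_contra h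
    simp [chainOf, ht', h] at hne
  obtain ⟨k, hk, hik⟩ := (hS _).1 hmem
  have hx := hSsub hmem
  refine ⟨⟨t, ht'⟩, m _, ?_, hB _ hx⟩
  -- The component is taken anew with the space-like edge as base, so that clusters are counted from
  -- the affected probe. The odd distance `2 (T - 1 - t) - 1` rounds up to `m ≥ T - 1 - t`.
  have h1 := (hg _ hx).edgePos_le
    ((hg _ hk).base_mem nearEdges_symm (hcl _ hx) (hsub _ hk) hik (hg _ hx).mem)
  rw [show (edgePos (last k)).1 = 2 * ((T - 1 : ℕ) : ℤ) from rfl,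
    show (edgePos (.inl (⟨t, ht'⟩, i) : Edge T n)).1 = 2 * (t : ℤ) + 1 from rfl, abs_le] at h1
  change T - 1 - t ≤ _
  omega

end Matching

/-! ### Faults and the true chain -/

section Faults

variable {T n : ℕ}

theorem bit_xor (a b : Bool) : bit (xor a b) = bit a + bit b := by
  revert a b; decide

/-- The errors in the matching graph that are caused by given faults. -/
def trueChain (w : ℕ → RoundFaults n) : Chain n where
  space t i := bit (w t (3, data i)) + bit (w t (5, data i)) +
    (bit (w (t + 1) (1, data i)) + bit (w (t + 1) (2, data i)))
  time t k := bit (w t (2, data (left k))) + (bit (w t (0, anc (left k))) +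
    (bit (w t (1, anc (left k))) + bit (w t (2, anc (left k)))) +
    (bit (w t (3, anc (left k))) + bit (w t (4, anc (left k)))))

/-- The errors of the probes at the reference time of round `t`. -/
def roundState (x : Fin n → Bool) (w : ℕ → RoundFaults n) (t : ℕ) (i : Fin n) : ZMod 2 :=
  bit (trajectory x w t i) + (bit (w t (1, data i)) + bit (w t (2, data i)))

/-- The reference time lies between the second CNOT layer and the flips that precede it. The left
probe has interacted earlier, so its flip in layer `2` is missing from the report and is booked as a
time-like error. -/
theorem bit_report (x : Fin n → Bool) (w : ℕ → RoundFaults n) (t : ℕ) (k : Fin (n - 1)) :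
    bit (report (w t) (trajectory x w t) k) =
      boundary (roundState x w t) k + (trueChain w).time t k := by
  have h2 : (2 : ZMod 2) = 0 := rfl
  simp only [report, bit_xor, boundary, roundState, trueChain]
  linear_combination (- bit (w t (2, data (left k)))) * h2

theorem roundState_succ (x : Fin n → Bool) (w : ℕ → RoundFaults n) (t : ℕ) (i : Fin n) :
    roundState x w (t + 1) i = roundState x w t i + (trueChain w).space t i := by
  simp only [roundState, trajectory, symmDiff_apply_bool, roundShift, bit_xor, trueChain]
  ring

/-- Differences of consecutive reports see only the flips between two reference times and the two
report errors, whatever the initial string `x`. -/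
theorem trueChain_explains (x : Fin n → Bool) (w : ℕ → RoundFaults n) {s : History n}
    (hs : ∀ t < T, ∀ k, s t k = bit (report (w t) (trajectory x w t) k)) :
    (trueChain w).Explains T s := fun t ht k => by
  have h2 : (2 : ZMod 2) = 0 := rfl
  rw [hs _ ht, hs _ (by omega), bit_report, bit_report]
  simp only [boundary, roundState_succ]
  linear_combination (roundState x w t (left k) + roundState x w t (right k)) * h2

/-- The faults that affect an edge of the matching graph. -/
def faultLocs : Edge T n → Finset (Fin T × (Fin 6 × Qubit n))
  | .inl (t, i) => {(⟨t, by omega⟩, 3, data i), (⟨t, by omega⟩, 5, data i),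
      (⟨t + 1, by omega⟩, 1, data i), (⟨t + 1, by omega⟩, 2, data i)}
  | .inr (t, k) => {(t, 2, data (left k)), (t, 0, anc (left k)), (t, 1, anc (left k)),
      (t, 2, anc (left k)), (t, 3, anc (left k)), (t, 4, anc (left k))}

theorem card_faultLocs_le (e : Edge T n) : (faultLocs e).card ≤ 6 := by
  rcases e with ⟨t, i⟩ | ⟨t, k⟩
  · exact Finset.card_le_four.trans (by norm_num)
  · exact Finset.card_le_six

theorem left_injective : Function.Injective (left (n := n)) := fun k k' h =>
  Fin.ext (by simpa [left] using h)

/-- A fault touches at most one space-like and one time-like edge, hence `Sum.isLeft` separates the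
affected edges. Two occur for a layer `2` flip of a probe between its two checks. -/
theorem card_filter_faultLocs_le (Γ : Finset (Edge T n)) (l : Fin T × (Fin 6 × Qubit n)) :
    (Γ.filter fun e => l ∈ faultLocs e).card ≤ 2 := by
  rw [← Fintype.card_bool, ← Finset.card_univ]
  refine Finset.card_le_card_of_injOn Sum.isLeft (fun _ _ => Finset.mem_coe.2 (Finset.mem_univ _)) ?_
  intro e he e' he' h
  have h1 := (Finset.mem_filter.1 he).2
  have h2 := (Finset.mem_filter.1 he').2
  obtain ⟨τ, a, q⟩ := l
  rcases e with ⟨t, i⟩ | ⟨t, k⟩ <;> rcases e' with ⟨t', i'⟩ | ⟨t', k'⟩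
  · simp only [faultLocs, Finset.mem_insert, Finset.mem_singleton, Prod.mk.injEq] at h1 h2
    have hi : i = i' := by
      rcases h1 with h1 | h1 | h1 | h1 <;> rcases h2 with h2 | h2 | h2 | h2 <;>
        exact Sum.inl_injective (h1.2.2.symm.trans h2.2.2)
    have ht : t = t' := by
      rcases h1 with ⟨h1, rfl, -⟩ | ⟨h1, rfl, -⟩ | ⟨h1, rfl, -⟩ | ⟨h1, rfl, -⟩ <;>
      rcases h2 with ⟨h2, h3, -⟩ | ⟨h2, h3, -⟩ | ⟨h2, h3, -⟩ | ⟨h2, h3, -⟩ <;>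
        first
        | exact absurd h3 (by decide)
        | (have h4 := congrArg Fin.val (h1.symm.trans h2); exact Fin.ext (by simpa using h4))
    rw [hi, ht]
  · simp at h
  · simp at h
  · simp only [faultLocs, Finset.mem_insert, Finset.mem_singleton, Prod.mk.injEq] at h1 h2
    have ht : t = t' := by
      rcases h1 with h1 | h1 | h1 | h1 | h1 | h1 <;> rcases h2 with h2 | h2 | h2 | h2 | h2 | h2 <;>
        exact h1.1.symm.trans h2.1
    have hq : ∀ k : Fin (n - 1), (τ = t ∧ a = 2 ∧ q = data (left k) ∨ τ = t ∧ a = 0 ∧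
        q = anc (left k) ∨ τ = t ∧ a = 1 ∧ q = anc (left k) ∨ τ = t ∧ a = 2 ∧ q = anc (left k) ∨
        τ = t ∧ a = 3 ∧ q = anc (left k) ∨ τ = t ∧ a = 4 ∧ q = anc (left k)) →
        Sum.elim id id q = left k := by
      intro k h
      rcases h with h | h | h | h | h | h <;> rw [h.2.2] <;> rfl
    have hk := left_injective ((hq k h1).symm.trans (hq k' (ht ▸ h2)))
    rw [ht, hk]

theorem exists_fault (ω : Fin T × (Fin 6 × Qubit n) → Bool) {e : Edge T n}
    (he : e ∈ (trueChain (faultSeq ω)).edges T) : ∃ l ∈ faultLocs e, ω l = true := by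
  by_contra! hc
  refine Chain.mem_edges.1 he ?_
  rcases e with ⟨t, i⟩ | ⟨t, k⟩
  · have h1 : t.1 < T := by omega
    have h2 : t.1 + 1 < T := by omega
    simp only [faultLocs, Finset.mem_insert, Finset.mem_singleton, forall_eq_or_imp, forall_eq] at hc
    simp only [Chain.coeff, trueChain, faultSeq, h1, h2, dif_pos]
    simp [hc, bit]
  · simp only [faultLocs, Finset.mem_insert, Finset.mem_singleton, forall_eq_or_imp, forall_eq] at hc
    simp only [Chain.coeff, trueChain, faultSeq, t.2, dif_pos]
    simp [hc, bit]

end Faults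

/-! ### Probability bounds -/

section Bounds

variable {ι ε : Type*} [Fintype ι] [DecidableEq ι] [DecidableEq ε]

/-- Chernoff bound for the number of events in `Γ`, each of which needs a fault at one of at most
six locations, when no fault affects more than two of them. -/
theorem bern_pow_card_le {r : ι → ℝ} (h0 : ∀ i, 0 ≤ r i) (h1 : ∀ i, r i ≤ 1) {Λ : ℝ} (hΛ : 1 ≤ Λ)
    (hr : ∀ i, r i * Λ ^ 4 ≤ 1) {E : (ι → Bool) → Finset ε} {locs : ε → Finset ι}
    (hE : ∀ ω, ∀ e ∈ E ω, ∃ l ∈ locs e, ω l = true) {Γ : Finset ε}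
    (hmult : ∀ l, (Γ.filter fun e => l ∈ locs e).card ≤ 2) (hloc : ∀ e, (locs e).card ≤ 6) :
    bern r (fun ω => Λ ^ (2 * (Γ ∩ E ω).card)) ≤ 64 ^ Γ.card := by
  set mult : ι → ℕ := fun l => (Γ.filter fun e => l ∈ locs e).card with hmdef
  have hsum : ∑ l, mult l ≤ 6 * Γ.card := by
    have : ∑ l, mult l = ∑ e ∈ Γ, (locs e).card := by
      simp only [hmdef, Finset.card_filter]
      rw [Finset.sum_comm]
      simp
    rw [this, mul_comm, ← smul_eq_mul]
    exact Finset.sum_le_card_nsmul _ _ _ fun e _ => hloc e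
  have hcount : ∀ ω, (Γ ∩ E ω).card ≤ ∑ l, if ω l = true then mult l else 0 := fun ω => by
    have h2 : ∀ l, (if ω l = true then mult l else 0) =
        ∑ e ∈ Γ, if l ∈ locs e ∧ ω l = true then 1 else 0 := fun l => by
      by_cases h : ω l = true <;> simp [h, hmdef]
    simp only [h2]
    rw [Finset.sum_comm, ← Finset.filter_mem_eq_inter, Finset.card_filter]
    refine Finset.sum_le_sum fun e _ => ?_
    split_ifs with he
    · obtain ⟨l, hl, hω⟩ := hE ω e he
      refine le_trans ?_ (Finset.single_le_sum (fun _ _ => Nat.zero_le _) (Finset.mem_univ l))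
      rw [if_pos ⟨hl, hω⟩]
    · exact Nat.zero_le _
  calc bern r (fun ω => Λ ^ (2 * (Γ ∩ E ω).card))
      ≤ bern r fun ω => ∏ l, if ω l = true then Λ ^ (2 * mult l) else 1 := by
        refine bern_mono h0 h1 fun ω => ?_
        refine (pow_le_pow_right₀ hΛ (Nat.mul_le_mul_left 2 (hcount ω))).trans_eq ?_
        rw [Finset.mul_sum, ← Finset.prod_pow_eq_pow_sum]
        refine Finset.prod_congr rfl fun l _ => ?_
        split_ifs <;> simp
    _ = ∏ l, (r l * Λ ^ (2 * mult l) + (1 - r l)) := by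
        rw [bern_prod r fun l b => if b = true then Λ ^ (2 * mult l) else 1]
        simp
    _ ≤ ∏ l, (2 : ℝ) ^ mult l := by
        refine Finset.prod_le_prod (fun l _ => ?_) fun l _ => ?_
        · have := h1 l
          have := mul_nonneg (h0 l) (pow_nonneg (zero_le_one.trans hΛ) (2 * mult l))
          linarith
        · rcases Nat.eq_zero_or_pos (mult l) with hm | hm
          · simp [hm]
          -- A location counts at most twice and each error weighs `Λ ^ 2`, which is why the rates
          -- are compared with `Λ ^ 4`. Each relevant factor is then at most `2`.
          · have h3 : r l * Λ ^ (2 * mult l) ≤ 1 := (mul_le_mul_of_nonneg_left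
              (pow_le_pow_right₀ hΛ (by have := hmult l; simp only [hmdef]; omega)) (h0 l)).trans (hr l)
            have h4 : (2 : ℝ) ^ 1 ≤ 2 ^ mult l := pow_le_pow_right₀ (by norm_num) hm
            have := h0 l
            linarith
    _ = 2 ^ (∑ l, mult l) := by rw [Finset.prod_pow_eq_pow_sum]
    _ ≤ 2 ^ (6 * Γ.card) := pow_le_pow_right₀ (by norm_num) hsum
    _ = 64 ^ Γ.card := by rw [pow_mul]; norm_num

theorem bern_bit (r : ι → ℝ) (l : ι) : bern r (fun ω => if ω l = true then (1 : ℝ) else 0) = r l := by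
  have h : ∀ ω : ι → Bool, (if ω l = true then (1 : ℝ) else 0) =
      ∏ i, if i = l then (if ω i = true then 1 else 0) else 1 := fun ω => by simp
  simp only [h]
  rw [bern_prod r fun i b => if i = l then (if b = true then (1 : ℝ) else 0) else 1]
  rw [Finset.prod_eq_single_of_mem l (Finset.mem_univ _)]
  · simp
  · intro i _ hi
    simp [hi]

theorem bern_sub (r : ι → ℝ) (g h : (ι → Bool) → ℝ) :
    bern r (fun f => g f - h f) = bern r g - bern r h := by
  simp [bern, Finset.sum_sub_distrib, mul_sub]

variable {T n : ℕ}

-- Union bound over clusters, with an exponential Markov bound for each: a bad one has `Λ ^ (2 * (Γ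
-- ∩ E).card) ≥ Λ ^ (m + 1)`. The constant is `25² · 64 = 40000`.
open Classical in
theorem prob_bad_le {r : Fin T × (Fin 6 × Qubit n) → ℝ} (h0 : ∀ i, 0 ≤ r i) (h1 : ∀ i, r i ≤ 1)
    {Λ : ℝ} (hΛ : 1 ≤ Λ) (hr : ∀ i, r i * Λ ^ 4 ≤ 1) (x : Edge T n) (m : ℕ) :
    bern r (fun ω => if Bad ((trueChain (faultSeq ω)).edges T) x m then (1 : ℝ) else 0) ≤
      (40000 / Λ) ^ (m + 1) := by
  have hΛ0 : 0 < Λ := zero_lt_one.trans_le hΛ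
  let E (ω : Fin T × (Fin 6 × Qubit n) → Bool) := (trueChain (faultSeq ω)).edges T
  calc _ ≤ bern r (fun ω => ∑ Γ ∈ (walkRanges nearEdges (2 * m) x).filter (·.card = m + 1),
          (Λ⁻¹ ^ (m + 1)) * Λ ^ (2 * (Γ ∩ E ω).card)) := by
        refine bern_mono h0 h1 fun ω => ?_
        have hnn : ∀ Γ : Finset (Edge T n), 0 ≤ (Λ⁻¹ ^ (m + 1)) * Λ ^ (2 * (Γ ∩ E ω).card) :=
          fun Γ => by positivity
        split_ifs with h
        · obtain ⟨Γ, hΓ, hcard, hle⟩ := h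
          refine le_trans ?_ (Finset.single_le_sum (fun Γ _ => hnn Γ)
            (Finset.mem_filter.2 ⟨hΓ, hcard⟩))
          rw [hcard] at hle
          calc (1 : ℝ) = (Λ⁻¹ ^ (m + 1)) * Λ ^ (m + 1) := by
                rw [← mul_pow, inv_mul_cancel₀ hΛ0.ne', one_pow]
            _ ≤ _ := mul_le_mul_of_nonneg_left (pow_le_pow_right₀ hΛ hle) (by positivity)
        · exact Finset.sum_nonneg fun Γ _ => hnn Γ
    _ = ∑ Γ ∈ (walkRanges nearEdges (2 * m) x).filter (·.card = m + 1),
          (Λ⁻¹ ^ (m + 1)) * bern r fun ω => Λ ^ (2 * (Γ ∩ E ω).card) := by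
        rw [bern_sum]
        exact Finset.sum_congr rfl fun Γ _ => bern_mul_real _ _ _
    _ ≤ ∑ Γ ∈ (walkRanges nearEdges (2 * m) x).filter (·.card = m + 1),
          (Λ⁻¹ ^ (m + 1)) * 64 ^ (m + 1) := by
        refine Finset.sum_le_sum fun Γ hΓ => mul_le_mul_of_nonneg_left ?_ (by positivity)
        have := bern_pow_card_le h0 h1 hΛ hr (E := E) (locs := faultLocs) (Γ := Γ)
          (fun ω e he => exists_fault ω he) (card_filter_faultLocs_le Γ) card_faultLocs_le
        rwa [(Finset.mem_filter.1 hΓ).2] at this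
    _ ≤ (25 : ℝ) ^ (2 * (m + 1)) * ((Λ⁻¹ ^ (m + 1)) * 64 ^ (m + 1)) := by
        rw [Finset.sum_const, nsmul_eq_mul]
        refine mul_le_mul_of_nonneg_right ?_ (by positivity)
        have h2 := (Finset.card_filter_le (walkRanges nearEdges (2 * m) x) (·.card = m + 1)).trans
          (card_walkRanges_le card_nearEdges_le (2 * m) x)
        calc _ ≤ ((25 ^ (2 * m) : ℕ) : ℝ) := by exact_mod_cast h2
          _ = (25 : ℝ) ^ (2 * m) := by push_cast; rfl
          _ ≤ _ := pow_le_pow_right₀ (by norm_num) (by omega)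
    _ = (40000 / Λ) ^ (m + 1) := by
        rw [pow_mul, ← mul_pow, ← mul_pow]
        congr 1
        ring

end Bounds

/-! ### The magnetisation after error correction -/

section Magnetization

variable {T n : ℕ}

theorem abs_magnetization_le (v : Fin n → Bool) : |magnetization v| ≤ n := by
  refine (Finset.abs_sum_le_sum_abs _ _).trans_eq ?_
  have : ∀ i, |if v i = true then (-1 : ℝ) else 1| = 1 := fun i => by split_ifs <;> simp
  simp [this]

/-- With `N` bits different from `κ` the magnetisation is `±(n - 2N)`, and the square `4N²` is
dropped. The result is linear in `N`, so its mean needs only one-probe probabilities. -/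
theorem magnetization_sq_ge (v : Fin n → Bool) (κ : ZMod 2) :
    (n : ℝ) ^ 2 - 4 * n * ∑ i, (if bit (v i) ≠ κ then (1 : ℝ) else 0) ≤ magnetization v ^ 2 := by
  set N := ∑ i, (if bit (v i) ≠ κ then (1 : ℝ) else 0) with hN
  have hκ : ∀ a : ZMod 2, a = 0 ∨ a = 1 := by decide
  have hsum : ∑ i : Fin n, (1 - 2 * (if bit (v i) ≠ κ then (1 : ℝ) else 0)) = n - 2 * N := by
    rw [Finset.sum_sub_distrib, ← Finset.mul_sum]
    simp [hN]
  have h : magnetization v = n - 2 * N ∨ magnetization v = -(n - 2 * N) := by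
    rw [← hsum, magnetization, ← Finset.sum_neg_distrib]
    rcases hκ κ with rfl | rfl
    · left
      refine Finset.sum_congr rfl fun i _ => ?_
      cases v i <;> simp [bit]; norm_num
    · right
      refine Finset.sum_congr rfl fun i _ => ?_
      cases v i <;> simp [bit]; norm_num
  have h2 : magnetization v ^ 2 = (n - 2 * N) ^ 2 := by
    rcases h with h | h <;> rw [h]; ring
  rw [h2]
  nlinarith [sq_nonneg N]

/-- `residual_error` is applied at the reference time of the last round. Later flips, namely layers
`3` and `5` of that round and the flips `f` after the correction, escape all checks and are listed
separately. -/
theorem residual_flips (hT : 0 < T) (D : MinWeightDecoder n) (x : Fin n → Bool)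
    (ω : Fin T × (Fin 6 × Qubit n) → Bool) (f : Fin n → Bool)
    (hbad : ∀ e : Edge T n, ∀ m, T - 1 ≤ m → ¬ Bad ((trueChain (faultSeq ω)).edges T) e m) :
    ∃ κ, ∀ i, bit (corrected D x ω f i) ≠ κ →
      (∃ t : Fin (T - 1), ∃ m, T - 1 - t.1 ≤ m ∧
        Bad ((trueChain (faultSeq ω)).edges T) (.inl (t, i)) m) ∨
      ω (⟨T - 1, by omega⟩, 3, data i) = true ∨ ω (⟨T - 1, by omega⟩, 5, data i) = true ∨
        f i = true := by
  set w := faultSeq ω with hw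
  set s := historyAfter T 0 (fun _ _ => 0) x w with hs
  have hs' : ∀ t < T, ∀ k, s t k = bit (report (w t) (trajectory x w t) k) := fun t ht k => by
    have := historyAfter_add ht 0 (fun _ _ => 0) x w
    rw [zero_add] at this
    rw [hs, this]
  obtain ⟨c, hc, hcorr⟩ := D.spec T s
  have hdec : ∀ a : ZMod 2, bit (decide (a = 1)) = a := by decide
  have h2 : (2 : ZMod 2) = 0 := rfl
  obtain ⟨κ, hκ⟩ := residual_error hc (trueChain_explains x w hs') hT
    (e := fun i => roundState x w (T - 1) i + D.correction T s i) (fun k => by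
      have e1 := hcorr k
      rw [hs' (T - 1) (by omega), bit_report] at e1
      simp only [boundary] at *
      linear_combination e1 + (roundState x w (T - 1) (left k) + roundState x w (T - 1) (right k)) * h2)
    hbad
  refine ⟨κ, fun i hi => ?_⟩
  by_contra! hcon
  obtain ⟨h1, h3, h5, hf⟩ := hcon
  have hne : ¬ (roundState x w (T - 1) i + D.correction T s i ≠ κ) := fun h => by
    obtain ⟨t, m, htm, hB⟩ := hκ i h
    exact h1 t m htm hB
  rw [not_not] at hne
  refine hi ?_
  have hTT : T = T - 1 + 1 := by omega
  have hlast : ∀ l, w (T - 1) l = ω (⟨T - 1, by omega⟩, l) := fun l => by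
    simp only [hw, faultSeq]
    rw [dif_pos (by omega)]
  have htr : trajectory x w T = trajectory x w (T - 1) ∆ roundShift (w (T - 1)) := by
    conv_lhs => rw [hTT]
    rfl
  rw [← hne, corrected, ← hw, ← hs, htr]
  simp only [symmDiff_apply_bool, roundShift, bit_xor, hdec, roundState, hlast]
  rw [Bool.eq_false_of_not_eq_true h3, Bool.eq_false_of_not_eq_true h5,
    Bool.eq_false_of_not_eq_true hf]
  simp only [show bit false = 0 from rfl]
  ring

theorem Bad.lt_card {E : Finset (Edge T n)} {x : Edge T n} {m : ℕ} (h : Bad E x m) :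
    m < Fintype.card (Edge T n) := by
  obtain ⟨Γ, -, hΓ, -⟩ := h
  have := Finset.card_le_univ Γ
  omega

theorem sum_pow_le {q : ℝ} (h0 : 0 ≤ q) (h1 : q ≤ 1 / 2) (a M : ℕ) :
    ∑ m ∈ Finset.Ico a M, q ^ m ≤ 2 * q ^ a := by
  refine (geom_sum_Ico_le_of_lt_one h0 (by linarith)).trans ?_
  rw [div_le_iff₀ (by linarith)]
  nlinarith [pow_nonneg h0 a]

-- A deterministic inequality prepared for averaging. If a cluster spans the history, the first sum
-- is at least `1` and the left side is nonpositive; otherwise the last sum dominates the number of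
-- deviating probes.
open Classical in
theorem magnetization_sq_ge_bad (hT : 0 < T) (D : MinWeightDecoder n) (x : Fin n → Bool)
    (ω : Fin T × (Fin 6 × Qubit n) → Bool) (f : Fin n → Bool) :
    (n : ℝ) ^ 2 - n ^ 2 * (∑ e : Edge T n, ∑ m ∈ Finset.Ico (T - 1) (Fintype.card (Edge T n)),
      if Bad ((trueChain (faultSeq ω)).edges T) e m then (1 : ℝ) else 0) -
      4 * n * ∑ i, ((∑ t : Fin (T - 1), ∑ m ∈ Finset.Ico (T - 1 - t.1) (Fintype.card (Edge T n)),
        if Bad ((trueChain (faultSeq ω)).edges T) (.inl (t, i)) m then (1 : ℝ) else 0) +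
        (if ω (⟨T - 1, by omega⟩, 3, data i) = true then (1 : ℝ) else 0) +
        (if ω (⟨T - 1, by omega⟩, 5, data i) = true then (1 : ℝ) else 0) +
        (if f i = true then (1 : ℝ) else 0)) ≤ magnetization (corrected D x ω f) ^ 2 := by
  have hnn : ∀ (P : Prop) [Decidable P], (0 : ℝ) ≤ if P then 1 else 0 := fun P _ => by
    split_ifs <;> norm_num
  have hc : ∀ i : Fin n, (0 : ℝ) ≤ ∑ t : Fin (T - 1),
      ∑ m ∈ Finset.Ico (T - 1 - t.1) (Fintype.card (Edge T n)),
      if Bad ((trueChain (faultSeq ω)).edges T) (.inl (t, i)) m then (1 : ℝ) else 0 := fun i =>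
    Finset.sum_nonneg fun _ _ => Finset.sum_nonneg fun _ _ => hnn _
  have hB : (0 : ℝ) ≤ ∑ e : Edge T n, ∑ m ∈ Finset.Ico (T - 1) (Fintype.card (Edge T n)),
      if Bad ((trueChain (faultSeq ω)).edges T) e m then (1 : ℝ) else 0 :=
    Finset.sum_nonneg fun _ _ => Finset.sum_nonneg fun _ _ => hnn _
  by_cases hbad : ∀ e : Edge T n, ∀ m, T - 1 ≤ m → ¬ Bad ((trueChain (faultSeq ω)).edges T) e m
  · obtain ⟨κ, hκ⟩ := residual_flips hT D x ω f hbad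
    refine le_trans ?_ (magnetization_sq_ge _ κ)
    have h1 : ∑ i, (if bit (corrected D x ω f i) ≠ κ then (1 : ℝ) else 0) ≤ _ :=
      Finset.sum_le_sum (g := fun i => (∑ t : Fin (T - 1),
        ∑ m ∈ Finset.Ico (T - 1 - t.1) (Fintype.card (Edge T n)),
        if Bad ((trueChain (faultSeq ω)).edges T) (.inl (t, i)) m then (1 : ℝ) else 0) +
        (if ω (⟨T - 1, by omega⟩, 3, data i) = true then (1 : ℝ) else 0) +
        (if ω (⟨T - 1, by omega⟩, 5, data i) = true then (1 : ℝ) else 0) +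
        (if f i = true then (1 : ℝ) else 0)) fun i _ => by
      have n1 := hc i
      have n2 := hnn (ω (⟨T - 1, by omega⟩, 3, data i) = true)
      have n3 := hnn (ω (⟨T - 1, by omega⟩, 5, data i) = true)
      have n4 := hnn (f i = true)
      by_cases hi : bit (corrected D x ω f i) ≠ κ
      swap
      · rw [if_neg hi]
        exact add_nonneg (add_nonneg (add_nonneg n1 n2) n3) n4
      rw [if_pos hi]
      rcases hκ i hi with ⟨t, m, htm, hBad⟩ | h | h | h
      · have : (1 : ℝ) ≤ ∑ t : Fin (T - 1),
            ∑ m ∈ Finset.Ico (T - 1 - t.1) (Fintype.card (Edge T n)),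
            if Bad ((trueChain (faultSeq ω)).edges T) (.inl (t, i)) m then (1 : ℝ) else 0 := by
          refine le_trans ?_ (Finset.single_le_sum (fun t _ => Finset.sum_nonneg fun m _ => hnn _)
            (Finset.mem_univ t))
          refine le_trans ?_ (Finset.single_le_sum (fun m _ => hnn _)
            (Finset.mem_Ico.2 ⟨htm, hBad.lt_card⟩))
          rw [if_pos hBad]
        linarith
      · rw [if_pos h] at n2 ⊢; linarith
      · rw [if_pos h] at n3 ⊢; linarith
      · rw [if_pos h] at n4 ⊢; linarith
    have h2 := mul_le_mul_of_nonneg_left h1 (by positivity : (0 : ℝ) ≤ 4 * n)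
    have h3 := mul_nonneg (sq_nonneg (n : ℝ)) hB
    linarith
  · push Not at hbad
    obtain ⟨e, m, hm, hBad⟩ := hbad
    have h1 : (1 : ℝ) ≤ ∑ e : Edge T n, ∑ m ∈ Finset.Ico (T - 1) (Fintype.card (Edge T n)),
        if Bad ((trueChain (faultSeq ω)).edges T) e m then (1 : ℝ) else 0 := by
      refine le_trans ?_ (Finset.single_le_sum (fun t _ => Finset.sum_nonneg fun m _ => hnn _)
        (Finset.mem_univ e))
      refine le_trans ?_ (Finset.single_le_sum (fun m _ => hnn _)
        (Finset.mem_Ico.2 ⟨hm, hBad.lt_card⟩))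
      rw [if_pos hBad]
    have h2 := mul_le_mul_of_nonneg_left h1 (sq_nonneg (n : ℝ))
    have h3 : (0 : ℝ) ≤ ∑ i, ((∑ t : Fin (T - 1),
        ∑ m ∈ Finset.Ico (T - 1 - t.1) (Fintype.card (Edge T n)),
        if Bad ((trueChain (faultSeq ω)).edges T) (.inl (t, i)) m then (1 : ℝ) else 0) +
        (if ω (⟨T - 1, by omega⟩, 3, data i) = true then (1 : ℝ) else 0) +
        (if ω (⟨T - 1, by omega⟩, 5, data i) = true then (1 : ℝ) else 0) +
        (if f i = true then (1 : ℝ) else 0)) :=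
      Finset.sum_nonneg fun i _ => add_nonneg (add_nonneg (add_nonneg (hc i) (hnn _)) (hnn _)) (hnn _)
    have h4 := mul_nonneg (by positivity : (0 : ℝ) ≤ 4 * n) h3
    have h5 := sq_nonneg (magnetization (corrected D x ω f))
    linarith

theorem roundRate_bounds {η : NoiseRates} {ρ : ℝ} (hρ : 0 ≤ ρ) (hp : 0 ≤ η.p ∧ η.p ≤ ρ)
    (hq : 0 ≤ η.q ∧ η.q ≤ ρ) (hpp : 0 ≤ η.pprep ∧ η.pprep ≤ ρ) (l : Fin 6 × Qubit n) :
    0 ≤ roundRate η n l ∧ roundRate η n l ≤ ρ := by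
  obtain ⟨t, v⟩ := l
  rw [roundRate, rateOn]
  split_ifs
  · fin_cases t <;> assumption
  · exact ⟨le_rfl, hρ⟩

/-- After error correction the mean square magnetisation is of order `n ^ 2`. -/
theorem mean_magnetization_sq_ge {η : NoiseRates} {ρ Λ : ℝ} (hp : 0 ≤ η.p ∧ η.p ≤ ρ)
    (hq : 0 ≤ η.q ∧ η.q ≤ ρ) (hpp : 0 ≤ η.pprep ∧ η.pprep ≤ ρ) (hΛ : 80000 ≤ Λ)
    (hρ : ρ * Λ ^ 4 ≤ 1) (hT : 0 < T) (D : MinWeightDecoder n) (x : Fin n → Bool) :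
    (n : ℝ) ^ 2 * (1 - 4 * n * T * (40000 / Λ) ^ T - 16 * (40000 / Λ) - 12 * ρ) ≤
      bern (fun p : Fin T × (Fin 6 × Qubit n) => roundRate η n p.2) fun ω =>
        bern (fun _ : Fin n => η.p) fun f => magnetization (corrected D x ω f) ^ 2 := by
  classical
  have hρ0 : 0 ≤ ρ := hp.1.trans hp.2
  have hΛ1 : 1 ≤ Λ := by linarith
  have hΛ4 : (1 : ℝ) ≤ Λ ^ 4 := one_le_pow₀ hΛ1
  have hρ1 : ρ ≤ 1 := by nlinarith
  have hb := fun l : Fin 6 × Qubit n => roundRate_bounds hρ0 hp hq hpp l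
  have h0 : ∀ l : Fin T × (Fin 6 × Qubit n), 0 ≤ roundRate η n l.2 := fun l => (hb l.2).1
  have h1 : ∀ l : Fin T × (Fin 6 × Qubit n), roundRate η n l.2 ≤ 1 := fun l =>
    (hb l.2).2.trans hρ1
  have hr : ∀ l : Fin T × (Fin 6 × Qubit n), roundRate η n l.2 * Λ ^ 4 ≤ 1 := fun l =>
    (mul_le_mul_of_nonneg_right (hb l.2).2 (by positivity)).trans hρ
  set q := 40000 / Λ with hqdef
  have hq0 : 0 ≤ q := by positivity
  have hq2 : q ≤ 1 / 2 := by
    rw [hqdef, div_le_iff₀ (by linarith)]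
    linarith
  have hbound := fun (e : Edge T n) (a : ℕ) => calc
    ∑ m ∈ Finset.Ico a (Fintype.card (Edge T n)),
      bern (fun p : Fin T × (Fin 6 × Qubit n) => roundRate η n p.2) (fun ω =>
        if Bad ((trueChain (faultSeq ω)).edges T) e m then (1 : ℝ) else 0)
      ≤ ∑ m ∈ Finset.Ico a (Fintype.card (Edge T n)), q ^ (m + 1) :=
        Finset.sum_le_sum fun m _ => prob_bad_le h0 h1 hΛ1 hr e m
    _ = q * ∑ m ∈ Finset.Ico a (Fintype.card (Edge T n)), q ^ m := by
        rw [Finset.mul_sum]; exact Finset.sum_congr rfl fun m _ => pow_succ' _ _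
    _ ≤ q * (2 * q ^ a) := mul_le_mul_of_nonneg_left (sum_pow_le hq0 hq2 _ _) hq0
    _ = 2 * q ^ (a + 1) := by ring
  have hmono := bern_mono h0 h1 fun ω : Fin T × (Fin 6 × Qubit n) → Bool =>
    bern_mono (r := fun _ : Fin n => η.p) (fun _ => hp.1) (fun _ => hp.2.trans hρ1) fun f =>
      magnetization_sq_ge_bad hT D x ω f
  refine le_trans ?_ hmono
  simp only [bern_sub, bern_const, bern_mul_real, bern_sum, bern_add, bern_bit]
  have hglobal : ∑ e : Edge T n, ∑ m ∈ Finset.Ico (T - 1) (Fintype.card (Edge T n)),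
      bern (fun p : Fin T × (Fin 6 × Qubit n) => roundRate η n p.2) (fun ω =>
        if Bad ((trueChain (faultSeq ω)).edges T) e m then (1 : ℝ) else 0) ≤ 4 * n * T * q ^ T := by
    refine (Finset.sum_le_sum fun e _ => hbound e (T - 1)).trans ?_
    rw [Finset.sum_const, nsmul_eq_mul, Nat.sub_add_cancel hT]
    have hcard : ((Finset.univ : Finset (Edge T n)).card : ℝ) ≤ 2 * n * T := by
      rw [Finset.card_univ]
      have : Fintype.card (Edge T n) ≤ 2 * n * T := by
        simp only [Edge, Fintype.card_sum, Fintype.card_prod, Fintype.card_fin]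
        have e1 : (T - 1) * n ≤ T * n := Nat.mul_le_mul_right _ (by omega)
        have e2 : T * (n - 1) ≤ T * n := Nat.mul_le_mul_left _ (by omega)
        nlinarith
      exact_mod_cast this
    have := mul_le_mul_of_nonneg_right hcard (by positivity : (0 : ℝ) ≤ 2 * q ^ T)
    linarith
  have hcol : ∀ i : Fin n, ∑ t : Fin (T - 1),
      ∑ m ∈ Finset.Ico (T - 1 - t.1) (Fintype.card (Edge T n)),
      bern (fun p : Fin T × (Fin 6 × Qubit n) => roundRate η n p.2) (fun ω =>
        if Bad ((trueChain (faultSeq ω)).edges T) (.inl (t, i)) m then (1 : ℝ) else 0) ≤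
      4 * q := fun i => by
    refine (Finset.sum_le_sum fun t _ => hbound (.inl (t, i)) (T - 1 - t.1)).trans ?_
    rw [Fin.sum_univ_eq_sum_range (fun t => 2 * q ^ (T - 1 - t + 1)) (T - 1),
      ← Finset.sum_range_reflect]
    -- Counted backwards from the last round, the bounds form a geometric series, so the probability
    -- that a probe is hit is bounded independently of `T`.
    have h2 : ∀ j ∈ Finset.range (T - 1), 2 * q ^ (T - 1 - (T - 1 - 1 - j) + 1) ≤ 2 * q * q ^ j :=
      fun j hj => by
      have hj' := Finset.mem_range.1 hj
      rw [show T - 1 - (T - 1 - 1 - j) + 1 = j + 1 + 1 by omega, pow_succ, pow_succ]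
      have := pow_nonneg hq0 j
      nlinarith [mul_nonneg this hq0]
    refine (Finset.sum_le_sum h2).trans ?_
    rw [← Finset.mul_sum, Finset.range_eq_Ico]
    have := sum_pow_le hq0 hq2 0 (T - 1)
    rw [pow_zero] at this
    nlinarith
  have hsum : ∑ i : Fin n, ((∑ t : Fin (T - 1),
      ∑ m ∈ Finset.Ico (T - 1 - t.1) (Fintype.card (Edge T n)),
      bern (fun p : Fin T × (Fin 6 × Qubit n) => roundRate η n p.2) (fun ω =>
        if Bad ((trueChain (faultSeq ω)).edges T) (.inl (t, i)) m then (1 : ℝ) else 0)) +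
      roundRate η n (3, data i) + roundRate η n (5, data i) + η.p) ≤ n * (4 * q + 3 * ρ) := by
    refine (Finset.sum_le_card_nsmul _ _ (4 * q + 3 * ρ) fun i _ => ?_).trans_eq (by simp; ring)
    have := hcol i
    have := (hb (3, data i)).2
    have := (hb (5, data i)).2
    linarith [hp.2]
  have e1 := mul_le_mul_of_nonneg_left hglobal (sq_nonneg (n : ℝ))
  have e2 := mul_le_mul_of_nonneg_left hsum (by positivity : (0 : ℝ) ≤ 4 * n)
  nlinarith

end Magnetization

/-! ### The votes -/

section Votes

variable {η : NoiseRates}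

/-- Exponential moment of a random walk: a bound `A * z ^ c` on the final function picks up one
factor `(1 - e) * z ^ a + e * z ^ b` per step. -/
theorem walk_le {F : ℕ → ℕ → ℝ} {e A z : ℝ} {a b : ℕ} (h0 : 0 ≤ e) (h1 : e ≤ 1)
    (hF : ∀ m c, F (m + 1) c = (1 - e) * F m (c + a) + e * F m (c + b))
    (hA : ∀ c, F 0 c ≤ A * z ^ c) (m c : ℕ) :
    F m c ≤ A * z ^ c * ((1 - e) * z ^ a + e * z ^ b) ^ m := by
  induction m generalizing c with
  | zero => simpa using hA c
  | succ m ih =>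
    rw [hF]
    have e1 := mul_le_mul_of_nonneg_left (ih (c + a)) (sub_nonneg.2 h1)
    have e2 := mul_le_mul_of_nonneg_left (ih (c + b)) h0
    refine (add_le_add e1 e2).trans_eq ?_
    rw [pow_add, pow_add, pow_succ _ m]
    ring

variable (η) in
/-- The probability that a single noisy `X` measurement reports the wrong result. -/
def reportError : ℝ := η.q + η.pprep - 2 * η.q * η.pprep

variable (η) in
/-- The evolution of a functional on an eigenstate of `X`. -/
def xEvolSign (f : ℕ → Bool → ℝ) (v : Bool) (m c : ℕ) : ℝ :=
  xEvol η f m c false + (if v then -1 else 1) * xEvol η f m c true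

/-- On an `X` eigenstate the count of results `-1` is a classical walk. A report is wrong if exactly
one of ancilla preparation and readout fails; bit flips leave `X` results alone. -/
theorem xEvolSign_succ (f : ℕ → Bool → ℝ) (v : Bool) (m c : ℕ) :
    xEvolSign η f v (m + 1) c =
      (1 - reportError η) * xEvolSign η f v m (c + if v then 1 else 0) +
        reportError η * xEvolSign η f v m (c + if v then 0 else 1) := by
  simp only [xEvolSign, xEvol, Fintype.sum_bool, xKernelOne, sgn, reportError]
  cases v <;> simp <;> ring

theorem voteSign_mem (r c : ℕ) : -1 ≤ voteSign r c ∧ voteSign r c ≤ 1 := by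
  rw [voteSign]
  split_ifs <;> norm_num

/-- The indicator of `r < 2 * c` is at most `L ^ (2c - r)`, the form that `walk_le` requires. -/
theorem one_sub_voteSign_le {L : ℝ} (hL : 1 ≤ L) (r c : ℕ) :
    1 - voteSign r c ≤ 2 * (L ^ r)⁻¹ * (L ^ 2) ^ c := by
  have hp : 0 < L ^ r := by positivity
  rw [voteSign, majority]
  split_ifs with h
  · have : L ^ r ≤ (L ^ 2) ^ c := by
      rw [← pow_mul]
      exact pow_le_pow_right₀ hL (of_decide_eq_true h).le
    have := (one_le_div₀ hp).2 this
    rw [div_eq_inv_mul] at this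
    linarith
  · simp only [sub_self]; positivity

theorem one_add_voteSign_le {L : ℝ} (hL : 1 ≤ L) (r c : ℕ) :
    1 + voteSign r c ≤ 2 * L ^ r * ((L ^ 2)⁻¹) ^ c := by
  have hp : 0 < (L ^ 2) ^ c := by positivity
  rw [voteSign, majority]
  split_ifs with h
  · simp only [add_neg_cancel]; positivity
  · have h' : 2 * c ≤ r := by simpa using h
    have : (L ^ 2) ^ c ≤ L ^ r := by
      rw [← pow_mul]
      exact pow_le_pow_right₀ hL h'
    have := (one_le_div₀ hp).2 this
    rw [div_eq_mul_inv, ← inv_pow] at this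
    linarith

theorem xEvolSign_signFactor_zero (r : ℕ) (v : Bool) (c : ℕ) :
    xEvolSign η (signFactor r) v 0 c = voteSign r c := by
  simp [xEvolSign, xEvol, signFactor]

theorem xEvolSign_signFactor_mem (h0 : 0 ≤ reportError η) (h1 : reportError η ≤ 1) (r : ℕ)
    (v : Bool) :
    -1 ≤ xEvolSign η (signFactor r) v r 0 ∧ xEvolSign η (signFactor r) v r 0 ≤ 1 := by
  have u1 := walk_le (F := fun m c => 1 - xEvolSign η (signFactor r) v m c) (A := 2) (z := 1)
    (a := if v then 1 else 0) (b := if v then 0 else 1)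
    h0 h1 (fun m c => by rw [xEvolSign_succ]; ring)
    (fun c => by
      simp only [xEvolSign_signFactor_zero, one_pow]
      linarith [(voteSign_mem r c).1]) r 0
  have u2 := walk_le (F := fun m c => xEvolSign η (signFactor r) v m c) (A := 1) (z := 1)
    h0 h1 (fun m c => by rw [xEvolSign_succ])
    (fun c => by
      simp only [xEvolSign_signFactor_zero, one_pow]
      linarith [(voteSign_mem r c).2]) r 0
  simp only [one_pow, mul_one, sub_add_cancel] at u1 u2
  constructor <;> linarith

theorem chernoff_base_le {e L : ℝ} (h0 : 0 ≤ e) (h1 : e ≤ 1) (hL : 1 ≤ L) (he : e * L ^ 2 ≤ 1)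
    (r : ℕ) : ((1 - e + e * L ^ 2) / L) ^ r ≤ (2 / L) ^ r := by
  have : 0 ≤ e * L ^ 2 := by positivity
  refine pow_le_pow_left₀ (div_nonneg (by linarith) (by linarith)) ?_ r
  exact div_le_div_of_nonneg_right (by linarith) (by linarith)

theorem xEvolSign_signFactor_false {L : ℝ} (h0 : 0 ≤ reportError η) (h1 : reportError η ≤ 1)
    (hL : 1 ≤ L) (he : reportError η * L ^ 2 ≤ 1) (r : ℕ) :
    1 - 2 * (2 / L) ^ r ≤ xEvolSign η (signFactor r) false r 0 := by
  have u := walk_le (F := fun m c => 1 - xEvolSign η (signFactor r) false m c)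
    (A := 2 * (L ^ r)⁻¹) (z := L ^ 2) (a := 0) (b := 1)
    h0 h1 (fun m c => by rw [xEvolSign_succ]; simp only [Bool.false_eq_true, if_false]; ring)
    (fun c => by
      simp only [xEvolSign_signFactor_zero]
      exact one_sub_voteSign_le hL r c) r 0
  have h := chernoff_base_le h0 h1 hL he r
  rw [div_pow] at h
  simp only [pow_zero, mul_one, pow_one] at u
  have e1 : 2 * (L ^ r)⁻¹ * (1 - reportError η + reportError η * L ^ 2) ^ r =
      2 * ((1 - reportError η + reportError η * L ^ 2) ^ r / L ^ r) := by ring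
  linarith

theorem xEvolSign_signFactor_true {L : ℝ} (h0 : 0 ≤ reportError η) (h1 : reportError η ≤ 1)
    (hL : 1 ≤ L) (he : reportError η * L ^ 2 ≤ 1) (r : ℕ) :
    xEvolSign η (signFactor r) true r 0 ≤ -1 + 2 * (2 / L) ^ r := by
  have u := walk_le (F := fun m c => 1 + xEvolSign η (signFactor r) true m c)
    (A := 2 * L ^ r) (z := (L ^ 2)⁻¹) (a := 1) (b := 0)
    h0 h1 (fun m c => by rw [xEvolSign_succ]; simp only [if_true]; ring)
    (fun c => by
      simp only [xEvolSign_signFactor_zero]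
      exact one_add_voteSign_le hL r c) r 0
  have h := chernoff_base_le h0 h1 hL he r
  simp only [pow_zero, mul_one, pow_one] at u
  have hL0 : L ≠ 0 := by positivity
  have e1 : 2 * L ^ r * ((1 - reportError η) * (L ^ 2)⁻¹ + reportError η) ^ r =
      2 * ((1 - reportError η + reportError η * L ^ 2) / L) ^ r := by
    rw [mul_assoc, ← mul_pow]
    congr 2
    field_simp
  linarith

/-- Replacing `signFactor` by `phaseFactor` exchanges the two components, so the damping of the
first votes needs no new estimate. -/
theorem xEvolSign_phaseFactor (r : ℕ) (v : Bool) (m c : ℕ) :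
    xEvolSign η (phaseFactor r) v m c =
      (if v then -1 else 1) * xEvolSign η (signFactor r) v m c := by
  induction m generalizing c with
  | zero => simp [xEvolSign, xEvol, signFactor, phaseFactor]
  | succ m ih =>
    rw [xEvolSign_succ, xEvolSign_succ, ih, ih]
    ring

/-- The three numbers that describe the votes of one qubit are exponentially good. -/
theorem vote_bounds {L : ℝ} (h0 : 0 ≤ reportError η) (h1 : reportError η ≤ 1)
    (hpp : 0 ≤ η.pprep) (hpp' : η.pprep ≤ 1 / 2)
    (hL : 1 ≤ L) (he : reportError η * L ^ 2 ≤ 1) (r : ℕ) :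
    |xEvol η (signFactor r) r 0 false| ≤ (2 / L) ^ r ∧
      1 - 2 * (2 / L) ^ r ≤ xEvol η (signFactor r) r 0 true ∧ xEvol η (signFactor r) r 0 true ≤ 1 ∧
      1 - 3 * (2 / L) ^ r ≤ prepDamping η r ∧ prepDamping η r ≤ 1 := by
  have a1 := xEvolSign_signFactor_mem h0 h1 r false
  have a2 := xEvolSign_signFactor_mem h0 h1 r true
  have a3 := xEvolSign_signFactor_false h0 h1 hL he r
  have a4 := xEvolSign_signFactor_true h0 h1 hL he r
  have b1 := xEvolSign_phaseFactor (η := η) r false r 0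
  have b2 := xEvolSign_phaseFactor (η := η) r true r 0
  simp only [xEvolSign, if_true, Bool.false_eq_true, if_false] at a1 a2 a3 a4 b1 b2
  -- Add and subtract the identities for both eigenstates. Likewise `τ` is half the sum of the two
  -- mean votes; it is not zero in general because ties count as `+1`.
  have c1 : xEvol η (phaseFactor r) r 0 false = xEvol η (signFactor r) r 0 true := by linarith
  have c2 : xEvol η (phaseFactor r) r 0 true = xEvol η (signFactor r) r 0 false := by linarith
  rw [prepDamping, c1, c2, abs_le]
  generalize xEvol η (signFactor r) r 0 false = τ at a1 a2 a3 a4 ⊢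
  have hs : |τ| ≤ (2 / L) ^ r := abs_le.2 ⟨by linarith, by linarith⟩
  have hd : |(1 - 2 * η.pprep) * τ| ≤ |τ| := by
    rw [abs_mul]
    exact mul_le_of_le_one_left (abs_nonneg _) (abs_le.2 ⟨by linarith, by linarith⟩)
  have hd1 := abs_le.1 hd
  refine ⟨⟨by linarith, by linarith⟩, by linarith, by linarith, by linarith [hd1.1], ?_⟩
  rcases abs_cases τ with h | h <;> linarith [hd1.2]

end Votes

/-! ### The slope of the output distribution -/

section Slope

variable {ι : Type*} [Fintype ι] [DecidableEq ι] {T n : ℕ}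

theorem hasDerivAt_bern {r : ι → ℝ} {g : ℝ → (ι → Bool) → ℝ} {g' : (ι → Bool) → ℝ} {θ : ℝ}
    (h : ∀ f, HasDerivAt (fun t => g t f) (g' f) θ) :
    HasDerivAt (fun t => bern r (g t)) (bern r g') θ :=
  HasDerivAt.fun_sum fun f _ => (h f).const_smul (bernWeight r f)

theorem bern_magnetization (p : ℝ) (v : Fin n → Bool) :
    bern (fun _ : Fin n => p) (fun f => magnetization (v ∆ f)) = (1 - 2 * p) * magnetization v := by
  have h : ∀ f : Fin n → Bool, magnetization (v ∆ f) =
      ∑ i, (if v i then -1 else 1) * (1 - 2 * (if f i = true then (1 : ℝ) else 0)) := fun f =>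
    Finset.sum_congr rfl fun i _ => by
      rw [symmDiff_apply_bool]
      cases v i <;> cases f i <;> norm_num
  simp only [h, bern_sum, bern_mul_real, bern_sub, bern_const, bern_bit]
  rw [magnetization, Finset.mul_sum]
  exact Finset.sum_congr rfl fun i _ => mul_comm _ _

/-- At `θ = 0` the sine contributes the magnetisation after the flips `f'`, whose mean is `1 - 2p`
times that before them. The phase gate supplies the other factor, hence the square. -/
theorem hasDerivAt_signalTerm (η : NoiseRates) (D : MinWeightDecoder n) (x : Fin n → Bool) :
    HasDerivAt (fun θ => signalTerm η T D θ x) ((n : ℝ)⁻¹ * (1 - 2 * η.p) *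
      bern (fun p : Fin T × (Fin 6 × Qubit n) => roundRate η n p.2) fun ω =>
        bern (fun _ : Fin n => η.p) fun f => magnetization (corrected D x ω f) ^ 2) 0 := by
  simp only [← bern_mul_real]
  refine hasDerivAt_bern fun ω => hasDerivAt_bern fun f => ?_
  have h := (hasDerivAt_bern (r := fun _ : Fin n => η.p) (θ := 0) (fun f' : Fin n → Bool =>
    ((hasDerivAt_id (0 : ℝ)).mul_const (magnetization (corrected D x ω f ∆ f'))).sin)).const_mul
      ((n : ℝ)⁻¹ * magnetization (corrected D x ω f))
  refine h.congr_deriv ?_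
  simp only [id, zero_mul, Real.cos_zero, one_mul, bern_magnetization]
  ring

theorem mean_magnetization_sq_le {η : NoiseRates} (hp : 0 ≤ η.p ∧ η.p ≤ 1)
    (hq : 0 ≤ η.q ∧ η.q ≤ 1) (hpp : 0 ≤ η.pprep ∧ η.pprep ≤ 1) (D : MinWeightDecoder n)
    (x : Fin n → Bool) :
    (bern (fun p : Fin T × (Fin 6 × Qubit n) => roundRate η n p.2) fun ω =>
      bern (fun _ : Fin n => η.p) fun f => magnetization (corrected D x ω f) ^ 2) ≤ (n : ℝ) ^ 2 := by
  have hb := fun l : Fin 6 × Qubit n => roundRate_bounds zero_le_one hp hq hpp l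
  have h : ∀ v : Fin n → Bool, magnetization v ^ 2 ≤ (n : ℝ) ^ 2 := fun v =>
    sq_le_sq' (abs_le.1 (abs_magnetization_le v)).1 (abs_le.1 (abs_magnetization_le v)).2
  have h1 := bern_mono (r := fun p : Fin T × (Fin 6 × Qubit n) => roundRate η n p.2)
    (fun l => (hb l.2).1) (fun l => (hb l.2).2) fun ω => bern_mono (r := fun _ : Fin n => η.p)
      (fun _ => hp.1) (fun _ => hp.2) fun f => h (corrected D x ω f)
  simpa only [bern_const] using h1

/-- Both outcomes have slopes `±g'/2` and probabilities `(1 ± t)/2`, and `1/(1 + t) + 1/(1 - t) =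
2/(1 - t²)`. -/
theorem fisherInformation_eq {P : Bool → ℝ → ℝ} {t g' : ℝ} {g : ℝ → ℝ} (hg : HasDerivAt g g' 0)
    (hg0 : g 0 = 0) (ht : |t| < 1)
    (hP : ∀ b θ, P b θ = 1 / 2 + (if b then -1 else 1) / 2 * (t - g θ)) :
    fisherInformation P 0 = g' ^ 2 / (1 - t ^ 2) := by
  obtain ⟨h1, h2⟩ := abs_lt.1 ht
  have hd : ∀ b, HasDerivAt (P b) ((if b then -1 else 1) / 2 * (-g')) 0 := fun b => by
    have := ((hg.const_sub t).const_mul ((if b = true then (-1 : ℝ) else 1) / 2)).const_add (1 / 2)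
    exact this.congr_of_eventuallyEq (Filter.Eventually.of_forall fun θ => hP b θ)
  have hval : ∀ b, P b 0 = 1 / 2 + (if b then -1 else 1) / 2 * t := fun b => by
    rw [hP, hg0, sub_zero]
  have hne : ∀ b, P b 0 ≠ 0 := fun b => by
    rw [hval]
    cases b <;> simp <;> intro h <;> linarith
  have hl : ∀ b, deriv (fun θ => Real.log (P b θ)) 0 = _ := fun b => ((hd b).log (hne b)).deriv
  rw [fisherInformation]
  simp only [hl, Fintype.sum_bool, hval, if_true, Bool.false_eq_true, if_false]
  have e1 : (1 / 2 + -1 / 2 * t : ℝ) ≠ 0 := fun h => by linarith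
  have e2 : (1 / 2 + 1 / 2 * t : ℝ) ≠ 0 := fun h => by linarith
  have e3 : (1 - t ^ 2 : ℝ) ≠ 0 := fun h => by nlinarith
  have e4 : (1 - t : ℝ) ≠ 0 := fun h => by linarith
  have e5 : (1 + t : ℝ) ≠ 0 := fun h => by linarith
  rw [show (1 / 2 + -1 / 2 * t : ℝ) = (1 - t) / 2 by ring,
    show (1 / 2 + 1 / 2 * t : ℝ) = (1 + t) / 2 by ring,
    show (1 - t ^ 2 : ℝ) = (1 - t) * (1 + t) by ring]
  field_simp
  ring

end Slope

/-! ### Heisenberg scaling -/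

section Scaling

theorem pow_ceil_mul_log_le {a x : ℝ} (ha : 0 < a) (hx0 : 0 ≤ x) (hx : x ≤ Real.exp (-(2 / a)))
    {n : ℕ} (hn : 0 < n) : x ^ ⌈a * Real.log n⌉₊ ≤ ((n : ℝ) ^ 2)⁻¹ := by
  have hn' : (0 : ℝ) < n := Nat.cast_pos.2 hn
  refine (pow_le_pow_left₀ hx0 hx _).trans ?_
  rw [← Real.exp_nat_mul]
  have h1 : a * Real.log n ≤ ⌈a * Real.log n⌉₊ := Nat.le_ceil _
  have h2 : (⌈a * Real.log n⌉₊ : ℝ) * -(2 / a) ≤ -(2 * Real.log n) := by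
    have := mul_le_mul_of_nonneg_right h1 (by positivity : 0 ≤ 2 / a)
    have e : a * Real.log n * (2 / a) = 2 * Real.log n := by field_simp
    linarith
  refine (Real.exp_le_exp.2 h2).trans_eq ?_
  rw [Real.exp_neg, ← Nat.cast_two, Real.exp_nat_mul, Real.exp_log hn']

theorem natCast_mul_pow_le {q : ℝ} (hq : 0 ≤ q) (T : ℕ) : T * q ^ T ≤ (2 * q) ^ T := by
  rw [mul_pow]
  refine mul_le_mul_of_nonneg_right ?_ (pow_nonneg hq T)
  exact_mod_cast Nat.lt_two_pow_self.le

theorem reportError_bounds {η : NoiseRates} {ρ : ℝ} (hρ : ρ ≤ 1 / 2) (hq : 0 ≤ η.q ∧ η.q ≤ ρ)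
    (hpp : 0 ≤ η.pprep ∧ η.pprep ≤ ρ) : 0 ≤ reportError η ∧ reportError η ≤ 2 * ρ := by
  rw [reportError]
  have := mul_nonneg hq.1 hpp.1
  constructor
  · nlinarith [mul_nonneg hq.1 (sub_nonneg.2 hpp.2)]
  · linarith

/-- Bounds on the Fisher information of a protocol whose votes and error correction succeed. -/
theorem fisherInformation_bounds {η : NoiseRates} {r T n : ℕ} {D : MinWeightDecoder n} {ρ β : ℝ}
    (hn : 0 < n) (hT : 0 < T) (hρ : ρ ≤ 1 / 4) (hp : 0 ≤ η.p ∧ η.p ≤ ρ)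
    (hq : 0 ≤ η.q ∧ η.q ≤ ρ) (hpp : 0 ≤ η.pprep ∧ η.pprep ≤ ρ)
    (hτ : |xEvol η (signFactor r) r 0 false| ≤ β)
    (hκ : 1 - 3 * β ≤ xEvol η (signFactor r) r 0 true) (hκ' : xEvol η (signFactor r) r 0 true ≤ 1)
    (hd : 1 - 3 * β ≤ prepDamping η r) (hd' : prepDamping η r ≤ 1) (hβ : n * β ≤ 1 / 12)
    (hmag : ∀ x, (n : ℝ) ^ 2 / 2 ≤
      bern (fun p : Fin T × (Fin 6 × Qubit n) => roundRate η n p.2) fun ω =>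
        bern (fun _ : Fin n => η.p) fun f => magnetization (corrected D x ω f) ^ 2) :
    (n : ℝ) ^ 2 / 64 ≤ fisherInformation (outcomeProb η r T D) 0 ∧
      fisherInformation (outcomeProb η r T D) 0 ≤ 2 * n ^ 2 := by
  have hn1 : (1 : ℝ) ≤ n := by exact_mod_cast hn
  have hβ0 : 0 ≤ β := (abs_nonneg _).trans hτ
  have hβ1 : β ≤ 1 / 12 := by nlinarith
  set τ := xEvol η (signFactor r) r 0 false
  set κ := xEvol η (signFactor r) r 0 true
  set δ := prepDamping η r
  have hA0 : 0 ≤ κ * δ := mul_nonneg (by linarith) (by linarith)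
  have hA1 : κ * δ ≤ 1 := mul_le_one₀ hκ' (by linarith) hd'
  have hA : 1 / 2 ≤ (κ * δ) ^ n := by
    -- Each factor is at least `1 - 3β`. Bernoulli's inequality then loses `6nβ ≤ 1/2`, the origin
    -- of the constant `1/12`.
    have h1 : 1 - 6 * β ≤ κ * δ := by nlinarith
    have h2 := one_add_mul_le_pow (a := κ * δ - 1) (by linarith) n
    rw [add_sub_cancel] at h2
    nlinarith
  have hA' : (κ * δ) ^ n ≤ 1 := pow_le_one₀ hA0 hA1
  have ht : |τ ^ n| ≤ 1 / 2 := by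
    rw [abs_pow]
    exact (pow_le_of_le_one (abs_nonneg _) (by linarith) hn.ne').trans (by linarith)
  set M := fun x : Fin n → Bool => bern (fun p : Fin T × (Fin 6 × Qubit n) => roundRate η n p.2)
    fun ω => bern (fun _ : Fin n => η.p) fun f => magnetization (corrected D x ω f) ^ 2 with hM
  have hM' : ∀ x, M x ≤ (n : ℝ) ^ 2 := fun x =>
    mean_magnetization_sq_le ⟨hp.1, by linarith⟩ ⟨hq.1, by linarith⟩ ⟨hpp.1, by linarith⟩ D x
  set avg := (2 ^ n : ℝ)⁻¹ * ∑ x, M x with havg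
  have hc : (∑ _x : Fin n → Bool, (n : ℝ) ^ 2) = 2 ^ n * n ^ 2 := by simp
  have h2n : (0 : ℝ) < 2 ^ n := by positivity
  have hS1 : ∑ x, M x ≤ 2 ^ n * (n : ℝ) ^ 2 := hc ▸ Finset.sum_le_sum fun x _ => hM' x
  have hS2 : 2 ^ n * (n : ℝ) ^ 2 / 2 ≤ ∑ x, M x := by
    rw [← hc, Finset.sum_div]
    exact Finset.sum_le_sum fun x _ => hmag x
  have havg1 : avg ≤ (n : ℝ) ^ 2 := (inv_mul_le_iff₀ h2n).2 hS1
  have havg2 : (n : ℝ) ^ 2 / 2 ≤ avg := (le_inv_mul_iff₀ h2n).2 (by linarith)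
  set G := (κ * δ) ^ n * ((n : ℝ)⁻¹ * (1 - 2 * η.p) * avg) with hG
  have hg : HasDerivAt (fun θ => (κ * δ) ^ n * ((2 ^ n)⁻¹ * ∑ x, signalTerm η T D θ x)) G 0 := by
    have := ((HasDerivAt.fun_sum (u := Finset.univ) fun x _ =>
      hasDerivAt_signalTerm (T := T) η D x).const_mul ((2 ^ n : ℝ)⁻¹)).const_mul ((κ * δ) ^ n)
    refine this.congr_deriv ?_
    rw [← Finset.mul_sum, hG, havg]
    ring
  have hg0 : (κ * δ) ^ n * ((2 ^ n)⁻¹ * ∑ x, signalTerm η T D 0 x) = 0 := by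
    have : ∀ x, signalTerm η T D 0 x = 0 := fun x => by simp [signalTerm, bern_const]
    simp [this]
  rw [fisherInformation_eq hg hg0 (by linarith) fun b θ => outcomeProb_eq hn r hT D b]
  have hn0 : (0 : ℝ) < n := by linarith
  have hu1 : (n : ℝ)⁻¹ * (1 - 2 * η.p) * avg ≤ n := by
    rw [mul_assoc, inv_mul_le_iff₀ hn0]
    have := mul_le_mul (by linarith [hp.1] : 1 - 2 * η.p ≤ 1) havg1
      (le_trans (by positivity) havg2) zero_le_one
    linarith
  have hu2 : (n : ℝ) / 4 ≤ (n : ℝ)⁻¹ * (1 - 2 * η.p) * avg := by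
    rw [mul_assoc, le_inv_mul_iff₀ hn0]
    have := mul_le_mul (by linarith [hp.2] : 1 / 2 ≤ 1 - 2 * η.p) havg2
      (by positivity) (by linarith [hp.2])
    linarith
  have hG1 : G ≤ n := by
    have := mul_le_mul hA' hu1 (by linarith) zero_le_one
    linarith
  have hG2 : (n : ℝ) / 8 ≤ G := by
    have := mul_le_mul hA hu2 (by linarith) (by linarith)
    linarith
  have hGs1 : G ^ 2 ≤ n ^ 2 := pow_le_pow_left₀ (by linarith) hG1 2
  have hGs2 : ((n : ℝ) / 8) ^ 2 ≤ G ^ 2 := pow_le_pow_left₀ (by linarith) hG2 2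
  have ht2 : (τ ^ n) ^ 2 ≤ 1 / 2 := by
    rw [← sq_abs]
    nlinarith [abs_nonneg (τ ^ n)]
  have e1 := mul_nonneg (sq_nonneg (n : ℝ)) (sq_nonneg (τ ^ n))
  have e2 := mul_le_mul_of_nonneg_left ht2 (sq_nonneg (n : ℝ))
  constructor
  · rw [le_div_iff₀ (by linarith)]
    refine le_trans ?_ hGs2
    linarith
  · rw [div_le_iff₀ (by linarith)]
    refine hGs1.trans ?_
    linarith

theorem fisherInformation_isTheta (a b : ℝ) (ha : 0 < a) (hb : 0 < b) :
    ∃ ρ : ℝ, 0 < ρ ∧ ∀ η : NoiseRates, 0 ≤ η.p ∧ η.p ≤ ρ → 0 ≤ η.q ∧ η.q ≤ ρ →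
      0 ≤ η.pprep ∧ η.pprep ≤ ρ → ∀ D : ∀ n : ℕ, MinWeightDecoder n,
        (fun n : ℕ => fisherInformation
          (outcomeProb η ⌈a * Real.log n⌉₊ ⌈b * Real.log n⌉₊ (D n)) 0)
          =Θ[atTop] (fun n : ℕ => (n : ℝ) ^ 2) := by
  -- Makes `2 / L = exp (-2/a)`, so that `(2/L)^r ≤ n^(-2)`: one power of `n` beats the `n`-th power
  -- of the vote factors, the other leaves room.
  set L : ℝ := 2 * Real.exp (2 / a) with hL
  -- Makes `40000 / Λ = exp (-2/b) / 256`. The exponential beats the number of possible starting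
  -- edges through `T q^T ≤ (2q)^T ≤ n^(-2)`; the factor `256` makes the density of residual flips
  -- small.
  set Λ : ℝ := 40000 * (256 * Real.exp (2 / b)) with hΛ
  have hL1 : 1 ≤ L := by linarith [Real.one_le_exp (by positivity : 0 ≤ 2 / a)]
  have hΛ1 : 80000 ≤ Λ := by linarith [Real.one_le_exp (by positivity : 0 ≤ 2 / b)]
  have hL0 : 0 < L ^ 2 := by positivity
  have hΛ0 : 0 < Λ ^ 4 := by positivity
  refine ⟨min (Λ ^ 4)⁻¹ (2 * L ^ 2)⁻¹, by positivity, fun η hp hq hpp D => ?_⟩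
  set ρ := min (Λ ^ 4)⁻¹ (2 * L ^ 2)⁻¹ with hρ
  have hρΛ : ρ * Λ ^ 4 ≤ 1 := by
    have := mul_le_mul_of_nonneg_right (min_le_left (Λ ^ 4)⁻¹ (2 * L ^ 2)⁻¹) hΛ0.le
    rwa [inv_mul_cancel₀ hΛ0.ne'] at this
  have hρL : ρ * (2 * L ^ 2) ≤ 1 := by
    have := mul_le_mul_of_nonneg_right (min_le_right (Λ ^ 4)⁻¹ (2 * L ^ 2)⁻¹)
      (by positivity : 0 ≤ 2 * L ^ 2)
    rwa [inv_mul_cancel₀ (by positivity)] at this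
  have hρ0 : 0 ≤ ρ := hp.1.trans hp.2
  have hρ1 : ρ ≤ 1 / 96 := by
    have : Λ ≤ Λ ^ 4 := le_self_pow₀ (by linarith) (by norm_num)
    nlinarith
  obtain ⟨he0, he2⟩ := reportError_bounds (by linarith) hq hpp
  have heL : reportError η * L ^ 2 ≤ 1 := by nlinarith
  have hx : 2 / L = Real.exp (-(2 / a)) := by
    rw [hL, Real.exp_neg, div_mul_eq_div_div, div_self two_ne_zero, one_div]
  have hq0 : 40000 / Λ = (Real.exp (2 / b))⁻¹ / 256 := by
    rw [hΛ]
    field_simp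
  have hq1 : 40000 / Λ ≤ 1 / 256 := by
    rw [hq0]
    have := inv_le_one_of_one_le₀ (Real.one_le_exp (by positivity : 0 ≤ 2 / b))
    linarith
  have key : ∀ᶠ n : ℕ in atTop, (n : ℝ) ^ 2 / 64 ≤ fisherInformation
      (outcomeProb η ⌈a * Real.log n⌉₊ ⌈b * Real.log n⌉₊ (D n)) 0 ∧ fisherInformation
      (outcomeProb η ⌈a * Real.log n⌉₊ ⌈b * Real.log n⌉₊ (D n)) 0 ≤ 2 * n ^ 2 := by
    -- For `n ≥ 32` the losses `4nTq^T`, `16q` and `12ρ` are at most `1/8`, `1/16` and `1/8`,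
    -- together below `1/2`.
    filter_upwards [eventually_ge_atTop 32] with n hn
    have hn0 : 0 < n := by omega
    have hnr : (32 : ℝ) ≤ n := by exact_mod_cast hn
    have hnp : (0 : ℝ) < n := by linarith
    have hinv : (n : ℝ) * ((n : ℝ) ^ 2)⁻¹ ≤ 1 / 32 := by
      rw [pow_two, mul_inv, mul_inv_cancel_left₀ hnp.ne', ← one_div]
      exact one_div_le_one_div_of_le (by norm_num) hnr
    have hT : 0 < ⌈b * Real.log n⌉₊ := Nat.ceil_pos.2 (mul_pos hb (Real.log_pos (by linarith)))
    obtain ⟨hτ, hκ, hκ', hd, hd'⟩ := vote_bounds he0 (by linarith) hpp.1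
      (by linarith [hpp.2]) hL1 heL ⌈a * Real.log n⌉₊
    have hβ := pow_ceil_mul_log_le ha (by positivity) hx.le hn0
    have hβ0 : 0 ≤ (2 / L) ^ ⌈a * Real.log n⌉₊ := by positivity
    refine fisherInformation_bounds hn0 hT (by linarith) hp hq hpp hτ (by linarith) hκ' hd hd'
      ((mul_le_mul_of_nonneg_left hβ hnp.le).trans (by linarith)) fun x => ?_
    refine le_trans ?_ (mean_magnetization_sq_ge hp hq hpp hΛ1 hρΛ hT (D n) x)
    have h1 := natCast_mul_pow_le (by positivity : 0 ≤ 40000 / Λ) ⌈b * Real.log n⌉₊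
    have h2 := pow_ceil_mul_log_le hb (by positivity : 0 ≤ 2 * (40000 / Λ)) (by
      rw [hq0, Real.exp_neg]
      have : 0 < (Real.exp (2 / b))⁻¹ := by positivity
      linarith) hn0
    have h3 := mul_le_mul_of_nonneg_left (h1.trans h2) hnp.le
    rw [div_eq_mul_one_div]
    refine mul_le_mul_of_nonneg_left ?_ (sq_nonneg _)
    linarith
  have hcast : ∀ n : ℕ, ‖(n : ℝ) ^ 2‖ = (n : ℝ) ^ 2 := fun n => Real.norm_of_nonneg (sq_nonneg _)
  constructor
  · refine IsBigO.of_bound 2 (key.mono fun n h => ?_)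
    rw [hcast, Real.norm_of_nonneg (le_trans (by positivity) h.1)]
    exact h.2
  · refine IsBigO.of_bound 64 (key.mono fun n h => ?_)
    rw [hcast, Real.norm_of_nonneg (le_trans (by positivity) h.1)]
    linarith [h.1]

end Scaling

end FTSensing

end

theorem mainTheorem1 (a b : ℝ) (ha : 0 < a) (hb : 0 < b) :
    ∃ pth qth prepth : ℝ, 0 < pth ∧ 0 < qth ∧ 0 < prepth ∧
      ∀ η : FTSensing.NoiseRates,
        0 ≤ η.p → η.p < pth → 0 ≤ η.q → η.q < qth → 0 ≤ η.pprep → η.pprep < prepth →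
        ∀ D : ∀ n : ℕ, FTSensing.MinWeightDecoder n,
          (fun n : ℕ => FTSensing.fisherInformation
            (FTSensing.outcomeProb η ⌈a * Real.log n⌉₊ ⌈b * Real.log n⌉₊ (D n)) 0)
            =Θ[atTop] (fun n : ℕ => (n : ℝ) ^ 2) := by
  obtain ⟨ρ, hρ, h⟩ := FTSensing.fisherInformation_isTheta a b ha hb
  exact ⟨ρ, ρ, ρ, hρ, hρ, hρ, fun η hp hp' hq hq' hpp hpp' D =>
    h η ⟨hp, hp'.le⟩ ⟨hq, hq'.le⟩ ⟨hpp, hpp'.le⟩ D⟩
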